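/- **Setting.** For odd $p$ let $\mathbb R_p=\{\pm\sum_{i=1}^{p-1}b_i2^{(p-1)/2-i}: b_i\in\{0,1\}\}$ be the numbers of precision $p$ (for even $p$ read $(p-1)/2$ as its integer part, with $\mathbb R_p$ the multiples $k2^{-\lfloor (p-1)/2\rfloor}$, $|k|<2^{p-1}$). Arithmetic of precision $p$ computes each operation exactly and then rounds the result to a nearest element of $\mathbb R_p$. For $n$-vertex graphs the vocabulary $V$ consists of the numbers $1,\dots,n$ and the six special tokens $\texttt{<s>},\sim,\mathrm{YES},\mathrm{NO},\texttt{<StartSearch>},\texttt{<EndSearch>}$. A graph $G$ on the vertex set $\{1,\dots,n\}$ with edges $\{u_1,v_1\},\dots,\{u_m,v_m\}$, $u_i<v_i$, listed in an arbitrary order, is given as the sequence $\texttt{<s>},u_1,\sim,v_1,\dots,u_m,\sim,v_m$. An embedding of dimension $d$ is a word embedding $W^{(E)}_v\in\mathbb R^d$ ($v\in V$) and a position embedding $W^{(P)}_l\in\mathbb R^d$ ($l\ge1$); $\mathrm{Emb}(\mathcal S)$ is the matrix with columns $W^{(E)}_{\mathcal S_l}+W^{(P)}_l$, computed in precision $p$.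 The standard embedding, with coordinate vectors $w_1,\dots,w_d$, is $W^{(E)}_i=i\,w_1+i^2w_2$ for a number $i$, $W^{(E)}=w_{2+k}$ for the $k$-th special token, and $W^{(P)}_l=l\,w_d$. A language model $M$ maps nonempty sequences over $V$ to probability distributions on $V$. Starting from the input sequence, one repeatedly appends a token of maximal probability under $M$; the process stops when this token is $\mathrm{YES}$ or $\mathrm{NO}$. $M$ solves IsTree on $n$ vertices with a chain of thought (CoT) of length at most $T$ if, for every graph $G$ on $n$ vertices and every order of its edges, the process stops after at most $T$ tokens have been appended before the answer, and the answer is $\mathrm{YES}$ if and only if $G$ is a tree. It solves IsTree with any length of CoT if the process always stops with the right answer. A Transformer of precision $p$ with embedding dimension $d$, $L$ layers, $H$ heads and width $w$ has all parameters in $\mathbb R_p$ and computes in precision $p$. Its output at $\mathcal S$ is $\mathrm{softmax}(W^{(E)}f_L(\cdots f_1(\mathrm{Emb}(\mathcal S))))$ at the last position, where $$f(X)=X+\mathcal A(X)+g(X+\mathcal A(X)),\qquad \mathcal A(X)=\sum_{h=1}^H W^{(V,h)}X\,\mathrm{softmax}\Big(\tfrac{(W^{(K,h)}X)^\top W^{(Q,h)}X}{\sqrt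 d}+C\Big),$$ $C$ is the causal mask, the softmax is column-wise, and $g$ acts on columns by $g(x)=W_3(\mathrm{ReLU}(W_1x+b_1)\otimes(W_2x+b_2))+b_3$ with hidden width $w$. (The final softmax of the $p$-bit vector is not rounded.) An RNN has a state $s\in\mathbb R_p^{\Lambda}$, an initial state $s_0$, and arbitrary functions $\mathbf t:\mathbb R_p^\Lambda\times\mathbb R_p^d\to\mathbb R_p^\Lambda$ and $\mathbf o:\mathbb R_p^\Lambda\to\mathbb R_p^d$. With $s_k=\mathbf t(s_{k-1},\mathrm{Emb}(\mathcal S)_{:,k})$, its output at a sequence $\mathcal S$ of length $l$ is $\mathrm{softmax}(W^{(E)}\mathbf o(s_l))$, the argument of the softmax being computed in precision $p$. Its memory is $\Lambda p$ bits. **Theorem.** 1. There are constants $d>8$, $L,H,w,C$ such that for every $n\ge1$ there are an odd $p\le C(\lfloor\log_2 n\rfloor+1)$ and a Transformer of precision $p$, with embedding dimension $d$, $L$ layers, $H$ heads and width $w$, which with the standard embedding solves IsTree on $n$ vertices with a CoT of length at most $Cn$, whatever rule is used to break ties in the choice of a most probable token. 2. For every family of RNNs $R_n$ ($n\ge 0$)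 with precision $p_n$ and state dimension $\Lambda_n$ such that $\Lambda_np_n=o(n)$, with arbitrary embeddings of arbitrary dimensions $d_n$, and for all sufficiently large $n$: $R_n$ does not solve IsTree on $n$ vertices with any length of CoT, under any rule for breaking ties. -/

import Mathlib

open Filter Asymptotics

noncomputable section

namespace SeqModel

/-! ### Fixed-precision arithmetic -/

/-- The real numbers representable with `p` bits: a sign and `p - 1` binary digits, of weights
`2 ^ ((p - 1) / 2 - i)` for `i = 1, …, p - 1`. The digits are collected into one integer of absolute
value less than `2 ^ (p - 1)`, in units of the last digit's weight `2 ^ (-(p - 1) / 2)`. -/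
def FixedNum (p : ℕ) : Set ℝ :=
  {x | ∃ k : ℤ, |k| < 2 ^ (p - 1) ∧ x = (k : ℝ) / 2 ^ ((p - 1) / 2)}

/-- Rounding to the nearest element of `FixedNum p`: round to the nearest multiple of the unit
(upwards from a midpoint), then saturate. -/
def rnd (p : ℕ) (x : ℝ) : ℝ :=
  ((max (-(2 ^ (p - 1) - 1)) (min (2 ^ (p - 1) - 1) (round (x * 2 ^ ((p - 1) / 2)))) : ℤ) : ℝ) /
    2 ^ ((p - 1) / 2)

theorem rnd_mem (p : ℕ) (x : ℝ) : rnd p x ∈ FixedNum p := by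
  have h : (1 : ℤ) ≤ 2 ^ (p - 1) := one_le_pow₀ (by norm_num)
  refine ⟨_, ?_, rfl⟩
  rw [abs_lt]
  constructor
  · exact lt_of_lt_of_le (by linarith) (le_max_left _ _)
  · exact lt_of_le_of_lt (max_le (by linarith) (min_le_left _ _))
      (by linarith : (2 : ℤ) ^ (p - 1) - 1 < 2 ^ (p - 1))

/-- Rounding, as a map into the representable numbers. -/
def rndRep (p : ℕ) (x : ℝ) : FixedNum p := ⟨rnd p x, rnd_mem p x⟩

/-- Entrywise rounding of a matrix. -/
def rndM (p : ℕ) {m n : Type*} (A : Matrix m n ℝ) : Matrix m n ℝ := A.map (rnd p)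

/-- A matrix of representable numbers, as a real matrix. -/
def toReal {p : ℕ} {m n : Type*} (A : Matrix m n (FixedNum p)) : Matrix m n ℝ :=
  A.map fun x => (x : ℝ)

/-! ### Vocabulary and embeddings -/

/-- The special tokens. -/
inductive Special where
  | start
  | edge
  | yes
  | no
  | startSearch
  | endSearch
  deriving DecidableEq

instance : Fintype Special where
  elems := {.start, .edge, .yes, .no, .startSearch, .endSearch}
  complete := by intro x; cases x <;> decide

/-- The (one-based) number of a special token. -/
def Special.index : Special → ℕ
  | .start => 1
  | .edge => 2
  | .yes => 3
  | .no => 4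
  | .startSearch => 5
  | .endSearch => 6

/-- The vocabulary for graphs on `n` vertices: the number tokens `1, …, n` (the token `i + 1` is
`Sum.inl i`) and the special tokens. -/
abbrev Token (n : ℕ) : Type := Fin n ⊕ Special

/-- A word embedding and a position embedding of dimension `d`. Positions are one-based. -/
structure Embedding (V : Type) (d : ℕ) where
  word : V → Fin d → ℝ
  pos : ℕ → Fin d → ℝ

/-- The embedding of token `v` at position `l`, in precision `p`. -/
def Embedding.vec {V : Type} {d : ℕ} (E : Embedding V d) (p : ℕ) (v : V) (l : ℕ) :
    Fin d → FixedNum p :=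
  fun j => rndRep p (rnd p (E.word v j) + rnd p (E.pos l j))

/-- The `d × l` matrix of embeddings of a sequence of length `l`. -/
def Embedding.emb {V : Type} {d : ℕ} (E : Embedding V d) (p : ℕ) (S : List V) :
    Matrix (Fin d) (Fin S.length) ℝ :=
  fun j k => (E.vec p (S.get k) (k + 1) j : ℝ)

/-- The fixed embedding, in terms of the coordinate vectors `w_1, …, w_d`: number `i` is sent to
`i w_1 + i² w_2`, the `k`-th special token to `w_{2 + k}`, and position `l` to `l w_d`. -/
def stdEmbedding (n d : ℕ) : Embedding (Token n) d where
  word := fun v j => match v with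
    | Sum.inl i =>
        if (j : ℕ) + 1 = 1 then (i : ℝ) + 1 else if (j : ℕ) + 1 = 2 then ((i : ℝ) + 1) ^ 2 else 0
    | Sum.inr s => if (j : ℕ) + 1 = 2 + s.index then 1 else 0
  pos := fun l j => if (j : ℕ) + 1 = d then (l : ℝ) else 0

/-! ### Language models -/

/-- The softmax function. -/
def softmax {ι : Type*} [Fintype ι] (z : ι → ℝ) : ι → ℝ :=
  fun i => Real.exp (z i) / ∑ j, Real.exp (z j)

/-- A language model: it sends a nonempty sequence to a probability distribution of the next token.
Values at the empty sequence are irrelevant. -/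
abbrev LM (V : Type) : Type := List V → V → ℝ

/-- The distribution read off from an output vector `x`: the softmax of `W x`, where `W` is the
word embedding matrix and `W x` is computed in precision `p`. -/
def Embedding.readout {V : Type} [Fintype V] {d : ℕ} (E : Embedding V d) (p : ℕ) (x : Fin d → ℝ) :
    V → ℝ :=
  softmax fun v => rnd p (∑ j, rnd p (E.word v j) * x j)

/-- `τ` selects a token of maximal value (an `arg max` with some rule for ties). -/
def IsArgmax {V : Type} (τ : (V → ℝ) → V) : Prop :=
  ∀ (f : V → ℝ) (v : V), f v ≤ f (τ f)

/-- The sequence after `i` steps of greedy decoding, from the input `S`. -/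
def cot {V : Type} (M : LM V) (τ : (V → ℝ) → V) (S : List V) : ℕ → List V
  | 0 => S
  | i + 1 => cot M τ S i ++ [τ (M (cot M τ S i))]

/-- Greedy decoding from `S` answers after exactly `i` steps of chain of thought, and the answer
is `a`: the first decoded token among the tokens in `A` is the one decoded after `i` steps, and
it is `a`. -/
def AnswersAfter {V : Type} (M : LM V) (τ : (V → ℝ) → V) (A : Set V) (S : List V) (a : V)
    (i : ℕ) : Prop :=
  (∀ j < i, τ (M (cot M τ S j)) ∉ A) ∧ τ (M (cot M τ S i)) ∈ A ∧ τ (M (cot M τ S i)) = a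

/-! ### The task IsTree -/

/-- `E` lists the edges `(u, v)`, `u < v`, of `G`, each once, in some order. -/
def IsEdgeList {n : ℕ} (G : SimpleGraph (Fin n)) (E : List (Fin n × Fin n)) : Prop :=
  E.Nodup ∧ ∀ e, e ∈ E ↔ e.1 < e.2 ∧ G.Adj e.1 e.2

/-- The token sequence `<s>, u_1, ~, v_1, …, u_m, ~, v_m`. -/
def tokenize {n : ℕ} (E : List (Fin n × Fin n)) : List (Token n) :=
  Sum.inr .start :: E.flatMap fun e => [Sum.inl e.1, Sum.inr .edge, Sum.inl e.2]

open Classical in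
/-- The correct answer. -/
def isTreeAnswer {n : ℕ} (G : SimpleGraph (Fin n)) : Token n :=
  if G.IsTree then Sum.inr .yes else Sum.inr .no

/-- The set of answers YES and NO. -/
def answers (n : ℕ) : Set (Token n) := {Sum.inr .yes, Sum.inr .no}

/-- `M` solves IsTree on all graphs with `n` vertices, however the edges are ordered, with any
length of chain of thought. -/
def SolvesIsTree (n : ℕ) (M : LM (Token n)) (τ : (Token n → ℝ) → Token n) : Prop :=
  ∀ (G : SimpleGraph (Fin n)) (E : List (Fin n × Fin n)), IsEdgeList G E →
    ∃ i, AnswersAfter M τ (answers n) (tokenize E) (isTreeAnswer G) i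

/-- `M` solves IsTree on all graphs with `n` vertices, however the edges are ordered, within `t`
steps of chain of thought. -/
def SolvesIsTreeWithin (n : ℕ) (M : LM (Token n)) (τ : (Token n → ℝ) → Token n) (t : ℕ) : Prop :=
  ∀ (G : SimpleGraph (Fin n)) (E : List (Fin n × Fin n)), IsEdgeList G E →
    ∃ i ≤ t, AnswersAfter M τ (answers n) (tokenize E) (isTreeAnswer G) i

/-! ### Transformers

All operations are exact, with their results rounded to `p` bits. -/

/-- The parameters of a Transformer block, all of precision `p`: embedding dimension `d`, `H`
attention heads, and a ReGLU feed-forward network of width `w`. -/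
structure Block (p d H w : ℕ) where
  WQ : Fin H → Matrix (Fin d) (Fin d) (FixedNum p)
  WK : Fin H → Matrix (Fin d) (Fin d) (FixedNum p)
  WV : Fin H → Matrix (Fin d) (Fin d) (FixedNum p)
  W1 : Matrix (Fin w) (Fin d) (FixedNum p)
  W2 : Matrix (Fin w) (Fin d) (FixedNum p)
  W3 : Matrix (Fin d) (Fin w) (FixedNum p)
  b1 : Fin w → FixedNum p
  b2 : Fin w → FixedNum p
  b3 : Fin d → FixedNum p

/-- Column-wise softmax with the causal mask: in column `k` only the rows `k' ≤ k` count. -/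
def maskedSoftmax {l : ℕ} (s : Matrix (Fin l) (Fin l) ℝ) : Matrix (Fin l) (Fin l) ℝ :=
  fun k' k =>
    if k' ≤ k then Real.exp (s k' k) / ∑ k'' ∈ Finset.Iic k, Real.exp (s k'' k) else 0

/-- One attention head: `W_V X softmax((W_K X)ᵀ (W_Q X) / √d + C)`. -/
def Block.head {p d H w l : ℕ} (B : Block p d H w) (X : Matrix (Fin d) (Fin l) ℝ) (h : Fin H) :
    Matrix (Fin d) (Fin l) ℝ :=
  let K := rndM p (toReal (B.WK h) * X)
  let Q := rndM p (toReal (B.WQ h) * X)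
  let V := rndM p (toReal (B.WV h) * X)
  let s := rndM p ((Real.sqrt d)⁻¹ • rndM p (K.transpose * Q))
  rndM p (V * rndM p (maskedSoftmax s))

/-- The attention layer: the sum of all heads. -/
def Block.attn {p d H w l : ℕ} (B : Block p d H w) (X : Matrix (Fin d) (Fin l) ℝ) :
    Matrix (Fin d) (Fin l) ℝ :=
  rndM p (∑ h, B.head X h)

/-- The column-wise feed-forward network `W₃ (ReLU(W₁ x + b₁) ⊗ (W₂ x + b₂)) + b₃`. -/
def Block.ffn {p d H w l : ℕ} (B : Block p d H w) (X : Matrix (Fin d) (Fin l) ℝ) :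
    Matrix (Fin d) (Fin l) ℝ :=
  let Y1 := rndM p (rndM p (toReal B.W1 * X) + Matrix.of fun i _ => (B.b1 i : ℝ))
  let Y2 := rndM p (rndM p (toReal B.W2 * X) + Matrix.of fun i _ => (B.b2 i : ℝ))
  let Z : Matrix (Fin w) (Fin l) ℝ := rndM p (Matrix.of fun i k => max (Y1 i k) 0 * Y2 i k)
  rndM p (rndM p (toReal B.W3 * Z) + Matrix.of fun i _ => (B.b3 i : ℝ))

/-- The map `X ↦ X + attn X + ffn (X + attn X)` of a block. -/
def Block.apply {p d H w l : ℕ} (B : Block p d H w) (X : Matrix (Fin d) (Fin l) ℝ) :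
    Matrix (Fin d) (Fin l) ℝ :=
  let Y := rndM p (X + B.attn X)
  rndM p (Y + B.ffn Y)

/-- A Transformer of precision `p` with `L` layers. -/
structure Transformer (p d L H w : ℕ) where
  block : Fin L → Block p d H w

/-- The output of the last layer. -/
def Transformer.run {p d L H w l : ℕ} (T : Transformer p d L H w)
    (X : Matrix (Fin d) (Fin l) ℝ) : Matrix (Fin d) (Fin l) ℝ :=
  (List.ofFn T.block).foldl (fun Y B => B.apply Y) X

/-- The language model realized by a Transformer: the distribution read off at the last position. -/
def Transformer.lm {V : Type} [Fintype V] {p d L H w : ℕ} (T : Transformer p d L H w)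
    (E : Embedding V d) : LM V :=
  fun S =>
    if h : 0 < S.length then
      E.readout p fun j => T.run (E.emb p S) j ⟨S.length - 1, Nat.sub_lt h Nat.one_pos⟩
    else 0

/-! ### Recurrent neural networks -/

/-- A recurrent neural network whose state consists of `Λ` numbers of precision `p`, with arbitrary
state transition and output functions. Its state memory is `Λ * p` bits. -/
structure RNN (p Λ d : ℕ) where
  init : Fin Λ → FixedNum p
  trans : (Fin Λ → FixedNum p) → (Fin d → FixedNum p) → (Fin Λ → FixedNum p)
  out : (Fin Λ → FixedNum p) → (Fin d → FixedNum p)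

/-- The state after reading a sequence. -/
def RNN.state {V : Type} {p Λ d : ℕ} (R : RNN p Λ d) (E : Embedding V d) (S : List V) :
    Fin Λ → FixedNum p :=
  (S.zipIdx 1).foldl (fun s x => R.trans s (E.vec p x.1 x.2)) R.init

/-- The language model realized by a recurrent neural network. -/
def RNN.lm {V : Type} [Fintype V] {p Λ d : ℕ} (R : RNN p Λ d) (E : Embedding V d) : LM V :=
  fun S => E.readout p fun j => (R.out (R.state E S) j : ℝ)

end SeqModel

end

/-!
A Transformer decides whether a graph is a tree by tracing a face of it. List the edges in the given
order and let, at each vertex, the edges follow each other cyclically in this order. The walk that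
leaves every vertex through the cyclic predecessor of the edge through which it came passes, in a
tree, through all darts (`exists_iterate_eq_of_isTree`): a cycle of this map on darts contains with
a dart its reversal, since every edge is a bridge (`symm_mem_cycle`), and hence with a dart all the
darts at its endpoints. So it visits every vertex (`Lists.exists_visit`). In any graph the walk
stays in one component (`Lists.reachable_next`). So the Transformer first compares the number of
edges with `n - 1`, then writes down `2 (n - 1) + 1` vertices of the walk, and then counts through
the vertices, answering NO as soon as one has not occurred (`Follows.step`,
`Follows.solvesIsTreeWithin`).

One step of the walk is a search, in the input, for the last position that satisfies a polynomial
equation in the numbers at hand. A single attention head does it. Its scores are integers, in which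
the position serves to break ties in favour of the last one (`rmax`), multiplied by `2 q + 2`, where
`q` is the number of binary places. So the weights at all positions except the maximizing one are
rounded to zero, and the attention is an exact table lookup (`rndM_maskedSoftmax`). All quantities
are integers of size polynomial in `n`, which are represented exactly with `O(log n)` bits. A
Transformer block thus executes an exact instruction of a small machine with 64 integer registers
(`Layer`, `Layer.apply_toBlock`), and eleven such instructions form the `program` that computes the
next token (`body_spec`, `Reads.nextNum_of_isEdgeAt`). The token is read off from the quadratic form
`-(i - o) ^ 2`, up to a constant, which is an integer linear form in the embedding `(i, i ^ 2)`; the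
winner is unique, so ties do not matter (`argmax_toTransformer_lm`).

A recurrent network forgets. There are `2 ^ (n - 3)` ways to distribute `n - 3` vertices among the
stars of two centres, but only `2 ^ (Λ p)` states, so that two distributions lead to the same state.
They differ at some vertex, and joining this vertex, through a new vertex, to the first centre
connects the two stars in one case and closes a cycle in the other, although the network continues
in the same way (`RNN.not_solvesIsTree`).
-/

noncomputable section

namespace SeqModel

/-! ### Exact integer arithmetic in fixed precision -/

theorem rnd_eq_of_near {q : ℕ} {x : ℝ} {z : ℤ} (hz : |z| < 2 ^ q)
    (hx : |x - z| * 2 ^ q < 1 / 2) : rnd (2 * q + 1) x = z := by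
  have e1 : 2 * q + 1 - 1 = 2 * q := by omega
  have e2 : 2 * q / 2 = q := by omega
  have hpos : (0 : ℝ) < 2 ^ q := by positivity
  have hr : round (x * 2 ^ q) = z * 2 ^ q := by
    rw [round_eq, Int.floor_eq_iff]
    have h : |x * 2 ^ q - z * 2 ^ q| < 1 / 2 := by
      rw [← sub_mul, abs_mul, abs_of_pos hpos]; exact hx
    rw [abs_lt] at h
    push_cast
    constructor <;> linarith [h.1, h.2]
  have hz' := abs_lt.1 hz
  have hq : (0 : ℤ) < 2 ^ q := by positivity
  have hsq : (2 : ℤ) ^ (2 * q) = 2 ^ q * 2 ^ q := by rw [two_mul, pow_add]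
  unfold rnd
  rw [e1, e2, hr, hsq, min_eq_right, max_eq_right]
  · push_cast
    field_simp
  · nlinarith [hz'.1, hz'.2]
  · nlinarith [hz'.1, hz'.2]

theorem rnd_intCast {q : ℕ} {z : ℤ} (hz : |z| < 2 ^ q) : rnd (2 * q + 1) (z : ℝ) = z :=
  rnd_eq_of_near hz (by simp)

/-- The real matrix with given integer entries. -/
abbrev castM {m n : Type*} (A : Matrix m n ℤ) : Matrix m n ℝ := A.map (fun z : ℤ => (z : ℝ))

theorem castM_mul {l m n : Type*} [Fintype m] (A : Matrix l m ℤ) (B : Matrix m n ℤ) :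
    castM A * castM B = castM (A * B) := by
  ext i j
  simp [castM, Matrix.mul_apply]

theorem rndM_castM {q : ℕ} {m n : Type*} {A : Matrix m n ℤ} (h : ∀ i j, |A i j| < 2 ^ q) :
    rndM (2 * q + 1) (castM A) = castM A := by
  ext i j
  exact rnd_intCast (h i j)

/-- The representable matrix with given integer entries (which are rounded if they are too large). -/
def repM (q : ℕ) {m n : Type*} (A : Matrix m n ℤ) : Matrix m n (FixedNum (2 * q + 1)) :=
  A.map fun z => rndRep (2 * q + 1) z

theorem toReal_repM {q : ℕ} {m n : Type*} {A : Matrix m n ℤ} (h : ∀ i j, |A i j| < 2 ^ q) :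
    toReal (repM q A) = castM A := by
  ext i j
  exact rnd_intCast (h i j)

theorem abs_mul_apply_le {l m n : Type*} [Fintype m] {A : Matrix l m ℤ} {B : Matrix m n ℤ}
    {a b : ℤ} (i : l) (j : n) (hA : ∀ k, |A i k| ≤ a) (hB : ∀ k, |B k j| ≤ b) :
    |(A * B) i j| ≤ Fintype.card m * (a * b) := by
  rw [Matrix.mul_apply]
  refine (Finset.abs_sum_le_sum_abs _ _).trans ?_
  refine (Finset.sum_le_card_nsmul _ _ (a * b) fun k _ => ?_).trans (by simp)
  rw [abs_mul]
  exact mul_le_mul (hA k) (hB k) (abs_nonneg _) ((abs_nonneg _).trans (hA k))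

/-! ### Saturated attention -/

/-- A softmax column in which one score exceeds all the others by a gap `g` is close to a unit
vector. -/
theorem abs_maskedSoftmax_sub_le {l : ℕ} (s : Matrix (Fin l) (Fin l) ℝ) {j k : Fin l} {g : ℝ}
    (hj : j ≤ k) (hg : ∀ i ≤ k, i ≠ j → s i k + g ≤ s j k) (i : Fin l) :
    |maskedSoftmax s i k - if i = j then 1 else 0| ≤ l * Real.exp (-g) := by
  have hl : (1 : ℝ) ≤ l := by exact_mod_cast (Nat.succ_le_of_lt (Fin.pos i))
  have hmem : j ∈ Finset.Iic k := Finset.mem_Iic.2 hj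
  set R := ∑ i ∈ (Finset.Iic k).erase j, Real.exp (s i k) with hR
  have hD : ∑ i ∈ Finset.Iic k, Real.exp (s i k) = Real.exp (s j k) + R :=
    (Finset.add_sum_erase _ _ hmem).symm
  have hR0 : 0 ≤ R := Finset.sum_nonneg fun _ _ => (Real.exp_pos _).le
  have hother : ∀ i ≤ k, i ≠ j → Real.exp (s i k) ≤ Real.exp (-g) * Real.exp (s j k) := by
    intro i hi hij
    rw [← Real.exp_add]
    exact Real.exp_le_exp.2 (by linarith [hg i hi hij])
  have hR1 : R ≤ l * Real.exp (-g) * Real.exp (s j k) := by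
    have h1 : R ≤ ((Finset.Iic k).erase j).card • (Real.exp (-g) * Real.exp (s j k)) :=
      Finset.sum_le_card_nsmul _ _ _ fun i hi => by
        rw [Finset.mem_erase, Finset.mem_Iic] at hi
        exact hother i hi.2 hi.1
    have h2 : (((Finset.Iic k).erase j).card : ℝ) ≤ l := by
      have := Finset.card_le_univ ((Finset.Iic k).erase j)
      rw [Fintype.card_fin] at this
      exact_mod_cast this
    rw [nsmul_eq_mul] at h1
    rw [mul_assoc]
    exact h1.trans (mul_le_mul_of_nonneg_right h2 (by positivity))
  have he := Real.exp_pos (s j k)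
  have hDpos : 0 < Real.exp (s j k) + R := by linarith
  unfold maskedSoftmax
  rw [hD]
  by_cases hij : i = j
  · subst hij
    rw [if_pos hj, if_pos rfl, abs_sub_comm, abs_of_nonneg]
    · rw [sub_le_iff_le_add, ← sub_le_iff_le_add', le_div_iff₀ hDpos]
      nlinarith [Real.exp_pos (-g), mul_nonneg (mul_nonneg (by linarith : (0:ℝ) ≤ l)
        (Real.exp_pos (-g)).le) hR0]
    · rw [sub_nonneg, div_le_one hDpos]
      linarith
  · rw [if_neg hij, sub_zero]
    by_cases hik : i ≤ k
    · rw [if_pos hik, abs_of_nonneg (by positivity), div_le_iff₀ hDpos]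
      have h1 := hother i hik hij
      have h2 : Real.exp (-g) * Real.exp (s j k) ≤ l * Real.exp (-g) * Real.exp (s j k) := by
        rw [mul_assoc]
        exact le_mul_of_one_le_left (by positivity) hl
      have h3 : 0 ≤ l * Real.exp (-g) * R := by positivity
      linarith
    · rw [if_neg hik, abs_zero]
      positivity

/-- The rightmost point of `{0, …, k}` at which `f` is maximal. -/
def rmax (f : ℕ → ℤ) : ℕ → ℕ
  | 0 => 0
  | k + 1 => if f (rmax f k) ≤ f (k + 1) then k + 1 else rmax f k

theorem rmax_le (f : ℕ → ℤ) (k : ℕ) : rmax f k ≤ k := by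
  induction k with
  | zero => exact le_rfl
  | succ k ih => rw [rmax]; split_ifs <;> omega

theorem rmax_spec (f : ℕ → ℤ) (k : ℕ) :
    (∀ i ≤ k, f i ≤ f (rmax f k)) ∧ ∀ i ≤ k, rmax f k < i → f i < f (rmax f k) := by
  induction k with
  | zero => simp [rmax]
  | succ k ih =>
    have h0 := rmax_le f k
    rw [rmax]
    split_ifs with h
    · refine ⟨fun i hi => ?_, fun i hi h' => by omega⟩
      rcases Nat.lt_or_ge k i with hk | hk
      · rw [show i = k + 1 by omega]
      · exact (ih.1 i hk).trans h
    · push Not at h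
      refine ⟨fun i hi => ?_, fun i hi h' => ?_⟩
      · rcases Nat.lt_or_ge k i with hk | hk
        · rw [show i = k + 1 by omega]; exact h.le
        · exact ih.1 i hk
      · rcases Nat.lt_or_ge k i with hk | hk
        · rw [show i = k + 1 by omega]; exact h
        · exact ih.2 i hk h'

theorem rmax_eq {f : ℕ → ℤ} {j k : ℕ} (hj : j ≤ k) (h1 : ∀ i < j, f i ≤ f j)
    (h2 : ∀ i ≤ k, j < i → f i < f j) : rmax f k = j := by
  obtain ⟨h3, h4⟩ := rmax_spec f k
  have h0 := rmax_le f k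
  rcases lt_trichotomy (rmax f k) j with h | h | h
  · exact absurd (h4 j hj h) (not_lt.2 (h1 _ h))
  · exact h
  · exact absurd (h3 j hj) (not_le.2 (h2 _ h0 h))

/-- If in every column `k` the score at `a k` exceeds all the others by `2 * q + 2`, then the rounded
attention weights are those of hard attention to `a k`. -/
theorem rndM_maskedSoftmax {q l : ℕ} {s : Matrix (Fin l) (Fin l) ℤ} (hl : l ≤ 2 ^ q) (hq : 1 ≤ q)
    (a : Fin l → Fin l) (ha : ∀ k, a k ≤ k)
    (hgap : ∀ k, ∀ i ≤ k, i ≠ a k → s i k + (2 * q + 2) ≤ s (a k) k) :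
    rndM (2 * q + 1) (maskedSoftmax (castM s)) =
      castM (Matrix.of fun i k => if i = a k then 1 else 0) := by
  ext i k
  refine rnd_eq_of_near ?_ ?_
  · have : (2 : ℤ) ^ 1 ≤ 2 ^ q := pow_le_pow_right₀ (by norm_num) hq
    simp only [Matrix.of_apply]
    split_ifs <;> simp; linarith
  · have h := abs_maskedSoftmax_sub_le (castM s) (g := (2 * q + 2 : ℕ)) (ha k)
      (fun i hi hne => by
        have := hgap k i hi hne
        simp only [castM, Matrix.map_apply]
        exact_mod_cast this) i
    have hcast : (((Matrix.of fun i k => if i = a k then (1 : ℤ) else 0) i k : ℤ) : ℝ) =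
        if i = a k then 1 else 0 := by
      simp only [Matrix.of_apply]; split_ifs <;> simp
    rw [hcast]
    refine lt_of_le_of_lt (mul_le_mul_of_nonneg_right h (by positivity)) ?_
    have hl' : (l : ℝ) ≤ 2 ^ q := by exact_mod_cast hl
    have he : (2 : ℝ) ^ (2 * q + 2) ≤ Real.exp ((2 * q + 2 : ℕ) : ℝ) := by
      have h2 : (2 : ℝ) ≤ Real.exp 1 := by linarith [Real.exp_one_gt_d9]
      calc (2 : ℝ) ^ (2 * q + 2) ≤ Real.exp 1 ^ (2 * q + 2) := by gcongr
        _ = _ := by rw [← Real.exp_nat_mul, mul_one]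
    rw [Real.exp_neg]
    have hp : (0 : ℝ) < 2 ^ (2 * q + 2) := by positivity
    calc l * (Real.exp ((2 * q + 2 : ℕ) : ℝ))⁻¹ * 2 ^ q
        ≤ 2 ^ q * (2 ^ (2 * q + 2))⁻¹ * 2 ^ q := by gcongr
      _ = 1 / 4 := by
        rw [pow_add, mul_comm 2 q, pow_mul]; field_simp; norm_num
      _ < 1 / 2 := by norm_num

/-! ### Integer programs -/

/-- The linear form `∑ c * x i` over the pairs `(c, i)` of the list `r`. -/
def lin {d : ℕ} (r : List (ℤ × Fin d)) (x : Fin d → ℤ) : ℤ := (r.map fun e => e.1 * x e.2).sum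

/-- The coefficient vector of `lin r`. -/
def coef {d : ℕ} (r : List (ℤ × Fin d)) (j : Fin d) : ℤ :=
  (r.map fun e => if e.2 = j then e.1 else 0).sum

/-- The sum of the absolute values of the coefficients listed in `r`. -/
def wt {d : ℕ} (r : List (ℤ × Fin d)) : ℤ := (r.map fun e => |e.1|).sum

theorem sum_coef_mul {d : ℕ} (r : List (ℤ × Fin d)) (x : Fin d → ℤ) :
    ∑ j, coef r j * x j = lin r x := by
  induction r with
  | nil => simp [coef, lin]
  | cons e r ih =>
    simp only [coef, lin, List.map_cons, List.sum_cons, add_mul, Finset.sum_add_distrib, ite_mul,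
      zero_mul, Finset.sum_ite_eq, Finset.mem_univ, if_true] at ih ⊢
    rw [ih]

theorem abs_coef_le {d : ℕ} (r : List (ℤ × Fin d)) (j : Fin d) : |coef r j| ≤ wt r := by
  induction r with
  | nil => simp [coef, wt]
  | cons e r ih =>
    simp only [coef, wt, List.map_cons, List.sum_cons] at ih ⊢
    refine (abs_add_le _ _).trans (add_le_add ?_ ih)
    split_ifs <;> simp

/-- A hidden unit of a feed-forward layer: it adds `ReLU (A x + a) * (B x + b)` to the
coordinate `tgt`. -/
structure Gate (d : ℕ) where
  tgt : Fin d
  A : List (ℤ × Fin d)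
  a : ℤ
  B : List (ℤ × Fin d)
  b : ℤ

/-- A layer of an integer program. It performs one step of hard attention, in which position `k`
selects the position `j ≤ k` that maximizes `∑ K (x_j) * Q (x_k)` over the pairs `(K, Q)` in
`pairs` (the rightmost one, if there are several), and adds to the coordinate `t` the value
`V (x_j)`, for each `(t, V)` in `vals`. Then it applies the hidden units in `gates`. -/
structure Layer (d : ℕ) where
  pairs : List (List (ℤ × Fin d) × List (ℤ × Fin d))
  vals : List (Fin d × List (ℤ × Fin d))
  gates : List (Gate d)

/-- The score of the key position `x'` for the query position `x`. -/
def Layer.score {d : ℕ} (L : Layer d) (x' x : Fin d → ℤ) : ℤ :=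
  (L.pairs.map fun e => lin e.1 x' * lin e.2 x).sum

/-- The position to which position `k` attends. -/
def Layer.att {d : ℕ} (L : Layer d) (X : ℕ → Fin d → ℤ) (k : ℕ) : ℕ :=
  rmax (fun j => L.score (X j) (X k)) k

/-- The residual stream after the attention step. -/
def Layer.mid {d : ℕ} (L : Layer d) (X : ℕ → Fin d → ℤ) (k : ℕ) (t : Fin d) : ℤ :=
  X k t + (L.vals.map fun e => if e.1 = t then lin e.2 (X (L.att X k)) else 0).sum

/-- The residual stream after the layer. -/
def Layer.sem {d : ℕ} (L : Layer d) (X : ℕ → Fin d → ℤ) (k : ℕ) (t : Fin d) : ℤ :=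
  L.mid X k t + (L.gates.map fun g => if g.tgt = t then
    max (lin g.A (L.mid X k) + g.a) 0 * (lin g.B (L.mid X k) + g.b) else 0).sum

/-- The layer has at most `D` score terms and `w` hidden units, leaves the last coordinate alone,
and its integers are bounded by `W`. -/
structure Layer.Fits {D : ℕ} (L : Layer (D + 1)) (w : ℕ) (W : ℤ) : Prop where
  pairs_length : L.pairs.length ≤ D
  gates_length : L.gates.length ≤ w
  vals_tgt : ∀ e ∈ L.vals, e.1 ≠ Fin.last D
  gates_tgt : ∀ g ∈ L.gates, g.tgt ≠ Fin.last D
  pairs_wt : ∀ e ∈ L.pairs, wt e.1 ≤ W ∧ wt e.2 ≤ W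
  vals_wt : (L.vals.map fun e => wt e.2).sum ≤ W
  gates_wt : ∀ g ∈ L.gates, wt g.A ≤ W ∧ |g.a| ≤ W ∧ wt g.B ≤ W ∧ |g.b| ≤ W

theorem Layer.mid_last {D w : ℕ} {W : ℤ} {L : Layer (D + 1)} (h : L.Fits w W)
    (X : ℕ → Fin (D + 1) → ℤ) (k : ℕ) : L.mid X k (Fin.last D) = X k (Fin.last D) := by
  unfold Layer.mid
  rw [List.sum_eq_zero, add_zero]
  intro x hx
  obtain ⟨e, he, rfl⟩ := List.mem_map.1 hx
  exact if_neg (h.vals_tgt e he)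

theorem Layer.sem_last {D w : ℕ} {W : ℤ} {L : Layer (D + 1)} (h : L.Fits w W)
    (X : ℕ → Fin (D + 1) → ℤ) (k : ℕ) : L.sem X k (Fin.last D) = X k (Fin.last D) := by
  unfold Layer.sem
  rw [List.sum_eq_zero, add_zero, Layer.mid_last h]
  intro x hx
  obtain ⟨e, he, rfl⟩ := List.mem_map.1 hx
  exact if_neg (h.gates_tgt e he)

theorem sum_getD {α : Type*} (l : List α) (x : α) (f : α → ℤ) (hf : f x = 0) {N : ℕ}
    (hl : l.length ≤ N) : ∑ i : Fin N, f (l.getD i x) = (l.map f).sum := by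
  induction l generalizing N with
  | nil => simp [hf]
  | cons y l ih =>
    obtain ⟨N, rfl⟩ : ∃ N', N = N' + 1 := ⟨N - 1, by simp at hl; omega⟩
    rw [Fin.sum_univ_succ]
    simp only [List.length_cons, Nat.add_le_add_iff_right] at hl
    simpa using ih hl

/-! ### Compilation of integer programs to Transformers -/

section Compile

variable {D : ℕ} (L : Layer (D + 1))

/-- The key matrix. Its last row reads off the position, for the benefit of the tie-breaking
term of the score. -/
def Layer.matK : Matrix (Fin (D + 1)) (Fin (D + 1)) ℤ :=
  Matrix.of (Fin.lastCases (fun j => if j = Fin.last D then 1 else 0)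
    fun i => coef (L.pairs.getD i ([], [])).1)

/-- The query matrix. The scores are multiplied by `M` before the product of the two positions is
added, in order to break ties. Then `c` amplifies their differences, and `r` compensates for the
division by the square root of the dimension. -/
def Layer.matQ (c r M : ℤ) : Matrix (Fin (D + 1)) (Fin (D + 1)) ℤ :=
  Matrix.of (Fin.lastCases (fun j => if j = Fin.last D then r * c else 0)
    fun i j => r * (c * M) * coef (L.pairs.getD i ([], [])).2 j)

/-- The value matrix. -/
def Layer.matV : Matrix (Fin (D + 1)) (Fin (D + 1)) ℤ :=
  Matrix.of fun t j => (L.vals.map fun e => if e.1 = t then coef e.2 j else 0).sum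

/-- The hidden unit number `i`. -/
def Layer.unit (i : ℕ) : Gate (D + 1) := L.gates.getD i ⟨0, [], 0, [], 0⟩

/-- The hidden unit `i` writes into its target coordinate only. -/
def Layer.matW3 (w : ℕ) : Matrix (Fin (D + 1)) (Fin w) ℤ :=
  Matrix.of fun t i => if (L.unit i).tgt = t then 1 else 0

/-- The Transformer block that executes a layer. -/
def Layer.toBlock (q w r M : ℕ) : Block (2 * q + 1) (D + 1) 1 w where
  WQ _ := repM q (L.matQ (2 * q + 2) r M)
  WK _ := repM q L.matK
  WV _ := repM q L.matV
  W1 := repM q (Matrix.of fun (i : Fin w) => coef (L.unit i).A)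
  W2 := repM q (Matrix.of fun (i : Fin w) => coef (L.unit i).B)
  W3 := repM q (L.matW3 w)
  b1 i := rndRep _ (L.unit i).a
  b2 i := rndRep _ (L.unit i).b
  b3 _ := rndRep _ (0 : ℤ)

/-- The columns `0, …, l - 1` of the residual stream. -/
def cols (l : ℕ) {d : ℕ} (X : ℕ → Fin d → ℤ) : Matrix (Fin d) (Fin l) ℤ :=
  Matrix.of fun t k => X k t

theorem mul_cols_apply {l d : ℕ} {m : Type*} (A : Matrix m (Fin d) ℤ) (X : ℕ → Fin d → ℤ) (i : m)
    (k : Fin l) : (A * cols l X) i k = ∑ j, A i j * X k j := by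
  simp [Matrix.mul_apply, cols]

theorem Layer.score_matrix (c r M : ℤ) {w : ℕ} {W : ℤ} (h : L.Fits w W)
    (X : ℕ → Fin (D + 1) → ℤ) {l : ℕ} (k' k : Fin l) :
    ((L.matK * cols l X).transpose * (L.matQ c r M * cols l X)) k' k =
      r * (c * (M * L.score (X k') (X k) + X k' (Fin.last D) * X k (Fin.last D))) := by
  rw [Matrix.mul_apply, Fin.sum_univ_castSucc]
  simp only [Matrix.transpose_apply, mul_cols_apply, Layer.matK, Layer.matQ, Matrix.of_apply,
    Fin.lastCases_castSucc, Fin.lastCases_last, ite_mul, one_mul, zero_mul, Finset.sum_ite_eq',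
    Finset.mem_univ, if_true, mul_assoc, ← Finset.mul_sum, sum_coef_mul]
  have := sum_getD L.pairs ([], []) (fun e => lin e.1 (X k') * lin e.2 (X k)) (by simp [lin])
    h.pairs_length
  rw [Layer.score, ← this, Finset.mul_sum, mul_add, mul_add, Finset.mul_sum, Finset.mul_sum]
  congr 1
  · refine Finset.sum_congr rfl fun i _ => ?_
    ring
  · ring

theorem Layer.matV_apply (X : ℕ → Fin (D + 1) → ℤ) {l : ℕ} (t : Fin (D + 1)) (k : Fin l) :
    (L.matV * cols l X) t k = (L.vals.map fun e => if e.1 = t then lin e.2 (X k) else 0).sum := by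
  rw [mul_cols_apply]
  simp only [Layer.matV, Matrix.of_apply]
  induction L.vals with
  | nil => simp
  | cons e v ih =>
    simp only [List.map_cons, List.sum_cons, add_mul, Finset.sum_add_distrib, ih]
    congr 1
    split_ifs
    · exact sum_coef_mul _ _
    · simp

theorem Layer.abs_matV_le (t j : Fin (D + 1)) :
    |L.matV t j| ≤ (L.vals.map fun e => wt e.2).sum := by
  simp only [Layer.matV, Matrix.of_apply]
  induction L.vals with
  | nil => simp
  | cons e v ih =>
    simp only [List.map_cons, List.sum_cons]
    refine (abs_add_le _ _).trans (add_le_add ?_ ih)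
    split_ifs
    · exact abs_coef_le _ _
    · simpa using (abs_nonneg _).trans (abs_coef_le e.2 j)

theorem Layer.pairs_getD_wt {w : ℕ} {W : ℤ} (h : L.Fits w W) (hW : 0 ≤ W) (i : ℕ) :
    wt (L.pairs.getD i ([], [])).1 ≤ W ∧ wt (L.pairs.getD i ([], [])).2 ≤ W := by
  rcases lt_or_ge i L.pairs.length with hi | hi
  · rw [List.getD_eq_getElem _ _ hi]
    exact h.pairs_wt _ (List.getElem_mem hi)
  · rw [List.getD_eq_default _ _ hi]
    simp [wt, hW]

theorem Layer.unit_wt {w : ℕ} {W : ℤ} (h : L.Fits w W) (hW : 0 ≤ W) (i : ℕ) :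
    wt (L.unit i).A ≤ W ∧ |(L.unit i).a| ≤ W ∧ wt (L.unit i).B ≤ W ∧ |(L.unit i).b| ≤ W := by
  unfold Layer.unit
  rcases lt_or_ge i L.gates.length with hi | hi
  · rw [List.getD_eq_getElem _ _ hi]
    exact h.gates_wt _ (List.getElem_mem hi)
  · rw [List.getD_eq_default _ _ hi]
    simp [wt, hW]

theorem Layer.abs_matK_le {w : ℕ} {W : ℤ} (h : L.Fits w W) (hW : 1 ≤ W) (i j : Fin (D + 1)) :
    |L.matK i j| ≤ W := by
  refine Fin.lastCases ?_ (fun i => ?_) i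
  · simp only [Layer.matK, Matrix.of_apply, Fin.lastCases_last]
    split_ifs <;> simp <;> omega
  · simp only [Layer.matK, Matrix.of_apply, Fin.lastCases_castSucc]
    exact (abs_coef_le _ _).trans (L.pairs_getD_wt h (by omega) i).1

theorem Layer.abs_matQ_le {w : ℕ} {W c r M : ℤ} (h : L.Fits w W) (hW : 1 ≤ W) (hc : 0 ≤ c)
    (hr : 0 ≤ r) (hM : 1 ≤ M) (i j : Fin (D + 1)) : |L.matQ c r M i j| ≤ r * (c * M) * W := by
  have hrc : 0 ≤ r * c := mul_nonneg hr hc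
  have h1 : r * c ≤ r * c * M := le_mul_of_one_le_right hrc hM
  refine Fin.lastCases ?_ (fun i => ?_) i
  · simp only [Layer.matQ, Matrix.of_apply, Fin.lastCases_last, ← mul_assoc]
    have h2 : r * c * M ≤ r * c * M * W := le_mul_of_one_le_right (hrc.trans h1) hW
    split_ifs
    · rw [abs_of_nonneg hrc]; exact h1.trans h2
    · rw [abs_zero]; exact hrc.trans (h1.trans h2)
  · simp only [Layer.matQ, Matrix.of_apply, Fin.lastCases_castSucc, ← mul_assoc]
    rw [abs_mul, abs_of_nonneg (hrc.trans h1)]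
    exact mul_le_mul_of_nonneg_left ((abs_coef_le _ _).trans (L.pairs_getD_wt h (by omega) i).2)
      (hrc.trans h1)

end Compile

/-- With the product of the two positions as a tie-breaking term, the score has a unique maximum, at
the position that the layer selects. -/
theorem Layer.score_att_gap {D : ℕ} {L : Layer (D + 1)}
    {X : ℕ → Fin (D + 1) → ℤ} {l : ℕ} {M : ℤ} (hpos : ∀ k < l, X k (Fin.last D) = k + 1)
    (hM : (l : ℤ) * l ≤ M) {k i : ℕ} (hk : k < l) (hi : i ≤ k) (hne : i ≠ L.att X k) :
    M * L.score (X i) (X k) + X i (Fin.last D) * X k (Fin.last D) + 1 ≤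
      M * L.score (X (L.att X k)) (X k) + X (L.att X k) (Fin.last D) * X k (Fin.last D) := by
  have hak : L.att X k ≤ k := rmax_le _ _
  obtain ⟨h1, h2⟩ := rmax_spec (fun j => L.score (X j) (X k)) k
  rw [hpos k hk, hpos i (by omega), hpos _ (by omega)]
  have h0 := h1 i hi
  change L.score (X i) (X k) ≤ L.score (X (L.att X k)) (X k) at h0
  set a := L.att X k with ha
  rcases lt_or_eq_of_le h0 with hlt | heq
  · -- a larger score outweighs the tie-breaking term, which is at most `l * l`
    have h3 : M * (L.score (X i) (X k) + 1) ≤ M * L.score (X a) (X k) :=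
      mul_le_mul_of_nonneg_left hlt (le_trans (by positivity) hM)
    have h4 : ((i : ℤ) + 1) * (k + 1) ≤ l * l :=
      mul_le_mul (by omega) (by omega) (by omega) (by omega)
    have h5 : (0 : ℤ) < (a + 1) * (k + 1) := by positivity
    linarith
  · have hia : i < a := by
      rcases lt_or_ge a i with h' | h'
      · exact absurd heq (ne_of_lt (h2 i hi h'))
      · omega
    have h5 : ((i : ℤ) + 1 + 1) * (k + 1) ≤ (a + 1) * (k + 1) :=
      mul_le_mul_of_nonneg_right (by omega) (by omega)
    rw [heq]
    nlinarith

/-- The attention head computes the attention step of the layer without rounding errors. Here `T`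
bounds the entries of the keys, queries and values, and `T ^ 3` the scores. -/
theorem Layer.head_toBlock {D w q l r M : ℕ} {W B T : ℤ} {L : Layer (D + 1)} (hr : r * r = D + 1)
    (h : L.Fits w W) (hW : 1 ≤ W) (hM : l * l ≤ M) (hM1 : 1 ≤ M) {X : ℕ → Fin (D + 1) → ℤ}
    (hpos : ∀ k < l, X k (Fin.last D) = k + 1) (hB : 1 ≤ B) (hX : ∀ k < l, ∀ t, |X k t| ≤ B)
    (hT : T = (D + 1) * (r * ((2 * q + 2) * M) * W * B)) (hTq : T ^ 3 < 2 ^ q) :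
    (L.toBlock q w r M).head (castM (cols l X)) 0 = castM (Matrix.of fun t (k : Fin l) =>
        (L.vals.map fun e => if e.1 = t then lin e.2 (X (L.att X k)) else 0).sum) ∧
      ∀ t, ∀ k < l,
        |(L.vals.map fun e => if e.1 = t then lin e.2 (X (L.att X k)) else 0).sum| ≤ T := by
  have hr0 : 0 < r := Nat.pos_of_ne_zero (by rintro rfl; simp at hr)
  set F : ℤ := r * ((2 * q + 2) * M) with hF
  have hF1 : 1 ≤ F := by
    have : (0 : ℤ) < r * ((2 * q + 2) * M) := by positivity
    omega
  have hWF : W ≤ F * W := le_mul_of_one_le_left (by omega) hF1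
  have hD1 : (1 : ℤ) ≤ D + 1 := by omega
  have hFW0 : 0 ≤ F * W := by positivity
  have hFWB : F * W ≤ F * W * B := le_mul_of_one_le_right hFW0 hB
  have hFWT : F * W ≤ T := by
    rw [hT]
    exact hFWB.trans (le_mul_of_one_le_left (hFW0.trans hFWB) hD1)
  have hT1 : 1 ≤ T := by linarith
  have hT3 : T ≤ T ^ 3 := le_self_pow₀ hT1 (by norm_num)
  have hTq1 : T < 2 ^ q := by linarith
  have hq : 1 ≤ q := by
    rcases Nat.eq_zero_or_pos q with rfl | hq
    · simp at hTq1; omega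
    · exact hq
  have hmul : ∀ (A : Matrix (Fin (D + 1)) (Fin (D + 1)) ℤ), (∀ i j, |A i j| ≤ F * W) →
      ∀ i (k : Fin l), |(A * cols l X) i k| ≤ T := by
    intro A hA i k
    have := abs_mul_apply_le (A := A) (B := cols l X) i k (hA i) (fun t => hX k k.2 t)
    rw [Fintype.card_fin] at this
    rw [hT]; push_cast at this; exact this
  have hK : ∀ i j, |L.matK i j| ≤ F * W := fun i j => (L.abs_matK_le h hW i j).trans hWF
  have hQ : ∀ i j, |L.matQ (2 * q + 2) r M i j| ≤ F * W := fun i j => by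
    exact L.abs_matQ_le h hW (by positivity) (by positivity) (by exact_mod_cast hM1) i j
  have hV : ∀ i j, |L.matV i j| ≤ F * W := fun i j =>
    ((L.abs_matV_le i j).trans h.vals_wt).trans hWF
  have hlt : ∀ {A : Matrix (Fin (D + 1)) (Fin (D + 1)) ℤ}, (∀ i j, |A i j| ≤ F * W) →
      ∀ i j, |A i j| < 2 ^ q := fun hA i j => lt_of_le_of_lt ((hA i j).trans hFWT) hTq1
  have hprod : ∀ {A : Matrix (Fin (D + 1)) (Fin (D + 1)) ℤ}, (∀ i j, |A i j| ≤ F * W) →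
      rndM (2 * q + 1) (toReal (repM q A) * castM (cols l X)) = castM (A * cols l X) := by
    intro A hA
    rw [toReal_repM (hlt hA), castM_mul, rndM_castM]
    exact fun i k => lt_of_le_of_lt (hmul A hA i k) hTq1
  -- the scores
  have hS : ∀ k' k, |((L.matK * cols l X).transpose * (L.matQ (2 * q + 2) r M * cols l X)) k' k| ≤
      T ^ 3 := by
    intro k' k
    refine (abs_mul_apply_le k' k (fun i => hmul _ hK i k') (fun i => hmul _ hQ i k)).trans ?_
    rw [Fintype.card_fin, pow_succ', sq]
    have : ((D + 1 : ℕ) : ℤ) ≤ T := by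
      rw [hT]; push_cast
      exact le_mul_of_one_le_right (by omega) (by linarith)
    exact mul_le_mul_of_nonneg_right this (by positivity)
  let s : Matrix (Fin l) (Fin l) ℤ := Matrix.of fun k' k => (2 * q + 2) *
    (M * L.score (X k') (X k) + X k' (Fin.last D) * X k (Fin.last D))
  have hs : ∀ k' k, ((L.matK * cols l X).transpose * (L.matQ (2 * q + 2) r M * cols l X)) k' k =
      r * s k' k := fun k' k => by rw [L.score_matrix _ _ _ h]; rfl
  have hscale : rndM (2 * q + 1) ((Real.sqrt (D + 1 : ℕ))⁻¹ • rndM (2 * q + 1)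
      ((castM (L.matK * cols l X)).transpose * castM (L.matQ (2 * q + 2) r M * cols l X))) =
      castM s := by
    have e1 : (castM (L.matK * cols l X)).transpose * castM (L.matQ (2 * q + 2) r M * cols l X) =
        castM ((L.matK * cols l X).transpose * (L.matQ (2 * q + 2) r M * cols l X)) :=
      castM_mul _ _
    have e2 : Real.sqrt (D + 1 : ℕ) = r := by
      rw [← hr]; push_cast; exact Real.sqrt_mul_self (by positivity)
    rw [e1, rndM_castM fun i j => lt_of_le_of_lt (hS i j) hTq, e2]
    have e3 : (r : ℝ)⁻¹ • castM ((L.matK * cols l X).transpose *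
        (L.matQ (2 * q + 2) r M * cols l X)) = castM s := by
      ext k' k
      have : (r : ℝ) ≠ 0 := by positivity
      simp only [castM, Matrix.smul_apply, Matrix.map_apply, smul_eq_mul, hs]
      push_cast
      field_simp
    rw [e3, rndM_castM]
    intro k' k
    refine lt_of_le_of_lt ?_ hTq
    refine le_trans ?_ (hS k' k)
    rw [hs, abs_mul]
    exact le_mul_of_one_le_left (abs_nonneg _) (by rw [abs_of_nonneg] <;> omega)
  have hl : l ≤ 2 ^ q := by
    rcases Nat.eq_zero_or_pos l with rfl | hl0
    · exact Nat.zero_le _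
    · have h1 := hX (l - 1) (by omega) (Fin.last D)
      rw [hpos (l - 1) (by omega), abs_of_nonneg (by positivity)] at h1
      have h2 : B ≤ T := by
        rw [hT]
        have : B ≤ F * W * B := le_mul_of_one_le_left (by omega) (by linarith)
        exact this.trans (le_mul_of_one_le_left (by linarith) hD1)
      have h3 : (l : ℤ) ≤ 2 ^ q := by push_cast [Nat.cast_sub hl0] at h1; linarith
      exact_mod_cast h3
  let a : Fin l → Fin l := fun k => ⟨L.att X k, lt_of_le_of_lt (rmax_le _ _) k.2⟩
  have hatt : rndM (2 * q + 1) (maskedSoftmax (castM s)) =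
      castM (Matrix.of fun i k => if i = a k then 1 else 0) := by
    refine rndM_maskedSoftmax hl hq a (fun k => rmax_le _ _) fun k i hi hne => ?_
    have := Layer.score_att_gap hpos (by exact_mod_cast hM : (l : ℤ) * l ≤ M) k.2 hi
      (fun e => hne (Fin.ext e))
    have h2 : (0 : ℤ) ≤ 2 * q + 2 := by positivity
    calc s i k + (2 * q + 2) = (2 * q + 2) * (M * L.score (X i) (X k) +
          X i (Fin.last D) * X k (Fin.last D) + 1) := by simp only [s, Matrix.of_apply]; ring
      _ ≤ _ := mul_le_mul_of_nonneg_left this h2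
  have hVE : ∀ t (k : Fin l), ((L.matV * cols l X) *
      (Matrix.of fun i k => if i = a k then 1 else 0 : Matrix (Fin l) (Fin l) ℤ)) t k =
      (L.vals.map fun e => if e.1 = t then lin e.2 (X (L.att X k)) else 0).sum := by
    intro t k
    rw [Matrix.mul_apply]
    simp only [Matrix.of_apply, mul_ite, mul_one, mul_zero, Finset.sum_ite_eq', Finset.mem_univ,
      if_true]
    rw [L.matV_apply]
  have hbd : ∀ t, ∀ k < l,
      |(L.vals.map fun e => if e.1 = t then lin e.2 (X (L.att X k)) else 0).sum| ≤ T := by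
    intro t k hk
    have h1 := hmul _ hV t (a ⟨k, hk⟩)
    rwa [L.matV_apply] at h1
  refine ⟨?_, hbd⟩
  change rndM (2 * q + 1) (rndM (2 * q + 1) (toReal (repM q L.matV) * castM (cols l X)) *
    rndM (2 * q + 1) (maskedSoftmax (rndM (2 * q + 1) ((Real.sqrt (D + 1 : ℕ))⁻¹ •
      rndM (2 * q + 1) ((rndM (2 * q + 1) (toReal (repM q L.matK) * castM (cols l X))).transpose *
        rndM (2 * q + 1) (toReal (repM q (L.matQ (2 * q + 2) r M)) * castM (cols l X))))))) = _
  rw [hprod hV, hprod hK, hprod hQ, hscale, hatt, castM_mul, rndM_castM]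
  · congr 1
    ext t k
    exact hVE t k
  · intro t k
    rw [hVE]
    exact lt_of_le_of_lt (hbd t k k.2) hTq1

/-- The feed-forward network computes the hidden units of the layer without rounding errors. -/
theorem Layer.ffn_toBlock {D w q l r M : ℕ} {W B T : ℤ} {L : Layer (D + 1)}
    (h : L.Fits w W) (hw : w ≤ D + 1) (hW : 1 ≤ W) {Y : ℕ → Fin (D + 1) → ℤ}
    (hD : 11 ≤ D + 1) (hB : 1 ≤ B)
    (hY : ∀ k < l, ∀ t, |Y k t| ≤ 2 * B) (hT : (D + 1) * (W * B) ≤ T) (hTq : T ^ 6 < 2 ^ q) :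
    (L.toBlock q w r M).ffn (castM (cols l Y)) = castM (Matrix.of fun t (k : Fin l) =>
        (L.gates.map fun g => if g.tgt = t then
          max (lin g.A (Y k) + g.a) 0 * (lin g.B (Y k) + g.b) else 0).sum) ∧
      ∀ t, ∀ k < l, |(L.gates.map fun g => if g.tgt = t then
          max (lin g.A (Y k) + g.a) 0 * (lin g.B (Y k) + g.b) else 0).sum| ≤ 9 * T ^ 5 := by
  have hD' : (11 : ℤ) ≤ D + 1 := by exact_mod_cast hD
  have hWB : W ≤ W * B := le_mul_of_one_le_right (by omega) hB
  have hWBT : W * B ≤ T := (le_mul_of_one_le_left (by omega) (by omega)).trans hT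
  have hDT : ((D + 1 : ℕ) : ℤ) ≤ T := by
    push_cast
    exact (le_mul_of_one_le_right (by omega) (by omega)).trans hT
  have hT11 : 11 ≤ T := by push_cast at hDT; omega
  have hpow : 11 * T ^ 5 ≤ T ^ 6 := by
    rw [pow_succ' T 5]
    exact mul_le_mul_of_nonneg_right hT11 (by positivity)
  have hTT5 : T ≤ T ^ 5 := le_self_pow₀ (by omega) (by norm_num)
  have hT1q : 9 * T ^ 5 < 2 ^ q := by linarith [pow_nonneg (by omega : (0 : ℤ) ≤ T) 5]
  have hTq1 : 3 * T < 2 ^ q := by linarith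
  have hT4 : 9 * T ^ 4 < 2 ^ q := by
    have : T ^ 4 ≤ T ^ 5 := pow_le_pow_right₀ (by omega) (by norm_num)
    linarith
  -- one affine layer
  have haff : ∀ (R : ℕ → List (ℤ × Fin (D + 1))) (c : ℕ → ℤ), (∀ i, wt (R i) ≤ W) →
      (∀ i, |c i| ≤ W) →
      rndM (2 * q + 1) (rndM (2 * q + 1)
        (toReal (repM q (Matrix.of fun (i : Fin w) => coef (R i))) * castM (cols l Y)) +
          Matrix.of fun (i : Fin w) _ => (rndRep (2 * q + 1) (c i) : ℝ)) =
        castM (Matrix.of fun (i : Fin w) (k : Fin l) => lin (R i) (Y k) + c i) ∧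
      ∀ i, ∀ k < l, |lin (R i) (Y k) + c i| ≤ 3 * T := by
    intro R c hR hc
    have h1 : ∀ i j, |coef (R i) j| ≤ W := fun i j => (abs_coef_le _ _).trans (hR i)
    have h2 : ∀ i (k : Fin l), ((Matrix.of fun (i : Fin w) => coef (R i)) * cols l Y) i k =
        lin (R i) (Y k) := by
      intro i k
      rw [mul_cols_apply]
      exact sum_coef_mul _ _
    have h3 : ∀ i, ∀ k < l, |lin (R i) (Y k)| ≤ 2 * T := by
      intro i k hk
      have := abs_mul_apply_le (A := Matrix.of fun (_ : Fin 1) => coef (R i)) (B := cols l Y) 0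
        ⟨k, hk⟩ (fun j => h1 i j) (fun t => hY k hk t)
      rw [mul_cols_apply] at this
      simp only [Matrix.of_apply, sum_coef_mul, Fintype.card_fin] at this
      push_cast at this
      linarith
    have h4 : ∀ i, ∀ k < l, |lin (R i) (Y k) + c i| ≤ 3 * T := fun i k hk => by
      refine (abs_add_le _ _).trans ?_
      linarith [h3 i k hk, hc i]
    refine ⟨?_, h4⟩
    rw [toReal_repM fun i j => by
      simp only [Matrix.of_apply]; linarith [h1 i j], castM_mul, rndM_castM fun i k => by
      rw [h2]; linarith [h3 i k k.2]]
    rw [← rndM_castM (q := q) (A := Matrix.of fun (i : Fin w) (k : Fin l) =>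
      lin (R i) (Y k) + c i) fun i k => by
        simp only [Matrix.of_apply]; linarith [h4 i k k.2]]
    congr 1
    ext i k
    have h5 : (rndRep (2 * q + 1) (c i) : ℝ) = c i :=
      rnd_intCast (by linarith [hc i])
    simp only [castM, Matrix.add_apply, Matrix.map_apply, Matrix.of_apply, h2, h5]
    push_cast
    rfl
  have hu := L.unit_wt h (by omega)
  obtain ⟨hA, hA'⟩ := haff (fun i => (L.unit i).A) (fun i => (L.unit i).a) (fun i => (hu i).1)
    (fun i => (hu i).2.1)
  obtain ⟨hBm, hB'⟩ := haff (fun i => (L.unit i).B) (fun i => (L.unit i).b) (fun i => (hu i).2.2.1)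
    (fun i => (hu i).2.2.2)
  let z : Matrix (Fin w) (Fin l) ℤ := Matrix.of fun i k =>
    max (lin (L.unit i).A (Y k) + (L.unit i).a) 0 * (lin (L.unit i).B (Y k) + (L.unit i).b)
  have hz : ∀ i k, |z i k| ≤ 9 * T ^ 4 := by
    intro i k
    have h1 := hA' i k k.2
    have h2 := hB' i k k.2
    have h3 : |max (lin (L.unit i).A (Y k) + (L.unit i).a) 0| ≤ 3 * T := by
      rw [abs_of_nonneg (le_max_right _ _)]
      exact max_le ((le_abs_self _).trans h1) (by omega)
    have h4 : |z i k| ≤ 3 * T * (3 * T) := by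
      simp only [z, Matrix.of_apply]
      rw [abs_mul]
      exact mul_le_mul h3 h2 (abs_nonneg _) (by omega)
    have h5 : T ^ 2 ≤ T ^ 4 := pow_le_pow_right₀ (by omega) (by norm_num)
    nlinarith
  have hW3 : ∀ t i, |L.matW3 w t i| ≤ 1 := by
    intro t i
    simp only [Layer.matW3, Matrix.of_apply]
    split_ifs <;> simp
  have hsum : ∀ t (k : Fin l), (L.matW3 w * z) t k = (L.gates.map fun g => if g.tgt = t then
      max (lin g.A (Y k) + g.a) 0 * (lin g.B (Y k) + g.b) else 0).sum := by
    intro t k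
    rw [Matrix.mul_apply, ← sum_getD L.gates ⟨0, [], 0, [], 0⟩ (fun g => if g.tgt = t then
      max (lin g.A (Y k) + g.a) 0 * (lin g.B (Y k) + g.b) else 0) (by simp [lin]) h.gates_length]
    refine Finset.sum_congr rfl fun i _ => ?_
    simp only [Layer.matW3, z, Matrix.of_apply, ite_mul, one_mul, zero_mul]
    rfl
  have hout : ∀ t (k : Fin l), |(L.matW3 w * z) t k| ≤ 9 * T ^ 5 := by
    intro t k
    refine (abs_mul_apply_le t k (fun i => hW3 t i) (fun i => hz i k)).trans ?_
    rw [Fintype.card_fin]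
    have : (w : ℤ) ≤ T := le_trans (by exact_mod_cast hw) hDT
    calc (w : ℤ) * (1 * (9 * T ^ 4)) ≤ T * (1 * (9 * T ^ 4)) :=
          mul_le_mul_of_nonneg_right this (by positivity)
      _ = 9 * T ^ 5 := by ring
  refine ⟨?_, fun t k hk => ?_⟩
  · change rndM (2 * q + 1) (rndM (2 * q + 1) (toReal (repM q (L.matW3 w)) * rndM (2 * q + 1)
      (Matrix.of fun i k =>
        max (rndM (2 * q + 1) (rndM (2 * q + 1)
        (toReal (repM q (Matrix.of fun (i : Fin w) => coef (L.unit i).A)) * castM (cols l Y)) +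
          Matrix.of fun (i : Fin w) _ => (rndRep (2 * q + 1) (L.unit i).a : ℝ)) i k) 0 *
        rndM (2 * q + 1) (rndM (2 * q + 1)
        (toReal (repM q (Matrix.of fun (i : Fin w) => coef (L.unit i).B)) * castM (cols l Y)) +
          Matrix.of fun (i : Fin w) _ => (rndRep (2 * q + 1) (L.unit i).b : ℝ)) i k)) +
      Matrix.of fun _ _ => (rndRep (2 * q + 1) (0 : ℤ) : ℝ)) = _
    rw [hA, hBm]
    have e1 : (Matrix.of fun i k => max (castM (Matrix.of fun (i : Fin w) (k : Fin l) =>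
        lin (L.unit i).A (Y k) + (L.unit i).a) i k) 0 *
        castM (Matrix.of fun (i : Fin w) (k : Fin l) =>
        lin (L.unit i).B (Y k) + (L.unit i).b) i k) = castM z := by
      ext i k
      simp only [castM, z, Matrix.map_apply, Matrix.of_apply]
      push_cast
      rfl
    have e2 : (rndRep (2 * q + 1) ((0 : ℤ) : ℝ) : ℝ) = 0 := by
      simpa [rndRep] using rnd_intCast (q := q) (z := 0) (by simp)
    have e3 : (Matrix.of fun (_ : Fin (D + 1)) (_ : Fin l) => (0 : ℝ)) = 0 := rfl
    rw [e1, rndM_castM fun i k => lt_of_le_of_lt (hz i k) hT4,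
      toReal_repM fun t i => by linarith [hW3 t i], castM_mul,
      rndM_castM fun t k => lt_of_le_of_lt (hout t k) hT1q, e2, e3, add_zero,
      rndM_castM fun t k => lt_of_le_of_lt (hout t k) hT1q]
    congr 1
    ext t k
    exact hsum t k
  · have := hout t ⟨k, hk⟩
    rwa [hsum] at this

/-- A Transformer block of precision `2 * q + 1` executes a layer of an integer program exactly, as
long as `2 ^ q` exceeds the numbers that can occur. -/
theorem Layer.apply_toBlock {D w q l r M : ℕ} {W B T : ℤ} {L : Layer (D + 1)} (hr : r * r = D + 1)
    (h : L.Fits w W) (hw : w ≤ D + 1) (hW : 1 ≤ W) (hM : l * l ≤ M) (hM1 : 1 ≤ M) (hD : 11 ≤ D + 1)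
    {X : ℕ → Fin (D + 1) → ℤ} (hpos : ∀ k < l, X k (Fin.last D) = k + 1) (hB : 1 ≤ B)
    (hX : ∀ k < l, ∀ t, |X k t| ≤ B)
    (hT : T = (D + 1) * (r * ((2 * q + 2) * M) * W * B)) (hTq : T ^ 12 < 2 ^ q) :
    (L.toBlock q w r M).apply (castM (cols l X)) = castM (cols l (L.sem X)) ∧
      ∀ k < l, ∀ t, |L.sem X k t| ≤ T ^ 12 := by
  have hr0 : 0 < r := Nat.pos_of_ne_zero (by rintro rfl; simp at hr)
  have hF1 : (1 : ℤ) ≤ r * ((2 * q + 2) * M) := by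
    have : (0 : ℤ) < r * ((2 * q + 2) * M) := by positivity
    omega
  have hD' : (11 : ℤ) ≤ D + 1 := by exact_mod_cast hD
  set F : ℤ := r * ((2 * q + 2) * M) with hF
  have hWF : W ≤ F * W := le_mul_of_one_le_left (by omega) hF1
  have hBT : (D + 1) * B ≤ T := by
    rw [hT]
    refine mul_le_mul_of_nonneg_left (le_mul_of_one_le_left (by omega) (by omega)) (by omega)
  have hB11 : 11 * B ≤ (D + 1) * B := mul_le_mul_of_nonneg_right hD' (by omega)
  have hT11 : 11 ≤ T := by linarith
  have hmono : ∀ {m : ℕ}, m ≤ 12 → T ^ m < 2 ^ q := fun hm =>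
    lt_of_le_of_lt (pow_le_pow_right₀ (by omega) hm) hTq
  obtain ⟨hh, hhb⟩ := Layer.head_toBlock hr h hW hM hM1 hpos hB hX hT (hmono (by norm_num))
  have hattn : (L.toBlock q w r M).attn (castM (cols l X)) = castM (Matrix.of fun t (k : Fin l) =>
        (L.vals.map fun e => if e.1 = t then lin e.2 (X (L.att X k)) else 0).sum) := by
    unfold Block.attn
    rw [Fin.sum_univ_one, hh, rndM_castM]
    intro t k
    have := hmono (m := 1) (by norm_num)
    rw [pow_one] at this
    exact lt_of_le_of_lt (hhb t k k.2) this
  have hmid : ∀ k < l, ∀ t, |L.mid X k t| ≤ 2 * T := by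
    intro k hk t
    refine (abs_add_le _ _).trans ?_
    linarith [hX k hk t, hhb t k hk]
  have hY : rndM (2 * q + 1) (castM (cols l X) + (L.toBlock q w r M).attn (castM (cols l X))) =
      castM (cols l (L.mid X)) := by
    rw [← rndM_castM (q := q) (A := cols l (L.mid X)) fun t k => ?_, hattn]
    · congr 1
      ext t k
      simp [castM, cols, Layer.mid]
    · have h1 : T ^ 2 < 2 ^ q := hmono (by norm_num)
      refine lt_of_le_of_lt (hmid k k.2 t) (lt_of_le_of_lt ?_ h1)
      nlinarith
  -- `T` is now the bound of the entries; the feed-forward step squares it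
  have hT2 : (D + 1) * (W * T) ≤ T ^ 2 := by
    rw [sq, ← mul_assoc]
    refine mul_le_mul_of_nonneg_right ?_ (by omega)
    rw [hT]
    exact mul_le_mul_of_nonneg_left (hWF.trans (le_mul_of_one_le_right (by omega) hB)) (by omega)
  have hTT : (T ^ 2) ^ 6 < 2 ^ q := by rw [← pow_mul]; exact hTq
  obtain ⟨hf, hfb⟩ := Layer.ffn_toBlock (r := r) (M := M) h hw hW hD (by omega : 1 ≤ T) hmid hT2
    hTT
  have hT10 : T ≤ T ^ 10 := le_self_pow₀ (by omega) (by norm_num)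
  have hT12 : 121 * T ^ 10 ≤ T ^ 12 := by
    have : 121 ≤ T ^ 2 := by nlinarith
    calc 121 * T ^ 10 ≤ T ^ 2 * T ^ 10 := mul_le_mul_of_nonneg_right this (by positivity)
      _ = T ^ 12 := by ring
  have hsem : ∀ k < l, ∀ t, |L.sem X k t| ≤ T ^ 12 := by
    intro k hk t
    refine (abs_add_le _ _).trans ?_
    have h1 := hmid k hk t
    have h2 := hfb t k hk
    have h3 : (T ^ 2) ^ 5 = T ^ 10 := by ring
    rw [h3] at h2
    linarith
  refine ⟨?_, hsem⟩
  change rndM (2 * q + 1) (rndM (2 * q + 1) (castM (cols l X) +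
    (L.toBlock q w r M).attn (castM (cols l X))) + (L.toBlock q w r M).ffn
      (rndM (2 * q + 1) (castM (cols l X) + (L.toBlock q w r M).attn (castM (cols l X))))) = _
  rw [hY, hf, ← rndM_castM (q := q) (A := cols l (L.sem X)) fun t k =>
    lt_of_le_of_lt (hsem k k.2 t) hTq]
  congr 1
  ext t k
  simp [castM, cols, Layer.sem]

/-- The result of an integer program. -/
def semList {d : ℕ} (Ls : List (Layer d)) (X : ℕ → Fin d → ℤ) : ℕ → Fin d → ℤ :=
  Ls.foldl (fun X L => L.sem X) X

/-- A stack of Transformer blocks executes an integer program. The induction starts after `i` layers,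
when the entries are bounded by `Z ^ 24 ^ i`. -/
theorem foldl_toBlock {D w q l r M : ℕ} {W Z : ℤ} (hr : r * r = D + 1) (hw : w ≤ D + 1)
    (hW : 1 ≤ W) (hM : l * l ≤ M) (hM1 : 1 ≤ M) (hD : 11 ≤ D + 1)
    (hZ : (D + 1) * (r * ((2 * q + 2) * M) * W) ≤ Z) (Ls : List (Layer (D + 1))) :
    (∀ L ∈ Ls, L.Fits w W) → ∀ (i : ℕ) (X : ℕ → Fin (D + 1) → ℤ),
      (∀ k < l, X k (Fin.last D) = k + 1) → (∀ k < l, ∀ t, |X k t| ≤ Z ^ 24 ^ i) →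
      Z ^ 24 ^ (i + Ls.length) < 2 ^ q →
      (Ls.map fun L => L.toBlock q w r M).foldl (fun Y B => B.apply Y) (castM (cols l X)) =
        castM (cols l (semList Ls X)) ∧
      ∀ k < l, ∀ t, |semList Ls X k t| ≤ Z ^ 24 ^ (i + Ls.length) := by
  have hr0 : 0 < r := Nat.pos_of_ne_zero (by rintro rfl; simp at hr)
  have hc1 : (1 : ℤ) ≤ (D + 1) * (r * ((2 * q + 2) * M) * W) := by
    have : (0 : ℤ) < (D + 1) * (r * ((2 * q + 2) * M) * W) := by positivity
    omega
  have hZ1 : 1 ≤ Z := hc1.trans hZ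
  induction Ls with
  | nil => exact fun _ i X _ hX _ => ⟨rfl, hX⟩
  | cons L Ls ih =>
    intro hfit i X hpos hX hq
    have hlen : i + (L :: Ls).length = (i + 1) + Ls.length := by simp only [List.length_cons]; omega
    rw [hlen] at hq ⊢
    set B := Z ^ 24 ^ i with hB
    set T := (D + 1) * (r * ((2 * q + 2) * M) * W * B) with hT
    have hB1 : 1 ≤ B := one_le_pow₀ hZ1
    have hTZ : T ≤ Z ^ (24 ^ i + 1) := by
      rw [pow_succ', hT, ← mul_assoc]
      exact mul_le_mul_of_nonneg_right hZ (by omega)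
    have hT0 : 0 ≤ T := by positivity
    have hT12 : T ^ 12 ≤ Z ^ 24 ^ (i + 1) := by
      refine (pow_le_pow_left₀ hT0 hTZ 12).trans ?_
      rw [← pow_mul]
      refine pow_le_pow_right₀ hZ1 ?_
      have : 1 ≤ 24 ^ i := Nat.one_le_pow _ _ (by norm_num)
      rw [pow_succ]; omega
    have hle : Z ^ 24 ^ (i + 1) ≤ Z ^ 24 ^ (i + 1 + Ls.length) :=
      pow_le_pow_right₀ hZ1 (Nat.pow_le_pow_right (by norm_num) (by omega))
    obtain ⟨h1, h2⟩ := Layer.apply_toBlock hr (hfit L (by simp)) hw hW hM hM1 hD hpos hB1 hX hT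
      (lt_of_le_of_lt (hT12.trans hle) hq)
    have := ih (fun L' hL' => hfit L' (by simp [hL'])) (i + 1) (L.sem X)
      (fun k hk => by rw [Layer.sem_last (hfit L (by simp))]; exact hpos k hk)
      (fun k hk t => (h2 k hk t).trans hT12) hq
    simp only [List.map_cons, List.foldl_cons, h1]
    exact this

/-! ### Transformers on the standard embedding -/

/-- The Transformer that executes an integer program. -/
def toTransformer {D : ℕ} (Ls : List (Layer (D + 1))) (q w r M : ℕ) :
    Transformer (2 * q + 1) (D + 1) Ls.length 1 w where
  block i := (Ls.get i).toBlock q w r M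

/-- The standard embedding of a token, as an integer vector. -/
def tokVec {n : ℕ} (d : ℕ) (v : Token n) (j : Fin d) : ℤ :=
  match v with
  | Sum.inl i => if (j : ℕ) = 0 then (i : ℤ) + 1 else if (j : ℕ) = 1 then ((i : ℤ) + 1) ^ 2 else 0
  | Sum.inr s => if (j : ℕ) = 1 + s.index then 1 else 0

/-- The standard embedding of a sequence, as a sequence of integer vectors with zero-based index `k`.
Beyond the end of `S` only the position is left. -/
def embInt {n : ℕ} (D : ℕ) (S : List (Token n)) (k : ℕ) (j : Fin (D + 1)) : ℤ :=
  (S[k]?.map fun v => tokVec (D + 1) v j).getD 0 + if j = Fin.last D then (k : ℤ) + 1 else 0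

theorem stdEmbedding_word {n d : ℕ} (v : Token n) (j : Fin d) :
    (stdEmbedding n d).word v j = tokVec d v j := by
  rcases v with i | s
  · simp only [stdEmbedding, tokVec, Nat.add_eq_right, Nat.reduceEqDiff]
    split_ifs <;> simp
  · have : ((j : ℕ) + 1 = 2 + s.index) ↔ ((j : ℕ) = 1 + s.index) := by omega
    simp only [stdEmbedding, tokVec, this]
    split_ifs <;> simp

theorem abs_tokVec_le {n d : ℕ} (hn : 1 ≤ n) (v : Token n) (j : Fin d) :
    |tokVec d v j| ≤ (n : ℤ) ^ 2 := by
  have hn' : (1 : ℤ) ≤ n ^ 2 := one_le_pow₀ (by exact_mod_cast hn)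
  rcases v with i | s
  · have h1 : ((i : ℕ) : ℤ) + 1 ≤ n := by exact_mod_cast i.2
    have h2 : (0 : ℤ) ≤ ((i : ℕ) : ℤ) := by positivity
    simp only [tokVec]
    split_ifs
    · rw [abs_of_nonneg (by positivity)]; nlinarith
    · rw [abs_of_nonneg (by positivity)]; exact pow_le_pow_left₀ (by positivity) h1 2
    · simp
  · simp only [tokVec]
    (split_ifs <;> simp); nlinarith

theorem abs_embInt_le {n D : ℕ} (hn : 1 ≤ n) (S : List (Token n)) {k : ℕ} (hk : k < S.length)
    (j : Fin (D + 1)) : |embInt D S k j| ≤ (n : ℤ) ^ 2 + S.length := by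
  unfold embInt
  refine (abs_add_le _ _).trans (add_le_add ?_ ?_)
  · rw [List.getElem?_eq_getElem hk]
    exact abs_tokVec_le hn _ _
  · split_ifs
    · rw [abs_of_nonneg (by positivity)]; exact_mod_cast hk
    · simp

theorem emb_eq_castM {n D q : ℕ} (hn : 1 ≤ n) (S : List (Token n))
    (hq : (n : ℤ) ^ 2 + S.length < 2 ^ q) :
    (stdEmbedding n (D + 1)).emb (2 * q + 1) S = castM (cols S.length (embInt D S)) := by
  ext j k
  have hk := k.2
  have h1 : rnd (2 * q + 1) ((stdEmbedding n (D + 1)).word (S.get k) j) =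
      (tokVec (D + 1) (S.get k) j : ℤ) := by
    rw [stdEmbedding_word]
    refine rnd_intCast (lt_of_le_of_lt (abs_tokVec_le hn _ _) ?_)
    have : (0 : ℤ) ≤ S.length := by positivity
    linarith
  have h2 : (stdEmbedding n (D + 1)).pos (k + 1) j =
      ((if j = Fin.last D then ((k : ℕ) : ℤ) + 1 else 0 : ℤ) : ℝ) := by
    have : j = Fin.last D ↔ (j : ℕ) + 1 = D + 1 := by
      rw [Fin.ext_iff, Fin.val_last]; omega
    simp only [stdEmbedding, this]
    split_ifs <;> simp
  have h3 : rnd (2 * q + 1) ((stdEmbedding n (D + 1)).pos (k + 1) j) =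
      ((if j = Fin.last D then ((k : ℕ) : ℤ) + 1 else 0 : ℤ) : ℝ) := by
    rw [h2]
    refine rnd_intCast (lt_of_le_of_lt ?_ hq)
    split_ifs
    · rw [abs_of_nonneg (by positivity)]
      have : ((k : ℕ) : ℤ) + 1 ≤ S.length := by exact_mod_cast hk
      have : (0 : ℤ) ≤ (n : ℤ) ^ 2 := by positivity
      linarith
    · rw [abs_zero]; positivity
  have h4 : embInt D S k j = tokVec (D + 1) (S.get k) j +
      if j = Fin.last D then ((k : ℕ) : ℤ) + 1 else 0 := by
    simp [embInt]
  change rnd (2 * q + 1) (rnd (2 * q + 1) ((stdEmbedding n (D + 1)).word (S.get k) j) +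
    rnd (2 * q + 1) ((stdEmbedding n (D + 1)).pos (k + 1) j)) = ((embInt D S k j : ℤ) : ℝ)
  rw [h1, h3, ← Int.cast_add, ← h4]
  exact rnd_intCast (lt_of_le_of_lt (abs_embInt_le hn S hk j) hq)

/-- The logit of a token for the integer output vector `x`. -/
def logit {n d : ℕ} (x : Fin d → ℤ) (v : Token n) : ℤ := ∑ j, tokVec d v j * x j

/-- The logits of an integer output vector are computed exactly, so that a unique maximum decides. -/
theorem argmax_readout {n d q : ℕ} {x : Fin d → ℤ} {B : ℤ} (hn : 1 ≤ n) (hx : ∀ j, |x j| ≤ B)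
    (hB : d * ((n : ℤ) ^ 2 * B) < 2 ^ q) (hn2 : (n : ℤ) ^ 2 < 2 ^ q)
    {τ : (Token n → ℝ) → Token n} (hτ : IsArgmax τ) {v : Token n}
    (hv : ∀ v' ≠ v, logit x v' < logit x v) :
    τ ((stdEmbedding n d).readout (2 * q + 1) fun j => (x j : ℝ)) = v := by
  have h1 : ∀ v, rnd (2 * q + 1) (∑ j, rnd (2 * q + 1) ((stdEmbedding n d).word v j) * (x j : ℝ)) =
      (logit x v : ℤ) := by
    intro v
    have e : ∑ j, rnd (2 * q + 1) ((stdEmbedding n d).word v j) * (x j : ℝ) = (logit x v : ℤ) := by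
      unfold logit
      push_cast
      refine Finset.sum_congr rfl fun j _ => ?_
      rw [stdEmbedding_word, rnd_intCast (lt_of_le_of_lt (abs_tokVec_le hn _ _) hn2)]
    rw [e]
    refine rnd_intCast (lt_of_le_of_lt ?_ hB)
    unfold logit
    refine (Finset.abs_sum_le_sum_abs _ _).trans ?_
    refine (Finset.sum_le_card_nsmul _ _ ((n : ℤ) ^ 2 * B) fun j _ => ?_).trans (by simp)
    rw [abs_mul]
    exact mul_le_mul (abs_tokVec_le hn _ _) (hx j) (abs_nonneg _) (by positivity)
  by_contra hne
  have h2 := hτ ((stdEmbedding n d).readout (2 * q + 1) fun j => (x j : ℝ)) v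
  have h3 := hv _ hne
  unfold Embedding.readout softmax at h2 h3
  simp only [h1] at h2 h3
  have hpos : 0 < ∑ v : Token n, Real.exp (logit x v : ℤ) :=
    Finset.sum_pos (fun _ _ => Real.exp_pos _) ⟨v, Finset.mem_univ _⟩
  rw [div_le_div_iff_of_pos_right hpos, Real.exp_le_exp, Int.cast_le] at h2
  exact absurd h2 (not_le.2 h3)

/-- If the logits computed by an integer program have a unique maximum, then the Transformer
generates the corresponding token, whatever the rule for ties. -/
theorem argmax_toTransformer_lm {D w q r M n : ℕ} {W Z : ℤ} (hr : r * r = D + 1) (hw : w ≤ D + 1)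
    (hW : 1 ≤ W) (hn : 1 ≤ n) (hD : 11 ≤ D + 1)
    (hZ : (D + 1) * (r * ((2 * q + 2) * M) * W) ≤ Z) {Ls : List (Layer (D + 1))}
    (hfit : ∀ L ∈ Ls, L.Fits w W) (hq : Z ^ 24 ^ (Ls.length + 1) < 2 ^ q) {S : List (Token n)}
    (hS : 0 < S.length) (hM : S.length * S.length ≤ M) (hnl : (n : ℤ) ^ 2 + S.length ≤ Z)
    {τ : (Token n → ℝ) → Token n} (hτ : IsArgmax τ) {v : Token n}
    (hv : ∀ v' ≠ v, logit (semList Ls (embInt D S) (S.length - 1)) v' <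
      logit (semList Ls (embInt D S) (S.length - 1)) v) :
    τ ((toTransformer Ls q w r M).lm (stdEmbedding n (D + 1)) S) = v := by
  have hM1 : 1 ≤ M := le_trans (Nat.mul_pos hS hS) hM
  have hr0 : 0 < r := Nat.pos_of_ne_zero (by rintro rfl; simp at hr)
  have hc1 : (D + 1 : ℤ) ≤ Z := by
    refine le_trans (le_mul_of_one_le_right (by positivity) ?_) hZ
    have : (0 : ℤ) < r * ((2 * q + 2) * M) * W := by positivity
    omega
  have hZ1 : 1 ≤ Z := by linarith [(Nat.cast_nonneg D : (0 : ℤ) ≤ D)]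
  set e := 24 ^ Ls.length with he
  have he1 : 1 ≤ e := Nat.one_le_pow _ _ (by norm_num)
  have he2 : 24 ^ (Ls.length + 1) = 24 * e := by rw [pow_succ]; omega
  rw [he2] at hq
  have hmono : ∀ {m : ℕ}, m ≤ 24 * e → Z ^ m < 2 ^ q := fun hm =>
    lt_of_le_of_lt (pow_le_pow_right₀ hZ1 hm) hq
  have hl0 : (0 : ℤ) ≤ S.length := by positivity
  have hn0 : (0 : ℤ) ≤ (n : ℤ) ^ 2 := by positivity
  have hZq : Z < 2 ^ q := by simpa using hmono (m := 1) (by omega)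
  have hemb := emb_eq_castM (D := D) hn S (lt_of_le_of_lt hnl hZq)
  obtain ⟨h1, h2⟩ := foldl_toBlock (l := S.length) hr hw hW hM hM1 hD hZ Ls hfit 0 (embInt D S)
    (fun k hk => by
      have h2 : S[k]? = some S[k] := List.getElem?_eq_getElem hk
      have h3 : tokVec (D + 1) S[k] (Fin.last D) = 0 := by
        rcases S[k] with i | s
        · simp only [tokVec, Fin.val_last]
          rw [if_neg (by omega), if_neg (by omega)]
        · simp only [tokVec, Fin.val_last]
          exact if_neg (by cases s <;> simp only [Special.index] <;> omega)
      simp [embInt, h2, h3])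
    (fun k hk t => by
      rw [pow_zero, pow_one]
      exact (abs_embInt_le hn S hk t).trans hnl)
    (by rw [zero_add]; exact hmono (by omega))
  have hrun : ∀ j, (toTransformer Ls q w r M).run ((stdEmbedding n (D + 1)).emb (2 * q + 1) S) j
      ⟨S.length - 1, Nat.sub_lt hS Nat.one_pos⟩ =
        ((semList Ls (embInt D S) (S.length - 1) j : ℤ) : ℝ) := by
    intro j
    have : List.ofFn (toTransformer Ls q w r M).block = Ls.map fun L => L.toBlock q w r M := by
      conv_rhs => rw [← List.ofFn_get Ls, List.map_ofFn]
      rfl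
    rw [hemb, Transformer.run, this, h1]
    rfl
  unfold Transformer.lm
  rw [dif_pos hS]
  simp only [hrun]
  refine argmax_readout (B := Z ^ e) hn (fun j => ?_) ?_ (by linarith) hτ hv
  · have := h2 (S.length - 1) (by omega) j
    rwa [zero_add] at this
  · calc ((D + 1 : ℕ) : ℤ) * ((n : ℤ) ^ 2 * Z ^ e) ≤ Z * (Z * Z ^ e) := by
          push_cast
          gcongr
          linarith
      _ = Z ^ (e + 2) := by ring
      _ < 2 ^ q := hmono (by omega)

/-- A precision proportional to `log n` suffices for numbers of any fixed polynomial size. -/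
theorem exists_precision (c e : ℕ) : ∃ K, 1 ≤ K ∧ ∀ n : ℕ,
    (c * (K * (Nat.log 2 n + 1)) * n ^ 5) ^ e < 2 ^ (K * (Nat.log 2 n + 1)) := by
  have h3 : ∀ s, 6 ≤ s → 3 * s ≤ 2 ^ s := by
    intro s hs
    induction s, hs using Nat.le_induction with
    | base => norm_num
    | succ s hs ih => rw [pow_succ]; omega
  set s := c + e + 6 with hs
  set t := 2 * s with ht
  have hK : (c + t + 6) * e < 2 ^ t := by
    have h4 := h3 s (by omega)
    have h5 : e < 2 ^ s := lt_of_lt_of_le (by omega) h4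
    rw [ht, two_mul, pow_add]
    calc (c + (s + s) + 6) * e ≤ 2 ^ s * e := Nat.mul_le_mul_right _ (by omega)
      _ < 2 ^ s * 2 ^ s := Nat.mul_lt_mul_of_pos_left h5 (by positivity)
  refine ⟨2 ^ t, Nat.one_le_two_pow, fun n => ?_⟩
  set m := Nat.log 2 n + 1 with hm
  have hn : n ≤ 2 ^ m := (Nat.lt_pow_succ_log_self (by norm_num) n).le
  have hc : c ≤ 2 ^ (c * m) := by
    refine (Nat.lt_two_pow_self).le.trans (Nat.pow_le_pow_right (by norm_num) ?_)
    exact Nat.le_mul_of_pos_right _ (by omega)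
  have ht' : 2 ^ t ≤ 2 ^ (t * m) :=
    Nat.pow_le_pow_right (by norm_num) (Nat.le_mul_of_pos_right _ (by omega))
  have hb : c * (2 ^ t * m) * n ^ 5 ≤ 2 ^ ((c + t + 6) * m) := by
    calc c * (2 ^ t * m) * n ^ 5 ≤ 2 ^ (c * m) * (2 ^ (t * m) * 2 ^ m) * (2 ^ m) ^ 5 := by
          gcongr
          exact Nat.lt_two_pow_self.le
      _ = 2 ^ ((c + t + 6) * m) := by ring
  calc (c * (2 ^ t * m) * n ^ 5) ^ e ≤ (2 ^ ((c + t + 6) * m)) ^ e := Nat.pow_le_pow_left hb e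
    _ = 2 ^ ((c + t + 6) * e * m) := by rw [← pow_mul]; ring_nf
    _ < 2 ^ (2 ^ t * m) :=
      Nat.pow_lt_pow_right (by norm_num) (Nat.mul_lt_mul_of_pos_right hK (by omega))

/-! ### Straight-line integer programs -/

/-- The contribution of hidden units to the coordinate `t`. -/
def gsum {d : ℕ} (gs : List (Gate d)) (x : Fin d → ℤ) (t : Fin d) : ℤ :=
  (gs.map fun g => if g.tgt = t then
    max (lin g.A x + g.a) 0 * (lin g.B x + g.b) else 0).sum

/-- The coordinates to which a layer writes. -/
def Layer.writes {d : ℕ} (L : Layer d) : List (Fin d) :=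
  L.vals.map (fun e => e.1) ++ L.gates.map fun g => g.tgt

/-- The linear form `r` reads no coordinate in `l`. -/
def avoids {d : ℕ} (l : List (Fin d)) (r : List (ℤ × Fin d)) : Bool :=
  r.all fun e => !l.contains e.2

/-- A program is in single-assignment form if every coordinate is written by one layer at most,
by its attention or by its hidden units, and read only after that. -/
def singleAssignment {d : ℕ} : List (Layer d) → Bool
  | [] => true
  | L :: Ls =>
      L.pairs.all (fun e => avoids (L.writes ++ Ls.flatMap Layer.writes) e.1 &&
        avoids (L.writes ++ Ls.flatMap Layer.writes) e.2) &&
      L.vals.all (fun e => avoids (L.writes ++ Ls.flatMap Layer.writes) e.2) &&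
      L.gates.all (fun g => avoids (L.gates.map (fun g => g.tgt) ++ Ls.flatMap Layer.writes) g.A &&
        avoids (L.gates.map (fun g => g.tgt) ++ Ls.flatMap Layer.writes) g.B) &&
      L.writes.all (fun t => !(Ls.flatMap Layer.writes).contains t) &&
      singleAssignment Ls

/-- What the layer writes into the coordinate `t` at position `k`, if its inputs are as in `Y`. -/
def Layer.delta {d : ℕ} (L : Layer d) (Y : ℕ → Fin d → ℤ) (k : ℕ) (t : Fin d) : ℤ :=
  (L.vals.map fun e => if e.1 = t then lin e.2 (Y (L.att Y k)) else 0).sum + gsum L.gates (Y k) t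

theorem lin_congr {d : ℕ} {l : List (Fin d)} {r : List (ℤ × Fin d)} (h : avoids l r = true)
    {x y : Fin d → ℤ} (hxy : ∀ t ∉ l, x t = y t) : lin r x = lin r y := by
  unfold lin
  congr 1
  refine List.map_congr_left fun e he => ?_
  have := List.all_eq_true.1 h e he
  rw [hxy e.2 (by simpa using this)]

theorem Layer.mid_of_notMem {d : ℕ} (L : Layer d) (X : ℕ → Fin d → ℤ) (k : ℕ) {t : Fin d}
    (h : t ∉ L.vals.map fun e => e.1) : L.mid X k t = X k t := by
  unfold Layer.mid
  rw [List.sum_eq_zero, add_zero]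
  intro x hx
  obtain ⟨e, he, rfl⟩ := List.mem_map.1 hx
  exact if_neg fun h' => h (List.mem_map.2 ⟨e, he, h'⟩)

theorem Layer.sem_of_notMem {d : ℕ} (L : Layer d) (X : ℕ → Fin d → ℤ) (k : ℕ) {t : Fin d}
    (h : t ∉ L.gates.map fun g => g.tgt) : L.sem X k t = L.mid X k t := by
  unfold Layer.sem
  rw [List.sum_eq_zero, add_zero]
  intro x hx
  obtain ⟨e, he, rfl⟩ := List.mem_map.1 hx
  exact if_neg fun h' => h (List.mem_map.2 ⟨e, he, h'⟩)

theorem Layer.sem_of_notMem_writes {d : ℕ} (L : Layer d) (X : ℕ → Fin d → ℤ) (k : ℕ) {t : Fin d}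
    (h : t ∉ L.writes) : L.sem X k t = X k t := by
  rw [Layer.writes, List.mem_append, not_or] at h
  rw [L.sem_of_notMem X k h.2, L.mid_of_notMem X k h.1]

theorem semList_of_notMem {d : ℕ} (Ls : List (Layer d)) (X : ℕ → Fin d → ℤ) (k : ℕ) {t : Fin d}
    (h : t ∉ Ls.flatMap Layer.writes) : semList Ls X k t = X k t := by
  induction Ls generalizing X with
  | nil => rfl
  | cons L Ls ih =>
    rw [List.flatMap_cons, List.mem_append, not_or] at h
    change semList Ls (L.sem X) k t = X k t
    rw [ih _ h.2, L.sem_of_notMem_writes X k h.1]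

/-- In a program in single-assignment form, the final values of the coordinates satisfy the
equations that the layers express. -/
theorem semList_eq_delta {d : ℕ} {Ls : List (Layer d)} (h : singleAssignment Ls = true)
    {X : ℕ → Fin d → ℤ} {L : Layer d} (hL : L ∈ Ls) {k : ℕ} {t : Fin d} (ht : t ∈ L.writes)
    (h0 : X k t = 0) : semList Ls X k t = L.delta (semList Ls X) k t := by
  induction Ls generalizing X with
  | nil => simp at hL
  | cons L' Ls ih =>
    rw [singleAssignment] at h
    simp only [Bool.and_eq_true, List.all_eq_true] at h
    obtain ⟨⟨⟨⟨hp, hv⟩, hg⟩, hw⟩, hs⟩ := h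
    have hw' : ∀ t ∈ L'.writes, t ∉ Ls.flatMap Layer.writes := fun t ht => by simpa using hw t ht
    change semList Ls (L'.sem X) k t = L.delta (semList Ls (L'.sem X)) k t
    by_cases hLL : L ∈ Ls
    · refine ih hs hLL ?_
      rw [L'.sem_of_notMem_writes X k fun h' => hw' t h' ?_, h0]
      exact List.mem_flatMap.2 ⟨L, hLL, ht⟩
    obtain rfl : L = L' := by
      rcases List.mem_cons.1 hL with h' | h'
      · exact h'
      · exact absurd h' hLL
    set Y := semList Ls (L.sem X) with hY
    have e1 : ∀ j, ∀ t ∉ L.writes ++ Ls.flatMap Layer.writes, X j t = Y j t := by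
      intro j t ht
      rw [List.mem_append, not_or] at ht
      rw [hY, semList_of_notMem _ _ _ ht.2, L.sem_of_notMem_writes X j ht.1]
    have e2 : ∀ t ∉ L.gates.map (fun g => g.tgt) ++ Ls.flatMap Layer.writes,
        L.mid X k t = Y k t := by
      intro t ht
      rw [List.mem_append, not_or] at ht
      rw [hY, semList_of_notMem _ _ _ ht.2, L.sem_of_notMem X k ht.1]
    have hatt : L.att X k = L.att Y k := by
      unfold Layer.att Layer.score
      congr 1
      funext j
      congr 1
      refine List.map_congr_left fun e he => ?_
      obtain ⟨h1, h2⟩ := hp e he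
      rw [lin_congr h1 (e1 j), lin_congr h2 (e1 k)]
    rw [hY, semList_of_notMem _ _ _ (hw' t ht), ← hY, Layer.sem, Layer.mid, h0, zero_add,
      Layer.delta, gsum]
    congr 2
    · refine List.map_congr_left fun e he => ?_
      rw [lin_congr (hv e he) (e1 _), hatt]
    · refine List.map_congr_left fun g hg' => ?_
      obtain ⟨h1, h2⟩ := hg g hg'
      rw [lin_congr h1 e2, lin_congr h2 e2]

/-- Hidden units that add `B x` to the coordinate `t` if `r x + c = 0`: the products of `B x` with
the three pieces of a hat function. -/
def hatGates {d : ℕ} (t : Fin d) (r : List (ℤ × Fin d)) (c : ℤ) (B : List (ℤ × Fin d)) :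
    List (Gate d) :=
  [⟨t, r, c + 1, B, 0⟩, ⟨t, r, c, B.map fun e => (-2 * e.1, e.2), 0⟩, ⟨t, r, c - 1, B, 0⟩]

/-- Hidden units that add `B x` to the coordinate `t` if `0 ≤ r x + c`. -/
def stepGates {d : ℕ} (t : Fin d) (r : List (ℤ × Fin d)) (c : ℤ) (B : List (ℤ × Fin d)) :
    List (Gate d) :=
  [⟨t, r, c + 1, B, 0⟩, ⟨t, r, c, B.map fun e => (-1 * e.1, e.2), 0⟩]

theorem lin_map_mul {d : ℕ} (m : ℤ) (r : List (ℤ × Fin d)) (x : Fin d → ℤ) :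
    lin (r.map fun e => (m * e.1, e.2)) x = m * lin r x := by
  induction r with
  | nil => simp [lin]
  | cons e r ih =>
    simp only [lin, List.map_cons, List.sum_cons] at ih ⊢
    rw [ih]; ring

theorem gsum_nil {d : ℕ} (x : Fin d → ℤ) (t : Fin d) : gsum [] x t = 0 := rfl

theorem gsum_cons {d : ℕ} (g : Gate d) (gs : List (Gate d)) (x : Fin d → ℤ) (t : Fin d) :
    gsum (g :: gs) x t = (if g.tgt = t then
      max (lin g.A x + g.a) 0 * (lin g.B x + g.b) else 0) + gsum gs x t := by
  simp [gsum]

theorem gsum_append {d : ℕ} (gs gs' : List (Gate d)) (x : Fin d → ℤ) (t : Fin d) :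
    gsum (gs ++ gs') x t = gsum gs x t + gsum gs' x t := by
  simp [gsum]

theorem gsum_hatGates {d : ℕ} (t' : Fin d) (r : List (ℤ × Fin d)) (c : ℤ) (B : List (ℤ × Fin d))
    (x : Fin d → ℤ) (t : Fin d) : gsum (hatGates t' r c B) x t =
      if t' = t then (if lin r x + c = 0 then lin B x else 0) else 0 := by
  simp only [hatGates, gsum_cons, gsum_nil, lin_map_mul]
  split_ifs with h1 h2
  · rw [max_eq_left (by omega), max_eq_right (by omega : lin r x + c ≤ 0), max_eq_right (by omega)]
    linear_combination lin B x * h2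
  · rcases lt_or_gt_of_ne h2 with h | h
    · rw [max_eq_right (by omega), max_eq_right (by omega), max_eq_right (by omega)]; ring
    · rw [max_eq_left (by omega), max_eq_left (by omega), max_eq_left (by omega)]; ring
  · rfl

theorem gsum_stepGates {d : ℕ} (t' : Fin d) (r : List (ℤ × Fin d)) (c : ℤ) (B : List (ℤ × Fin d))
    (x : Fin d → ℤ) (t : Fin d) : gsum (stepGates t' r c B) x t =
      if t' = t then (if 0 ≤ lin r x + c then lin B x else 0) else 0 := by
  simp only [stepGates, gsum_cons, gsum_nil, lin_map_mul]
  split_ifs with h1 h2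
  · rw [max_eq_left (by omega), max_eq_left (by omega)]; ring
  · rw [max_eq_right (by omega), max_eq_right (by omega)]; ring
  · rfl

/-! ### The registers -/

-- The registers up to `rES` hold the word embedding, and `rPOS` holds the position, counted from one.
-- The others are zero in the input. The name of a register is `r` followed by a mnemonic, and its
-- final value is computed in `body_spec`.
local notation "rNUM" => ((0 : Fin 64))
local notation "rSQ" => ((1 : Fin 64))
local notation "rSTART" => ((2 : Fin 64))
local notation "rEDGE" => ((3 : Fin 64))
local notation "rYES" => ((4 : Fin 64))
local notation "rNO" => ((5 : Fin 64))
local notation "rSS" => ((6 : Fin 64))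
local notation "rES" => ((7 : Fin 64))
local notation "rONE" => ((8 : Fin 64))
local notation "rPP" => ((9 : Fin 64))
local notation "rEP" => ((10 : Fin 64))
local notation "rWN" => ((11 : Fin 64))
local notation "rWN2" => ((12 : Fin 64))
local notation "rN1" => ((13 : Fin 64))
local notation "rE1" => ((14 : Fin 64))
local notation "rG0" => ((15 : Fin 64))
local notation "rG1" => ((16 : Fin 64))
local notation "rG2" => ((17 : Fin 64))
local notation "rN2" => ((18 : Fin 64))
local notation "rU" => ((19 : Fin 64))
local notation "rS1" => ((20 : Fin 64))
local notation "rF" => ((21 : Fin 64))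
local notation "rT1" => ((22 : Fin 64))
local notation "rU2" => ((23 : Fin 64))
local notation "rV3" => ((24 : Fin 64))
local notation "rS2" => ((25 : Fin 64))
local notation "rT2" => ((26 : Fin 64))
local notation "rA" => ((27 : Fin 64))
local notation "rB" => ((28 : Fin 64))
local notation "rD" => ((29 : Fin 64))
local notation "rU3" => ((30 : Fin 64))
local notation "rC" => ((31 : Fin 64))
local notation "rAV" => ((32 : Fin 64))
local notation "rOK" => ((33 : Fin 64))
local notation "rSU" => ((34 : Fin 64))
local notation "rTU" => ((35 : Fin 64))
local notation "rMU" => ((36 : Fin 64))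
local notation "rQ0" => ((37 : Fin 64))
local notation "rQ1" => ((38 : Fin 64))
local notation "rQ2" => ((39 : Fin 64))
local notation "rQ3" => ((40 : Fin 64))
local notation "rSV" => ((41 : Fin 64))
local notation "rTV" => ((42 : Fin 64))
local notation "rMV" => ((43 : Fin 64))
local notation "rPU" => ((44 : Fin 64))
local notation "rVN" => ((45 : Fin 64))
local notation "rPV" => ((46 : Fin 64))
local notation "rVIS" => ((47 : Fin 64))
local notation "rVK" => ((48 : Fin 64))
local notation "rRU" => ((49 : Fin 64))
local notation "rRV" => ((50 : Fin 64))
local notation "rR" => ((51 : Fin 64))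
local notation "rWO" => ((52 : Fin 64))
local notation "rPOS" => ((63 : Fin 64))

/-! ### The program -/

/-- Products, and copies of the numbers from position `3 * n - 2` on. -/
def layerInit (n : ℤ) : Layer 64 where
  pairs := []
  vals := []
  gates := [⟨rONE, [], 1, [], 1⟩, ⟨rPP, [(1, rPOS)], 0, [(1, rPOS)], 0⟩,
    ⟨rEP, [(1, rEDGE)], 0, [(1, rPOS)], 0⟩] ++
    (stepGates rWN [(1, rPOS)] (2 - 3 * n) [(1, rNUM)] ++
    stepGates rWN2 [(1, rPOS)] (2 - 3 * n) [(1, rSQ)])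

/-- Attention to the previous position. The hidden units mark the phases of the decoding. -/
def layerPrev (n : ℤ) : Layer 64 where
  pairs := [([(1, rPOS)], [(2, rPOS), (-2, rONE)]), ([(1, rPP)], [(-1, rONE)])]
  vals := [(rN1, [(1, rNUM)]), (rE1, [(1, rEDGE)])]
  gates := stepGates rG0 [(1, rPOS)] (1 - 3 * n) [(1, rONE)] ++
    (stepGates rG1 [(1, rPOS)] (3 - 5 * n) [(1, rONE)] ++
    stepGates rG2 [(1, rPOS)] (3 - 6 * n) [(1, rONE)])

/-- Attention to the second last position. At the second endpoint of an edge, the hidden units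
record the first endpoint and the sum of the endpoints. -/
def layerPrevPrev : Layer 64 where
  pairs := [([(1, rPOS)], [(2, rPOS), (-4, rONE)]), ([(1, rPP)], [(-1, rONE)])]
  vals := [(rN2, [(1, rNUM)])]
  gates := [⟨rU, [(1, rE1)], 0, [(1, rN2)], 0⟩, ⟨rS1, [(1, rE1)], 0, [(1, rN2), (1, rNUM)], 0⟩]

/-- Attention to the last edge token. At the second endpoint of an edge, the hidden units record the
product of the endpoints. -/
def layerLastEdge : Layer 64 where
  pairs := [([(1, rEP)], [(1, rONE)])]
  vals := [(rF, [(1, rEP)])]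
  gates := [⟨rT1, [(1, rU)], 0, [(1, rNUM)], 0⟩, ⟨rU2, [(1, rU)], 0, [(1, rU)], 0⟩,
    ⟨rV3, [(1, rNUM)], 0, [(1, rSQ)], 0⟩]

/-- The record of an edge is copied to the next position. The hidden units prepare the search in
the records, and compare the number of edges with `n - 1`. -/
def layerRecord (n : ℤ) : Layer 64 where
  pairs := [([(1, rPOS)], [(2, rPOS), (-2, rONE)]), ([(1, rPP)], [(-1, rONE)])]
  vals := [(rS2, [(1, rS1)]), (rT2, [(1, rT1)])]
  gates := [⟨rA, [(1, rS2)], 0, [(1, rS2)], 0⟩, ⟨rA, [(1, rONE)], 0, [(2, rT2)], 0⟩,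
    ⟨rB, [(1, rT2)], 0, [(1, rT2)], 0⟩, ⟨rD, [(1, rS2)], 0, [(1, rT2)], 0⟩,
    ⟨rU3, [(1, rU)], 0, [(1, rU2)], 0⟩, ⟨rC, [(1, rS1)], 0, [(1, rS1)], 0⟩,
    ⟨rC, [(1, rT1)], 0, [(1, rT1)], 0⟩, ⟨rAV, [(1, rN1)], 0, [(1, rNUM)], 0⟩] ++
    hatGates rOK [(1, rF)] (3 - 3 * n) [(1, rONE)]

/-- The search for the last recorded edge that contains the first endpoint `U` of the present edge:
an edge with the sum `S2` and the product `T2` of its endpoints contains `U` if and only if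
`U ^ 2 - U * S2 + T2 = 0`. The score is minus the square of this expression, up to a constant. -/
def layerSearchFst : Layer 64 where
  pairs := [([(1, rA)], [(-1, rU2)]), ([(1, rB)], [(-1, rONE)]), ([(1, rS2)], [(2, rU3)]),
    ([(1, rD)], [(2, rU)])]
  vals := [(rSU, [(1, rS2)]), (rTU, [(1, rT2)])]
  gates := [⟨rMU, [(1, rONE)], 0, [(1, rU2), (1, rTU)], 0⟩, ⟨rMU, [(1, rU)], 0, [(-1, rSU)], 0⟩,
    ⟨rQ0, [(1, rOK)], 0, [(1, rONE), (-1, rG0)], 0⟩, ⟨rQ1, [(1, rOK)], 0, [(1, rG0), (-1, rG1)], 0⟩,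
    ⟨rQ2, [(1, rOK)], 0, [(1, rG1), (-1, rG2)], 0⟩, ⟨rQ3, [(1, rOK)], 0, [(1, rG2)], 0⟩]

/-- The same search for the present token. -/
def layerSearchSnd : Layer 64 where
  pairs := [([(1, rA)], [(-1, rSQ)]), ([(1, rB)], [(-1, rONE)]), ([(1, rS2)], [(2, rV3)]),
    ([(1, rD)], [(2, rNUM)])]
  vals := [(rSV, [(1, rS2)]), (rTV, [(1, rT2)])]
  gates := [⟨rMV, [(1, rONE)], 0, [(1, rSQ), (1, rTV)], 0⟩, ⟨rMV, [(1, rNUM)], 0, [(-1, rSV)], 0⟩] ++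
    hatGates rPU [(1, rMU)] 0 [(1, rSU), (-1, rU)]

/-- The search for the number `POS - (5 * n - 4)` on the walk. -/
def layerVisited (n : ℤ) : Layer 64 where
  pairs := [([(1, rWN)], [(2, rPOS), (8 - 10 * n, rONE)]), ([(1, rWN2)], [(-1, rONE)])]
  vals := [(rVN, [(1, rWN)])]
  gates := hatGates rPV [(1, rMV)] 0 [(1, rSV), (-1, rNUM)] ++
    (hatGates rVIS [(1, rVN), (-1, rPOS)] (5 * n - 4) [(1, rONE)] ++
    hatGates rVK [(1, rVN), (-1, rPOS)] (5 * n - 4) [(1, rPOS), (4 - 5 * n, rONE)])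

/-- The search for the edge that consists of the last two tokens. The hidden units select the
predecessor of this edge around the present token. -/
def layerPair : Layer 64 where
  pairs := [([(1, rS1)], [(2, rN1), (2, rNUM)]), ([(1, rT1)], [(2, rAV)]), ([(1, rC)], [(-1, rONE)])]
  vals := [(rRU, [(1, rPU)]), (rRV, [(1, rPV)])]
  gates := stepGates rR [(1, rNUM), (-1, rN1)] (-1) [(1, rRV)] ++
    stepGates rR [(1, rN1), (-1, rNUM)] (-1) [(1, rRU)]

/-- If there is no predecessor, the last edge at the present token is used. -/
def layerNext : Layer 64 where
  pairs := []
  vals := []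
  gates := ⟨rWO, [(1, rONE)], 0, [(1, rR)], 0⟩ :: hatGates rWO [(1, rR)] 0 [(1, rPV)]

/-- The preparation of the output vector. -/
def layerOut : Layer 64 where
  pairs := []
  vals := []
  gates := [⟨rNUM, [], 1, [(-1, rNUM)], 0⟩, ⟨rNUM, [(1, rQ0)], 0, [(2, rNUM)], 0⟩,
    ⟨rNUM, [(1, rQ1)], 0, [(2, rWO)], 0⟩, ⟨rNUM, [(1, rQ2)], 0, [(2, rVK)], 0⟩,
    ⟨rSQ, [], 1, [(-1, rSQ)], -1⟩, ⟨rSTART, [], 1, [(-1, rSTART)], 0⟩,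
    ⟨rEDGE, [], 1, [(-1, rEDGE)], 0⟩, ⟨rYES, [], 1, [(-1, rYES), (1, rQ3)], 0⟩,
    ⟨rNO, [], 1, [(-1, rNO), (-1, rOK)], 1⟩, ⟨rNO, [(1, rQ2)], 0, [(-1, rVIS)], 1⟩,
    ⟨rSS, [], 1, [(-1, rSS)], 0⟩, ⟨rES, [], 1, [(-1, rES)], 0⟩]

/-- The output vector for the answer YES. -/
def layerYes : Layer 64 where
  pairs := []
  vals := []
  gates := [⟨rNUM, [], 1, [(-1, rNUM)], 0⟩,
    ⟨rSQ, [], 1, [(-1, rSQ)], -1⟩, ⟨rSTART, [], 1, [(-1, rSTART)], 0⟩,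
    ⟨rEDGE, [], 1, [(-1, rEDGE)], 0⟩, ⟨rYES, [], 1, [(-1, rYES)], 1⟩,
    ⟨rNO, [], 1, [(-1, rNO)], 0⟩, ⟨rSS, [], 1, [(-1, rSS)], 0⟩, ⟨rES, [], 1, [(-1, rES)], 0⟩]

/-- All layers but the last. -/
def body (n : ℤ) : List (Layer 64) :=
  [layerInit n, layerPrev n, layerPrevPrev, layerLastEdge, layerRecord n, layerSearchFst,
    layerSearchSnd, layerVisited n, layerPair, layerNext]

/-- The program for graphs with `n` vertices. There is only one graph with one vertex. -/
def program (n : ℤ) : List (Layer 64) := body n ++ [if n = 1 then layerYes else layerOut]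

theorem singleAssignment_body (n : ℤ) : singleAssignment (body n) = true := rfl

theorem rmax_congr {f g : ℕ → ℤ} (c : ℤ) (h : ∀ j, f j = g j + c) (k : ℕ) : rmax f k = rmax g k := by
  induction k with
  | zero => rfl
  | succ k ih => rw [rmax, rmax, ih, h, h]; simp

/-- Attention to the position `δ` steps back: the score is `-(j - (k - δ)) ^ 2`, up to a constant. -/
theorem rmax_fetch (δ k : ℕ) :
    rmax (fun j => ((j : ℤ) + 1) * (2 * ((k : ℤ) + 1) - 2 * δ) - ((j : ℤ) + 1) ^ 2) k = k - δ := by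
  refine rmax_eq (Nat.sub_le _ _) (fun i hi => ?_) fun i hi hj => ?_
  · have h1 : ((k - δ : ℕ) : ℤ) = k - δ := by push_cast [Nat.cast_sub (by omega : δ ≤ k)]; ring
    rw [h1]
    nlinarith [sq_nonneg ((i : ℤ) - (k - δ))]
  · rcases le_total δ k with h | h
    · have h1 : ((k - δ : ℕ) : ℤ) = k - δ := by push_cast [Nat.cast_sub h]; ring
      rw [h1]
      have : (0 : ℤ) < (i : ℤ) - (k - δ) := by omega
      nlinarith [mul_pos this this]
    · rw [Nat.sub_eq_zero_of_le h]
      have h2 : (0 : ℤ) < i := by omega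
      have h3 : (k : ℤ) ≤ δ := by exact_mod_cast h
      push_cast
      nlinarith [mul_nonneg h2.le (by omega : (0 : ℤ) ≤ δ - k), mul_pos h2 h2]

/-- The sum of the endpoints of the edge whose second endpoint is at position `k`; zero at other
positions. The numbers at the positions are `N`, and `E` indicates the edge tokens. -/
def recSum (N E : ℕ → ℤ) (k : ℕ) : ℤ := E (k - 1) * (N (k - 2) + N k)

/-- The product of the endpoints of the edge whose second endpoint is at position `k`. -/
def recProd (N E : ℕ → ℤ) (k : ℕ) : ℤ := E (k - 1) * N (k - 2) * N k

/-- This vanishes if the edge recorded at position `j` (whose second endpoint is at position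
`j - 1`) contains `v`. -/
def incid (N E : ℕ → ℤ) (v : ℤ) (j : ℕ) : ℤ := v ^ 2 - v * recSum N E (j - 1) + recProd N E (j - 1)

/-- The other endpoint of the last edge recorded up to position `k` that contains `v`; zero if
there is none. -/
def look (N E : ℕ → ℤ) (v : ℤ) (k : ℕ) : ℤ :=
  if incid N E v (rmax (fun j => -incid N E v j ^ 2) k) = 0 then
    recSum N E (rmax (fun j => -incid N E v j ^ 2) k - 1) - v else 0

/-- The position of the edge that consists of the numbers at the positions `k - 1` and `k`. -/
def pairPos (N E : ℕ → ℤ) (k : ℕ) : ℕ :=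
  rmax (fun j => -((recSum N E j - (N (k - 1) + N k)) ^ 2 +
    (recProd N E j - N (k - 1) * N k) ^ 2)) k

/-- The predecessor of the edge from the number at position `k - 1` to the number at position `k`,
among the edges at the latter, given by its other endpoint; zero if there is none. -/
def turn (N E : ℕ → ℤ) (k : ℕ) : ℤ :=
  (if N (k - 1) < N k then look N E (N (pairPos N E k)) (pairPos N E k) else 0) +
    if N k < N (k - 1) then
      look N E (E (pairPos N E k - 1) * N (pairPos N E k - 2)) (pairPos N E k) else 0

/-- The next number of the walk. -/
def nextNum (N E : ℕ → ℤ) (k : ℕ) : ℤ := turn N E k + if turn N E k = 0 then look N E (N k) k else 0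

/-- The position of the last edge token, counted from one. -/
def lastEdge (E : ℕ → ℤ) (k : ℕ) : ℤ :=
  E (rmax (fun j => E j * (j + 1)) k) * (rmax (fun j => E j * (j + 1)) k + 1)

/-- The number at position `k`, if it belongs to the decoding phase. -/
def decNum (n : ℤ) (N : ℕ → ℤ) (k : ℕ) : ℤ := if 0 ≤ (k : ℤ) + 1 + (2 - 3 * n) then N k else 0

/-- The coordinates on which the output depends. -/
structure BodySpec (n : ℤ) (N E : ℕ → ℤ) (Y : ℕ → Fin 64 → ℤ) : Prop where
  ok : ∀ k, Y k rOK = if lastEdge E k + (3 - 3 * n) = 0 then 1 else 0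
  q0 : ∀ k, Y k rQ0 = Y k rOK * (1 - if 0 ≤ (k : ℤ) + 1 + (1 - 3 * n) then 1 else 0)
  q1 : ∀ k, Y k rQ1 = Y k rOK * ((if 0 ≤ (k : ℤ) + 1 + (1 - 3 * n) then 1 else 0) -
    if 0 ≤ (k : ℤ) + 1 + (3 - 5 * n) then 1 else 0)
  q2 : ∀ k, Y k rQ2 = Y k rOK * ((if 0 ≤ (k : ℤ) + 1 + (3 - 5 * n) then 1 else 0) -
    if 0 ≤ (k : ℤ) + 1 + (3 - 6 * n) then 1 else 0)
  q3 : ∀ k, Y k rQ3 = Y k rOK * if 0 ≤ (k : ℤ) + 1 + (3 - 6 * n) then 1 else 0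
  wo : ∀ k, Y k rWO = nextNum N E k
  vis : ∀ k, Y k rVIS = if ∃ j ≤ k, decNum n N j = k + 1 + (4 - 5 * n) then 1 else 0
  vk : ∀ k, Y k rVK = if ∃ j ≤ k, decNum n N j = k + 1 + (4 - 5 * n) then
    (k : ℤ) + 1 + (4 - 5 * n) else 0

/-- A search for a zero of `g` is successful if there is one. -/
theorem rmax_neg_sq_eq_zero {g : ℕ → ℤ} {k : ℕ} :
    g (rmax (fun j => -g j ^ 2) k) = 0 ↔ ∃ j ≤ k, g j = 0 := by
  refine ⟨fun h => ⟨_, rmax_le _ _, h⟩, fun ⟨j, hj, h⟩ => ?_⟩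
  have := (rmax_spec (fun j => -g j ^ 2) k).1 j hj
  simp only [h] at this
  exact pow_eq_zero_iff (two_ne_zero) |>.1 (le_antisymm (by linarith) (sq_nonneg _))

set_option linter.unusedSimpArgs false in
/-- The final values of the coordinates satisfy the equations of the program. -/
theorem body_spec (n : ℤ) {X : ℕ → Fin 64 → ℤ} (h0 : ∀ k (t : Fin 64), 8 ≤ t → t < 63 → X k t = 0)
    (hpos : ∀ k, X k rPOS = k + 1) (hE : ∀ k, 0 ≤ X k rEDGE) (hN : ∀ k, 0 ≤ X k rNUM)
    (hSQ : ∀ k, X k rSQ = X k rNUM ^ 2) :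
    BodySpec n (fun k => X k rNUM) (fun k => X k rEDGE) (semList (body n) X) := by
  have hY := fun (L : Layer 64) (hL : L ∈ body n) (t : Fin 64) (ht : L.writes.contains t = true)
    (h8 : 8 ≤ t) (h63 : t < 63) (k : ℕ) => semList_eq_delta
      (singleAssignment_body n) (X := X) hL (k := k) (by simpa using ht) (h0 k t h8 h63)
  have hfr := fun (t : Fin 64) (ht : ((body n).flatMap Layer.writes).contains t = false) (k : ℕ) =>
    semList_of_notMem (body n) X k (t := t) (by simpa using ht)
  set Y := semList (body n) X with hYdef
  -- Below, `eX` gives the value of the register `rX`, and `a2, a3, …` the positions to which the layers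
  -- attend. The scores of the searches are minus a square, up to a term that does not depend on the
  -- key position and so does not change the maximum.
  have i1 : layerInit n ∈ body n := by simp [body]
  have i2 : layerPrev n ∈ body n := by simp [body]
  have i3 : layerPrevPrev ∈ body n := by simp [body]
  have i4 : layerLastEdge ∈ body n := by simp [body]
  have i5 : layerRecord n ∈ body n := by simp [body]
  have i6 : layerSearchFst ∈ body n := by simp [body]
  have i7 : layerSearchSnd ∈ body n := by simp [body]
  have i8 : layerVisited n ∈ body n := by simp [body]
  have i9 : layerPair ∈ body n := by simp [body]
  have i10 : layerNext ∈ body n := by simp [body]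
  have ePOS : ∀ k, Y k rPOS = k + 1 := fun k => (hfr rPOS rfl k).trans (hpos k)
  have eN : ∀ k, Y k rNUM = X k rNUM := hfr rNUM rfl
  have eE : ∀ k, Y k rEDGE = X k rEDGE := hfr rEDGE rfl
  have eSQ : ∀ k, Y k rSQ = X k rNUM ^ 2 := fun k => (hfr rSQ rfl k).trans (hSQ k)
  set N := fun k => X k rNUM with hNdef
  set E := fun k => X k rEDGE with hEdef
  have hN' : ∀ k, max (N k) 0 = N k := fun k => max_eq_left (hN k)
  have hE' : ∀ k, max (E k) 0 = E k := fun k => max_eq_left (hE k)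
  change ∀ k, Y k rNUM = N k at eN
  change ∀ k, Y k rEDGE = E k at eE
  change ∀ k, Y k rSQ = N k ^ 2 at eSQ
  have eONE : ∀ k, Y k rONE = 1 := fun k => by
    rw [hY _ i1 rONE rfl (by decide) (by decide)]
    simp [Layer.delta, layerInit, gsum_cons, gsum_append, gsum_stepGates, lin]
  have ePP : ∀ k, Y k rPP = (k + 1) ^ 2 := fun k => by
    rw [hY _ i1 rPP rfl (by decide) (by decide)]
    simp [Layer.delta, layerInit, gsum_cons, gsum_append, gsum_stepGates, lin, gsum_nil, ePOS]
    rw [max_eq_left (by positivity)]; ring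
  have eEP : ∀ k, Y k rEP = E k * (k + 1) := fun k => by
    rw [hY _ i1 rEP rfl (by decide) (by decide)]
    simp [Layer.delta, layerInit, gsum_cons, gsum_append, gsum_stepGates, lin, gsum_nil, ePOS, eE,
      hE']
  have eWN : ∀ k, Y k rWN = decNum n N k := fun k => by
    rw [hY _ i1 rWN rfl (by decide) (by decide)]
    simp [Layer.delta, layerInit, gsum_cons, gsum_append, gsum_stepGates, lin, gsum_nil, ePOS, eN,
      decNum]
  have eWN2 : ∀ k, Y k rWN2 = decNum n N k ^ 2 := fun k => by
    rw [hY _ i1 rWN2 rfl (by decide) (by decide)]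
    simp [Layer.delta, layerInit, gsum_cons, gsum_append, gsum_stepGates, lin, gsum_nil, ePOS, eSQ,
      decNum]
  have a2 : ∀ k, (layerPrev n).att Y k = k - 1 := fun k => by
    rw [← rmax_fetch 1 k]
    refine rmax_congr 0 (fun j => ?_) k
    simp [Layer.score, layerPrev, lin, ePOS, eONE, ePP]
    ring
  have eN1 : ∀ k, Y k rN1 = N (k - 1) := fun k => by
    rw [hY _ i2 rN1 rfl (by decide) (by decide), Layer.delta, a2]
    simp [layerPrev, gsum_append, gsum_stepGates, lin, eN]
  have eE1 : ∀ k, Y k rE1 = E (k - 1) := fun k => by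
    rw [hY _ i2 rE1 rfl (by decide) (by decide), Layer.delta, a2]
    simp [layerPrev, gsum_append, gsum_stepGates, lin, eE]
  have eG0 : ∀ k, Y k rG0 = if 0 ≤ (k : ℤ) + 1 + (1 - 3 * n) then 1 else 0 := fun k => by
    rw [hY _ i2 rG0 rfl (by decide) (by decide), Layer.delta, a2]
    simp [layerPrev, gsum_append, gsum_stepGates, lin, eONE, ePOS]
  have eG1 : ∀ k, Y k rG1 = if 0 ≤ (k : ℤ) + 1 + (3 - 5 * n) then 1 else 0 := fun k => by
    rw [hY _ i2 rG1 rfl (by decide) (by decide), Layer.delta, a2]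
    simp [layerPrev, gsum_append, gsum_stepGates, lin, eONE, ePOS]
  have eG2 : ∀ k, Y k rG2 = if 0 ≤ (k : ℤ) + 1 + (3 - 6 * n) then 1 else 0 := fun k => by
    rw [hY _ i2 rG2 rfl (by decide) (by decide), Layer.delta, a2]
    simp [layerPrev, gsum_append, gsum_stepGates, lin, eONE, ePOS]
  have a3 : ∀ k, layerPrevPrev.att Y k = k - 2 := fun k => by
    rw [← rmax_fetch 2 k]
    refine rmax_congr 0 (fun j => ?_) k
    simp [Layer.score, layerPrevPrev, lin, ePOS, eONE, ePP]
    ring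
  have eN2 : ∀ k, Y k rN2 = N (k - 2) := fun k => by
    rw [hY _ i3 rN2 rfl (by decide) (by decide), Layer.delta, a3]
    simp [layerPrevPrev, gsum_cons, gsum_nil, lin, eN]
  have eU : ∀ k, Y k rU = E (k - 1) * N (k - 2) := fun k => by
    rw [hY _ i3 rU rfl (by decide) (by decide), Layer.delta, a3]
    simp [layerPrevPrev, gsum_cons, gsum_nil, lin, eN2, eE1, hE']
  have eS1 : ∀ k, Y k rS1 = recSum N E k := fun k => by
    rw [hY _ i3 rS1 rfl (by decide) (by decide), Layer.delta, a3]
    simp [layerPrevPrev, gsum_cons, gsum_nil, lin, eN2, eE1, eN, hE', recSum]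
  have hU' : ∀ k, max (E (k - 1) * N (k - 2)) 0 = E (k - 1) * N (k - 2) := fun k =>
    max_eq_left (mul_nonneg (hE _) (hN _))
  have hS' : ∀ k, max (recSum N E k) 0 = recSum N E k := fun k =>
    max_eq_left (mul_nonneg (hE _) (add_nonneg (hN _) (hN _)))
  have hT' : ∀ k, max (recProd N E k) 0 = recProd N E k := fun k =>
    max_eq_left (mul_nonneg (mul_nonneg (hE _) (hN _)) (hN _))
  have eF : ∀ k, Y k rF = lastEdge E k := fun k => by
    have : layerLastEdge.att Y k = rmax (fun j => E j * (j + 1)) k := by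
      refine rmax_congr 0 (fun j => ?_) k
      simp [Layer.score, layerLastEdge, lin, eEP, eONE]
    rw [hY _ i4 rF rfl (by decide) (by decide), Layer.delta, this]
    simp [layerLastEdge, gsum_cons, gsum_nil, lin, eEP, lastEdge]
  have eT1 : ∀ k, Y k rT1 = recProd N E k := fun k => by
    rw [hY _ i4 rT1 rfl (by decide) (by decide), Layer.delta]
    simp [layerLastEdge, gsum_cons, gsum_nil, lin, eU, eN, hU', recProd]
  have eU2 : ∀ k, Y k rU2 = (E (k - 1) * N (k - 2)) ^ 2 := fun k => by
    rw [hY _ i4 rU2 rfl (by decide) (by decide), Layer.delta]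
    simp [layerLastEdge, gsum_cons, gsum_nil, lin, eU, hU', sq]
  have eV3 : ∀ k, Y k rV3 = N k ^ 3 := fun k => by
    rw [hY _ i4 rV3 rfl (by decide) (by decide), Layer.delta]
    simp [layerLastEdge, gsum_cons, gsum_nil, lin, eN, eSQ, hN']
    ring
  have a5 : ∀ k, (layerRecord n).att Y k = k - 1 := fun k => by
    rw [← rmax_fetch 1 k]
    refine rmax_congr 0 (fun j => ?_) k
    simp [Layer.score, layerRecord, lin, ePOS, eONE, ePP]
    ring
  have eS2 : ∀ k, Y k rS2 = recSum N E (k - 1) := fun k => by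
    rw [hY _ i5 rS2 rfl (by decide) (by decide), Layer.delta, a5]
    simp [layerRecord, gsum_append, gsum_cons, gsum_nil, gsum_hatGates, lin, eS1]
  have eT2 : ∀ k, Y k rT2 = recProd N E (k - 1) := fun k => by
    rw [hY _ i5 rT2 rfl (by decide) (by decide), Layer.delta, a5]
    simp [layerRecord, gsum_append, gsum_cons, gsum_nil, gsum_hatGates, lin, eT1]
  have eA : ∀ k, Y k rA = recSum N E (k - 1) ^ 2 + 2 * recProd N E (k - 1) := fun k => by
    rw [hY _ i5 rA rfl (by decide) (by decide), Layer.delta, a5]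
    simp [layerRecord, gsum_append, gsum_cons, gsum_nil, gsum_hatGates, lin, eS2, eT2, hS', eONE, sq]
  have eB : ∀ k, Y k rB = recProd N E (k - 1) ^ 2 := fun k => by
    rw [hY _ i5 rB rfl (by decide) (by decide), Layer.delta, a5]
    simp [layerRecord, gsum_append, gsum_cons, gsum_nil, gsum_hatGates, lin, eT2, hT', sq]
  have eD : ∀ k, Y k rD = recSum N E (k - 1) * recProd N E (k - 1) := fun k => by
    rw [hY _ i5 rD rfl (by decide) (by decide), Layer.delta, a5]
    simp [layerRecord, gsum_append, gsum_cons, gsum_nil, gsum_hatGates, lin, eS2, eT2, hS']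
  have eU3 : ∀ k, Y k rU3 = (E (k - 1) * N (k - 2)) ^ 3 := fun k => by
    rw [hY _ i5 rU3 rfl (by decide) (by decide), Layer.delta, a5]
    simp [layerRecord, gsum_append, gsum_cons, gsum_nil, gsum_hatGates, lin]
    rw [eU, eU2, hU']
    ring
  have eC : ∀ k, Y k rC = recSum N E k ^ 2 + recProd N E k ^ 2 := fun k => by
    rw [hY _ i5 rC rfl (by decide) (by decide), Layer.delta, a5]
    simp [layerRecord, gsum_append, gsum_cons, gsum_nil, gsum_hatGates, lin, eS1, eT1, hS', hT', sq]
  have eAV : ∀ k, Y k rAV = N (k - 1) * N k := fun k => by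
    rw [hY _ i5 rAV rfl (by decide) (by decide), Layer.delta, a5]
    simp [layerRecord, gsum_append, gsum_cons, gsum_nil, gsum_hatGates, lin, eN1, eN, hN']
  have eOK : ∀ k, Y k rOK = if lastEdge E k + (3 - 3 * n) = 0 then 1 else 0 := fun k => by
    rw [hY _ i5 rOK rfl (by decide) (by decide), Layer.delta, a5]
    simp [layerRecord, gsum_append, gsum_cons, gsum_nil, gsum_hatGates, lin, eF, eONE]
  have hOK' : ∀ k, max (Y k rOK) 0 = Y k rOK := fun k => by
    rw [eOK]; split_ifs <;> rfl
  have a6 : ∀ k, layerSearchFst.att Y k =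
      rmax (fun j => -incid N E (E (k - 1) * N (k - 2)) j ^ 2) k := fun k => by
    refine rmax_congr ((E (k - 1) * N (k - 2)) ^ 4) (fun j => ?_) k
    simp only [Layer.score, layerSearchFst, lin, eA, eB, eS2, eD, eU2, eU3, eU, eONE, incid,
      List.map_cons, List.map_nil, List.sum_cons, List.sum_nil]
    ring
  have eSU : ∀ k, Y k rSU =
      recSum N E (rmax (fun j => -incid N E (E (k - 1) * N (k - 2)) j ^ 2) k - 1) := fun k => by
    rw [hY _ i6 rSU rfl (by decide) (by decide), Layer.delta, a6]
    simp [layerSearchFst, gsum_cons, gsum_nil, lin, eS2]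
  have eTU : ∀ k, Y k rTU =
      recProd N E (rmax (fun j => -incid N E (E (k - 1) * N (k - 2)) j ^ 2) k - 1) := fun k => by
    rw [hY _ i6 rTU rfl (by decide) (by decide), Layer.delta, a6]
    simp [layerSearchFst, gsum_cons, gsum_nil, lin, eT2]
  have eMU : ∀ k, Y k rMU = incid N E (E (k - 1) * N (k - 2))
      (rmax (fun j => -incid N E (E (k - 1) * N (k - 2)) j ^ 2) k) := fun k => by
    rw [hY _ i6 rMU rfl (by decide) (by decide), Layer.delta, incid, ← eSU, ← eTU]
    simp [layerSearchFst, gsum_cons, gsum_nil, lin, eONE, eU, eU2, hU']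
    ring
  have eQ0 : ∀ k, Y k rQ0 = Y k rOK * (1 - Y k rG0) := fun k => by
    rw [hY _ i6 rQ0 rfl (by decide) (by decide), Layer.delta]
    simp [layerSearchFst, gsum_cons, gsum_nil, lin, eONE, hOK', sub_eq_add_neg]
  have eQ1 : ∀ k, Y k rQ1 = Y k rOK * (Y k rG0 - Y k rG1) := fun k => by
    rw [hY _ i6 rQ1 rfl (by decide) (by decide), Layer.delta]
    simp [layerSearchFst, gsum_cons, gsum_nil, lin, hOK', sub_eq_add_neg]
  have eQ2 : ∀ k, Y k rQ2 = Y k rOK * (Y k rG1 - Y k rG2) := fun k => by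
    rw [hY _ i6 rQ2 rfl (by decide) (by decide), Layer.delta]
    simp [layerSearchFst, gsum_cons, gsum_nil, lin, hOK', sub_eq_add_neg]
  have eQ3 : ∀ k, Y k rQ3 = Y k rOK * Y k rG2 := fun k => by
    rw [hY _ i6 rQ3 rfl (by decide) (by decide), Layer.delta]
    simp [layerSearchFst, gsum_cons, gsum_nil, lin, hOK']
  have a7 : ∀ k, layerSearchSnd.att Y k = rmax (fun j => -incid N E (N k) j ^ 2) k := fun k => by
    refine rmax_congr (N k ^ 4) (fun j => ?_) k
    simp only [Layer.score, layerSearchSnd, lin, eA, eB, eS2, eD, eSQ, eV3, eN, eONE, incid,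
      List.map_cons, List.map_nil, List.sum_cons, List.sum_nil]
    ring
  have eSV : ∀ k, Y k rSV = recSum N E (rmax (fun j => -incid N E (N k) j ^ 2) k - 1) :=
      fun k => by
    rw [hY _ i7 rSV rfl (by decide) (by decide), Layer.delta, a7]
    simp [layerSearchSnd, gsum_append, gsum_cons, gsum_nil, gsum_hatGates, lin, eS2]
  have eTV : ∀ k, Y k rTV = recProd N E (rmax (fun j => -incid N E (N k) j ^ 2) k - 1) :=
      fun k => by
    rw [hY _ i7 rTV rfl (by decide) (by decide), Layer.delta, a7]
    simp [layerSearchSnd, gsum_append, gsum_cons, gsum_nil, gsum_hatGates, lin, eT2]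
  have eMV : ∀ k, Y k rMV = incid N E (N k) (rmax (fun j => -incid N E (N k) j ^ 2) k) :=
      fun k => by
    rw [hY _ i7 rMV rfl (by decide) (by decide), Layer.delta, incid, ← eSV, ← eTV]
    simp [layerSearchSnd, gsum_append, gsum_cons, gsum_nil, gsum_hatGates, lin, eONE, eN, eSQ, hN']
    ring
  have ePU : ∀ k, Y k rPU = look N E (E (k - 1) * N (k - 2)) k := fun k => by
    rw [hY _ i7 rPU rfl (by decide) (by decide), Layer.delta, look, ← eSU, ← eMU, ← eU]
    simp [layerSearchSnd, gsum_append, gsum_cons, gsum_nil, gsum_hatGates, lin, sub_eq_add_neg]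
  have ePV : ∀ k, Y k rPV = look N E (N k) k := fun k => by
    rw [hY _ i8 rPV rfl (by decide) (by decide), Layer.delta, look, ← eSV, ← eMV, ← eN]
    simp [layerVisited, gsum_append, gsum_hatGates, lin, sub_eq_add_neg]
  have a8 : ∀ k, (layerVisited n).att Y k =
      rmax (fun j => -(decNum n N j - (k + 1 + (4 - 5 * n))) ^ 2) k := fun k => by
    refine rmax_congr (((k : ℤ) + 1 + (4 - 5 * n)) ^ 2) (fun j => ?_) k
    simp only [Layer.score, layerVisited, lin, eWN, eWN2, ePOS, eONE,
      List.map_cons, List.map_nil, List.sum_cons, List.sum_nil]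
    ring
  have eVN : ∀ k, (Y k rVN + (-((k : ℤ) + 1) + (5 * n - 4)) = 0) =
      ∃ j ≤ k, decNum n N j = k + 1 + (4 - 5 * n) := fun k => by
    have h1 : Y k rVN =
        decNum n N (rmax (fun j => -(decNum n N j - (k + 1 + (4 - 5 * n))) ^ 2) k) := by
      rw [hY _ i8 rVN rfl (by decide) (by decide), Layer.delta, a8]
      simp [layerVisited, gsum_append, gsum_hatGates, lin, eWN]
    have h2 := rmax_neg_sq_eq_zero (g := fun j => decNum n N j - (k + 1 + (4 - 5 * n))) (k := k)
    simp only [sub_eq_zero] at h2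
    rw [← h2, h1, eq_iff_iff]
    constructor <;> intro h <;> linarith
  have eVIS : ∀ k, Y k rVIS = if ∃ j ≤ k, decNum n N j = k + 1 + (4 - 5 * n) then 1 else 0 :=
      fun k => by
    rw [hY _ i8 rVIS rfl (by decide) (by decide), Layer.delta, a8]
    simp only [← eVN]
    simp [layerVisited, gsum_append, gsum_hatGates, lin, ePOS, eONE, add_assoc]
  have eVK : ∀ k, Y k rVK = if ∃ j ≤ k, decNum n N j = k + 1 + (4 - 5 * n) then
      (k : ℤ) + 1 + (4 - 5 * n) else 0 := fun k => by
    rw [hY _ i8 rVK rfl (by decide) (by decide), Layer.delta, a8]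
    simp only [← eVN]
    simp [layerVisited, gsum_append, gsum_hatGates, lin, ePOS, eONE, add_assoc]
  have a9 : ∀ k, layerPair.att Y k = pairPos N E k := fun k => by
    refine rmax_congr ((N (k - 1) + N k) ^ 2 + (N (k - 1) * N k) ^ 2) (fun j => ?_) k
    simp only [Layer.score, layerPair, lin, eS1, eT1, eC, eN1, eN, eAV, eONE,
      List.map_cons, List.map_nil, List.sum_cons, List.sum_nil]
    ring
  have eRU : ∀ k, Y k rRU = Y (pairPos N E k) rPU := fun k => by
    rw [hY _ i9 rRU rfl (by decide) (by decide), Layer.delta, a9]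
    simp [layerPair, gsum_append, gsum_stepGates, lin]
  have eRV : ∀ k, Y k rRV = Y (pairPos N E k) rPV := fun k => by
    rw [hY _ i9 rRV rfl (by decide) (by decide), Layer.delta, a9]
    simp [layerPair, gsum_append, gsum_stepGates, lin]
  have eR : ∀ k, Y k rR = turn N E k := fun k => by
    rw [hY _ i9 rR rfl (by decide) (by decide), Layer.delta, a9, turn]
    have h1 : 0 ≤ N k + -N (k - 1) + -1 ↔ N (k - 1) < N k := by omega
    have h2 : 0 ≤ N (k - 1) + -N k + -1 ↔ N k < N (k - 1) := by omega
    simp [layerPair, gsum_append, gsum_stepGates, lin, eRU, eRV, ePU, ePV, eN, eN1, h1, h2]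
  have eWO : ∀ k, Y k rWO = nextNum N E k := fun k => by
    rw [hY _ i10 rWO rfl (by decide) (by decide), Layer.delta, nextNum]
    simp [layerNext, gsum_cons, gsum_hatGates, lin, eR, ePV, eONE]
  refine ⟨eOK, fun k => ?_, fun k => ?_, fun k => ?_, fun k => ?_, eWO, eVIS, eVK⟩
  · rw [eQ0, eG0]
  · rw [eQ1, eG0, eG1]
  · rw [eQ2, eG1, eG2]
  · rw [eQ3, eG2]

/-! ### Size and output of the program -/

/-- The largest weights are those of the thresholds, such as `10 * n - 8`. -/
theorem program_fits {n : ℤ} (hn : 1 ≤ n) : ∀ L ∈ program n, L.Fits 16 (100 * n) := by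
  have key : ∀ L : Layer 64, (L.pairs.length ≤ 63 ∧ L.gates.length ≤ 16 ∧
      L.writes.contains rPOS = false) → (∀ e ∈ L.pairs, wt e.1 ≤ 100 * n ∧ wt e.2 ≤ 100 * n) →
      (L.vals.map fun e => wt e.2).sum ≤ 100 * n →
      (∀ g ∈ L.gates, wt g.A ≤ 100 * n ∧ |g.a| ≤ 100 * n ∧ wt g.B ≤ 100 * n ∧ |g.b| ≤ 100 * n) →
      L.Fits 16 (100 * n) := by
    intro L ⟨h1, h2, h3⟩ h4 h5 h6
    have h3' : rPOS ∉ L.writes := by simpa using h3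
    rw [Layer.writes, List.mem_append, not_or] at h3'
    exact ⟨h1, h2, fun e he h => h3'.1 (List.mem_map.2 ⟨e, he, h⟩),
      fun g hg h => h3'.2 (List.mem_map.2 ⟨g, hg, h⟩), h4, h5, h6⟩
  have h1 : |8 - 10 * n| = -(8 - 10 * n) := abs_of_nonpos (by omega)
  have h2 : |4 - 5 * n| = -(4 - 5 * n) := abs_of_nonpos (by omega)
  intro L hL
  simp only [program, body, List.cons_append, List.nil_append, List.mem_cons, List.not_mem_nil,
    or_false] at hL
  rcases hL with rfl | rfl | rfl | rfl | rfl | rfl | rfl | rfl | rfl | rfl | rfl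
  on_goal 11 => split_ifs
  all_goals
    refine key _ ⟨Nat.le_of_ble_eq_true rfl, Nat.le_of_ble_eq_true rfl, rfl⟩ ?_ ?_ ?_
  all_goals
    simp [layerInit, layerPrev, layerPrevPrev, layerLastEdge, layerRecord, layerSearchFst,
      layerSearchSnd, layerVisited, layerPair, layerNext, layerOut, layerYes, hatGates, stepGates,
      wt, abs_le]
  all_goals omega

/-- The input of the program: the position, nonnegative registers for the edge token and the number,
the square of the number, and zeros in the registers that the program writes. -/
theorem embInt_spec {n : ℕ} (S : List (Token n)) :
    (∀ k (t : Fin 64), 8 ≤ t → t < 63 → embInt 63 S k t = 0) ∧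
    (∀ k, embInt 63 S k rPOS = k + 1) ∧ (∀ k, 0 ≤ embInt 63 S k rEDGE) ∧
    (∀ k, 0 ≤ embInt 63 S k rNUM) ∧ ∀ k, embInt 63 S k rSQ = embInt 63 S k rNUM ^ 2 := by
  have h63 : ∀ t : Fin 64, t < 63 → t ≠ Fin.last 63 := fun t ht => ne_of_lt ht
  refine ⟨fun k t h8 ht => ?_, fun k => ?_, fun k => ?_, fun k => ?_, fun k => ?_⟩
  · rw [embInt, if_neg (h63 t ht), add_zero]
    have h8' : 8 ≤ (t : ℕ) := h8
    rcases S[k]? with _ | i | s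
    · rfl
    · simp only [Option.map_some, Option.getD_some, tokVec]
      rw [if_neg (by omega), if_neg (by omega)]
    · simp only [Option.map_some, Option.getD_some, tokVec]
      exact if_neg (by cases s <;> simp only [Special.index] <;> omega)
  · have : rPOS = Fin.last 63 := rfl
    rw [embInt, if_pos this]
    rcases S[k]? with _ | i | s
    · simp
    · simp [tokVec]
    · cases s <;> simp [tokVec, Special.index]
  · rw [embInt, if_neg (h63 _ (by decide)), add_zero]
    rcases S[k]? with _ | i | s
    · simp
    · simp [tokVec]
    · cases s <;> simp [tokVec, Special.index]
  · rw [embInt, if_neg (h63 _ (by decide)), add_zero]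
    rcases S[k]? with _ | i | s
    · simp
    · simp [tokVec]; positivity
    · cases s <;> simp [tokVec, Special.index]
  · rw [embInt, embInt, if_neg (h63 _ (by decide)), if_neg (h63 _ (by decide))]
    rcases S[k]? with _ | i | s
    · simp
    · simp [tokVec]
    · cases s <;> simp [tokVec, Special.index]

/-- The output vector `x` encodes the number `o` (if it is not zero), and the answers YES and NO by
their indicators `y` and `z`. The first two coordinates give the number `i` the logit
`2 * o * i - i ^ 2 = o ^ 2 - (i - o) ^ 2`, which is largest at `i = o`. -/
def IsOutput (x : Fin 64 → ℤ) (o y z : ℤ) : Prop :=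
  x rNUM = 2 * o ∧ x rSQ = -1 ∧ x rSTART = 0 ∧ x rEDGE = 0 ∧ x rYES = y ∧ x rNO = z ∧ x rSS = 0 ∧
    x rES = 0

theorem logit_inl {n : ℕ} (x : Fin 64 → ℤ) (i : Fin n) :
    logit x (Sum.inl i : Token n) = ((i : ℤ) + 1) * x rNUM + ((i : ℤ) + 1) ^ 2 * x rSQ := by
  have h : ∀ j : Fin 64, tokVec 64 (Sum.inl i : Token n) j * x j =
      (if j = rNUM then ((i : ℤ) + 1) * x j else 0) +
        if j = rSQ then ((i : ℤ) + 1) ^ 2 * x j else 0 := by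
    intro j
    have h0 : (j : ℕ) = 0 ↔ j = rNUM := by rw [Fin.ext_iff]; rfl
    have h1 : (j : ℕ) = 1 ↔ j = rSQ := by rw [Fin.ext_iff]; rfl
    simp only [tokVec, h0, h1]
    split_ifs with h2 h3
    · rw [h2] at h3; exact absurd h3 (by decide)
    · simp
    · simp
    · simp
  simp only [logit, h, Finset.sum_add_distrib, Finset.sum_ite_eq', Finset.mem_univ, if_true]

theorem logit_inr {n : ℕ} (x : Fin 64 → ℤ) (s : Special) (t : Fin 64)
    (ht : (t : ℕ) = 1 + s.index) : logit x (Sum.inr s : Token n) = x t := by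
  have h : ∀ j : Fin 64, tokVec 64 (Sum.inr s : Token n) j * x j = if j = t then x j else 0 := by
    intro j
    have h0 : (j : ℕ) = 1 + s.index ↔ j = t := by rw [Fin.ext_iff, ht]
    simp only [tokVec, h0, ite_mul, one_mul, zero_mul]
  simp only [logit, h, Finset.sum_ite_eq', Finset.mem_univ, if_true]

theorem IsOutput.logit {n : ℕ} {x : Fin 64 → ℤ} {o y z : ℤ} (h : IsOutput x o y z) :
    (∀ i : Fin n, logit x (Sum.inl i : Token n) = o ^ 2 - ((i : ℤ) + 1 - o) ^ 2) ∧
    ∀ s : Special, logit x (Sum.inr s : Token n) =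
      if s = .yes then y else if s = .no then z else 0 := by
  obtain ⟨h0, h1, h2, h3, h4, h5, h6, h7⟩ := h
  refine ⟨fun i => ?_, fun s => ?_⟩
  · rw [logit_inl, h0, h1]; ring
  · cases s
    · rw [logit_inr x _ rSTART rfl, h2]; rfl
    · rw [logit_inr x _ rEDGE rfl, h3]; rfl
    · rw [logit_inr x _ rYES rfl, h4]; rfl
    · rw [logit_inr x _ rNO rfl, h5]; rfl
    · rw [logit_inr x _ rSS rfl, h6]; rfl
    · rw [logit_inr x _ rES rfl, h7]; rfl

theorem IsOutput.lt_num {n : ℕ} {x : Fin 64 → ℤ} {i : Fin n} (h : IsOutput x ((i : ℤ) + 1) 0 0)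
    (v : Token n) (hv : v ≠ Sum.inl i) : SeqModel.logit x v < SeqModel.logit x (Sum.inl i : Token n) := by
  obtain ⟨h1, h2⟩ := h.logit (n := n)
  rw [h1]
  rcases v with j | s
  · rw [h1]
    have : ((j : ℕ) : ℤ) - i ≠ 0 := fun e => hv (by rw [show j = i from Fin.ext (by omega)])
    have : 0 < (((j : ℕ) : ℤ) - i) ^ 2 := by positivity
    nlinarith
  · rw [h2]
    have : (0 : ℤ) < ((i : ℕ) : ℤ) + 1 := by positivity
    have : (0 : ℤ) < (((i : ℕ) : ℤ) + 1) ^ 2 := by positivity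
    split_ifs <;> linarith

theorem IsOutput.lt_special {n : ℕ} {x : Fin 64 → ℤ} {y z : ℤ} (h : IsOutput x 0 y z) {s : Special}
    (hs : s = .yes ∧ y = 1 ∧ z = 0 ∨ s = .no ∧ y = 0 ∧ z = 1) (v : Token n) (hv : v ≠ Sum.inr s) :
    SeqModel.logit x v < SeqModel.logit x (Sum.inr s : Token n) := by
  obtain ⟨h1, h2⟩ := h.logit (n := n)
  rw [h2]
  have h3 : (if s = .yes then y else if s = .no then z else 0) = 1 := by
    rcases hs with ⟨rfl, h, _⟩ | ⟨rfl, _, h⟩ <;> simp [h]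
  rw [h3]
  rcases v with j | s'
  · rw [h1]
    nlinarith [sq_nonneg (((j : ℕ) : ℤ) + 1)]
  · rw [h2]
    have hne : s' ≠ s := fun e => hv (by rw [e])
    rcases hs with ⟨rfl, _, hz⟩ | ⟨rfl, hy, _⟩
    · rw [if_neg hne, hz]; simp
    · rw [hy]; simp [hne]

theorem isOutput_layerYes (X : ℕ → Fin 64 → ℤ) (k : ℕ) : IsOutput (layerYes.sem X k) 0 1 0 := by
  unfold IsOutput Layer.sem
  have hm : layerYes.mid X k = X k :=
    funext fun t => layerYes.mid_of_notMem X k (by simp [layerYes])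
  rw [hm]
  simp [layerYes, lin]

theorem isOutput_layerOut {Y : ℕ → Fin 64 → ℤ}
    (k : ℕ) (hQ : 0 ≤ Y k rQ0 ∧ 0 ≤ Y k rQ1 ∧ 0 ≤ Y k rQ2) :
    IsOutput (layerOut.sem Y k)
      (Y k rQ0 * Y k rNUM + Y k rQ1 * Y k rWO + Y k rQ2 * Y k rVK) (Y k rQ3)
      (1 - Y k rOK + Y k rQ2 * (1 - Y k rVIS)) := by
  unfold IsOutput Layer.sem
  have hm : layerOut.mid Y k = Y k :=
    funext fun t => layerOut.mid_of_notMem Y k (by simp [layerOut])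
  rw [hm]
  simp [layerOut, lin, hQ]
  exact ⟨by ring, by ring⟩

/-! ### Tracing the faces of a tree -/

theorem exists_iterate_lt_card {α : Type*} [Finite α] (f : α → α) {x y : α}
    (h : ∃ t, f^[t] x = y) : ∃ t < Nat.card α, f^[t] x = y := by
  classical
  refine ⟨Nat.find h, ?_, Nat.find_spec h⟩
  have hmin : ∀ s < Nat.find h, f^[s] x ≠ y := fun s hs => Nat.find_min h hs
  have hinj : Function.Injective fun s : Fin (Nat.find h + 1) => f^[s] x := by
    -- a repetition before the first visit of `y` would give an earlier visit
    have key : ∀ i j, i < j → j ≤ Nat.find h → f^[i] x ≠ f^[j] x := by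
      intro i j hij hj e
      refine hmin (Nat.find h - j + i) (by omega) ?_
      have h1 := Nat.find_spec h
      rw [show Nat.find h = (Nat.find h - j) + j by omega, Function.iterate_add_apply, ← e,
        ← Function.iterate_add_apply] at h1
      exact h1
    intro i j hij
    rcases lt_trichotomy (i : ℕ) j with h' | h' | h'
    · exact absurd hij (key i j h' (by omega))
    · exact Fin.ext h'
    · exact absurd hij.symm (key j i h' (by omega))
  have := Nat.card_le_card_of_injective _ hinj
  rw [Nat.card_eq_fintype_card, Fintype.card_fin] at this
  omega

/-- In a tree, a cycle of a face-tracing map that contains a dart contains the reversed dart: the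
dart is a bridge, and the cycle comes back to its origin. -/
theorem symm_mem_cycle {V : Type*} {G : SimpleGraph V} (hG : G.IsAcyclic) {f : G.Dart → G.Dart}
    (hf : ∀ d, (f d).fst = d.snd) {d : G.Dart} (hd : d ∈ Function.periodicPts f) :
    ∃ t, f^[t] d = d.symm := by
  by_contra! hne
  set k := Function.minimalPeriod f d with hk
  have hk0 : 0 < k := Function.minimalPeriod_pos_of_mem_periodicPts hd
  have hbridge := SimpleGraph.isAcyclic_iff_forall_adj_isBridge.1 hG d.adj
  rw [SimpleGraph.isBridge_iff] at hbridge
  have hreach : ∀ s < k, (G.deleteEdges {s(d.fst, d.snd)}).Reachable d.snd (f^[s] d).snd := by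
    intro s hs
    induction s with
    | zero => exact SimpleGraph.Reachable.refl _
    | succ s ih =>
      refine (ih (by omega)).trans (SimpleGraph.Adj.reachable ?_)
      rw [← hf (f^[s] d), ← Function.iterate_succ_apply' f, SimpleGraph.deleteEdges_adj]
      refine ⟨(f^[s + 1] d).adj, fun hmem => ?_⟩
      have : (f^[s + 1] d).edge = d.edge := hmem
      rcases SimpleGraph.dart_edge_eq_iff _ _ |>.1 this with h | h
      · exact Function.not_isPeriodicPt_of_pos_of_lt_minimalPeriod (by omega) hs h
      · exact hne _ h
  have hlast := hreach (k - 1) (by omega)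
  rw [← hf (f^[k - 1] d), ← Function.iterate_succ_apply' f, Nat.succ_eq_add_one, Nat.sub_add_cancel hk0,
    Function.iterate_minimalPeriod] at hlast
  exact hbridge hlast.symm

/-- A face-tracing map `f` of a tree has only one cycle. For each vertex `x`, the map sends the darts
into `x` to the darts out of `x`; the hypothesis `hrot` says that, on the neighbours of `x`, it acts
transitively. -/
theorem exists_iterate_eq_of_isTree {V : Type*} [Finite V] {G : SimpleGraph V} (hG : G.IsTree)
    {f : G.Dart → G.Dart} (hf : ∀ d, (f d).fst = d.snd)
    (hrot : ∀ (x : V) (P : V → Prop), (∃ a, G.Adj a x ∧ P a) →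
      (∀ d : G.Dart, d.snd = x → P d.fst → P (f d).snd) → ∀ b, G.Adj b x → P b)
    (d d' : G.Dart) : ∃ t, f^[t] d = d' := by
  have hfin : Finite G.Dart := Finite.of_injective _ (SimpleGraph.Dart.toProd_injective (G := G))
  obtain ⟨i, j, hij, hne⟩ : ∃ i j, f^[i] d = f^[j] d ∧ i ≠ j := by
    have := not_injective_infinite_finite fun i : ℕ => f^[i] d
    simpa [Function.Injective] using this
  wlog hlt : i < j generalizing i j
  · exact this j i hij.symm hne.symm (by omega)
  set y := f^[i] d with hy
  have hper : f^[j - i] y = y := by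
    rw [hy, ← Function.iterate_add_apply, Nat.sub_add_cancel hlt.le]; exact hij.symm
  have hperO : ∀ t, f^[t] y ∈ Function.periodicPts f := fun t => by
    refine ⟨j - i, by omega, ?_⟩
    rw [Function.IsPeriodicPt, Function.IsFixedPt, ← Function.iterate_add_apply, add_comm,
      Function.iterate_add_apply, hper]
  have hsymm : ∀ t, ∃ s, f^[s] y = (f^[t] y).symm := fun t => by
    obtain ⟨s, hs⟩ := symm_mem_cycle hG.isAcyclic hf (hperO t)
    exact ⟨s + t, by rw [Function.iterate_add_apply, hs]⟩
  -- the cycle contains every dart into a vertex that it visits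
  have hinto : ∀ t, ∀ d : G.Dart, d.snd = (f^[t] y).snd → ∃ s, f^[s] y = d := by
    intro t d hd
    have := hrot (f^[t] y).snd (fun a => ∃ s, (f^[s] y).fst = a ∧ (f^[s] y).snd = (f^[t] y).snd)
      ⟨_, (f^[t] y).adj, t, rfl, rfl⟩ ?_ d.fst (hd ▸ d.adj)
    · obtain ⟨s, h1, h2⟩ := this
      refine ⟨s, ?_⟩
      ext
      · exact h1
      · exact h2.trans hd.symm
    · rintro d' hd' ⟨s, h1, h2⟩
      have h3 : f^[s] y = d' := by
        ext
        · exact h1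
        · exact h2.trans hd'.symm
      obtain ⟨r, hr⟩ := hsymm (s + 1)
      rw [Function.iterate_succ_apply', h3] at hr
      exact ⟨r, by rw [hr]; rfl, by rw [hr]; exact (hf d').trans hd'⟩
  have hwalk : ∀ u v, G.Walk u v → (∃ t, (f^[t] y).snd = u) → ∃ t, (f^[t] y).snd = v := by
    intro u v p
    induction p with
    | nil => exact id
    | cons hadj p ih =>
      rintro ⟨t, ht⟩
      obtain ⟨s, hs⟩ := hinto t ⟨(_, _), hadj.symm⟩ ht.symm
      obtain ⟨r, hr⟩ := hsymm s
      exact ih ⟨r, by rw [hr, hs]; rfl⟩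
  have hall : ∀ x, ∃ t, (f^[t] y).snd = x := fun x => by
    obtain ⟨p⟩ := hG.connected.preconnected y.snd x
    exact hwalk _ _ p ⟨0, rfl⟩
  have hO : ∀ d', ∃ t, f^[t] y = d' := fun d' => by
    obtain ⟨t, ht⟩ := hall d'.snd
    exact hinto t d' ht.symm
  obtain ⟨t, ht⟩ := hO d'
  exact ⟨t + i, by rw [Function.iterate_add_apply, ← hy, ht]⟩

/-! ### The walk along the edge list -/

/-- The other endpoint of the last edge that contains `x`, among the first `i` edges. -/
def lastNbr {V : Type*} [DecidableEq V] (e : ℕ → V × V) (x : V) : ℕ → Option V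
  | 0 => none
  | i + 1 => if (e i).1 = x then some (e i).2 else if (e i).2 = x then some (e i).1 else
      lastNbr e x i

/-- The edge number `i` consists of `a` and `x`. -/
def IsEdgeAt {V : Type*} (e : ℕ → V × V) (i : ℕ) (a x : V) : Prop := e i = (a, x) ∨ e i = (x, a)

/-- `e 0, …, e (m - 1)` are the edges of `G`, each once. -/
structure Lists {V : Type*} (G : SimpleGraph V) (e : ℕ → V × V) (m : ℕ) : Prop where
  adj : ∀ i < m, G.Adj (e i).1 (e i).2
  exists_edge : ∀ {a x}, G.Adj a x → ∃ i < m, IsEdgeAt e i a x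
  unique : ∀ {i j a x}, i < m → j < m → IsEdgeAt e i a x → IsEdgeAt e j a x → i = j

theorem lastNbr_cases {V : Type*} [DecidableEq V] (e : ℕ → V × V) (x : V) (i : ℕ) :
    (lastNbr e x i = none ∧ ∀ j < i, ∀ y, ¬ IsEdgeAt e j y x) ∨
      ∃ j < i, ∃ y, lastNbr e x i = some y ∧ IsEdgeAt e j y x ∧
        ∀ j' < i, j < j' → ∀ y, ¬ IsEdgeAt e j' y x := by
  induction i with
  | zero => exact Or.inl ⟨rfl, fun j hj => absurd hj (Nat.not_lt_zero j)⟩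
  | succ i ih =>
    rw [lastNbr]
    split_ifs with h1 h2
    · exact Or.inr ⟨i, by omega, _, rfl, Or.inr (by rw [← h1]), fun j' hj' h => by omega⟩
    · exact Or.inr ⟨i, by omega, _, rfl, Or.inl (by rw [← h2]), fun j' hj' h => by omega⟩
    · have hi : ∀ y, ¬ IsEdgeAt e i y x := by
        rintro y (h | h)
        · exact h2 (by rw [h])
        · exact h1 (by rw [h])
      rcases ih with ⟨h3, h4⟩ | ⟨j, hj, y, h3, h4, h5⟩
      · refine Or.inl ⟨h3, fun j hj y => ?_⟩
        rcases Nat.lt_succ_iff_lt_or_eq.1 hj with h | rfl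
        · exact h4 j h y
        · exact hi y
      · refine Or.inr ⟨j, by omega, y, h3, h4, fun j' hj' h y => ?_⟩
        rcases Nat.lt_succ_iff_lt_or_eq.1 hj' with h' | rfl
        · exact h5 j' h' h y
        · exact hi y

theorem lastNbr_succ_of_isEdgeAt {V : Type*} [DecidableEq V] {e : ℕ → V × V} {i : ℕ} {a x : V}
    (h : IsEdgeAt e i a x) : lastNbr e x (i + 1) = some a := by
  rw [lastNbr]
  rcases h with h | h
  · simp only [h, if_true]
    split_ifs with h'
    · rw [h']
    · rfl
  · simp [h]

/-- The vertex after `x` on the walk that arrives at `x` through the edge number `i`: the other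
endpoint of the cyclic predecessor of this edge, among the edges at `x`. -/
def nextVertex {V : Type*} [DecidableEq V] (e : ℕ → V × V) (m i : ℕ) (x : V) : V :=
  (lastNbr e x i).getD ((lastNbr e x m).getD x)

section Walk

variable {V : Type*} {G : SimpleGraph V} {e : ℕ → V × V} {m : ℕ}

theorem Lists.adj_of_isEdgeAt (h : Lists G e m) {i : ℕ} (hi : i < m) {a x : V}
    (hax : IsEdgeAt e i a x) : G.Adj a x := by
  have := h.adj i hi
  rcases hax with h | h <;> rw [h] at this
  · exact this
  · exact this.symm

/-- The number of the edge of a dart. -/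
def Lists.index (h : Lists G e m) (d : G.Dart) : ℕ := (h.exists_edge d.adj).choose

theorem Lists.index_spec (h : Lists G e m) (d : G.Dart) :
    h.index d < m ∧ IsEdgeAt e (h.index d) d.fst d.snd := (h.exists_edge d.adj).choose_spec

variable [DecidableEq V]

theorem Lists.adj_lastNbr (h : Lists G e m) {i : ℕ} (hi : i ≤ m) {x y : V}
    (hy : lastNbr e x i = some y) : G.Adj x y := by
  rcases lastNbr_cases e x i with ⟨h1, _⟩ | ⟨j, hj, z, h1, h2, _⟩
  · rw [hy] at h1; cases h1
  · rw [hy] at h1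
    obtain rfl : y = z := Option.some.inj h1
    exact (h.adj_of_isEdgeAt (by omega) h2).symm

theorem Lists.exists_lastNbr (h : Lists G e m) {a x : V} (hax : G.Adj a x) :
    ∃ y, lastNbr e x m = some y := by
  rcases lastNbr_cases e x m with ⟨_, h2⟩ | ⟨j, hj, y, h1, _⟩
  · obtain ⟨i, hi, h3⟩ := h.exists_edge hax
    exact absurd h3 (h2 i hi a)
  · exact ⟨y, h1⟩

theorem Lists.adj_nextVertex (h : Lists G e m) {i : ℕ} (hi : i < m) {a x : V} (hax : G.Adj a x) :
    G.Adj x (nextVertex e m i x) := by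
  unfold nextVertex
  rcases h1 : lastNbr e x i with _ | y
  · obtain ⟨y, hy⟩ := h.exists_lastNbr hax
    rw [hy]
    exact h.adj_lastNbr le_rfl hy
  · exact h.adj_lastNbr hi.le h1

/-- The dart after `d` on the walk. -/
def Lists.next (h : Lists G e m) (d : G.Dart) : G.Dart :=
  ⟨(d.snd, nextVertex e m (h.index d) d.snd), h.adj_nextVertex (h.index_spec d).1 d.adj⟩

theorem Lists.next_transitive (h : Lists G e m) (x : V) (P : V → Prop)
    (hP : ∃ a, G.Adj a x ∧ P a) (hnext : ∀ d : G.Dart, d.snd = x → P d.fst → P (h.next d).snd) :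
    ∀ b, G.Adj b x → P b := by
  have hstep : ∀ i < m, ∀ a, IsEdgeAt e i a x → P a → P (nextVertex e m i x) := by
    intro i hi a hax ha
    have h1 := hnext ⟨(a, x), h.adj_of_isEdgeAt hi hax⟩ rfl ha
    have h2 := h.index_spec ⟨(a, x), h.adj_of_isEdgeAt hi hax⟩
    have h3 : h.index ⟨(a, x), h.adj_of_isEdgeAt hi hax⟩ = i := h.unique h2.1 hi h2.2 hax
    have h4 : (h.next ⟨(a, x), h.adj_of_isEdgeAt hi hax⟩).snd = nextVertex e m
      (h.index ⟨(a, x), h.adj_of_isEdgeAt hi hax⟩) x := rfl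
    rw [h4, h3] at h1
    exact h1
  obtain ⟨a, hax, ha⟩ := hP
  obtain ⟨i₀, hi₀, he₀⟩ := h.exists_edge hax
  obtain ⟨z, hz⟩ := h.exists_lastNbr hax
  -- going down the list of the edges at `x` one arrives at the last edge again
  have hwrap : ∀ i < m, ∀ a, IsEdgeAt e i a x → P a → P z := by
    intro i
    induction i using Nat.strong_induction_on with
    | _ i ih =>
      intro hi a hax ha
      have h1 := hstep i hi a hax ha
      unfold nextVertex at h1
      rcases lastNbr_cases e x i with ⟨h2, _⟩ | ⟨j, hj, y, h2, h3, _⟩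
      · rwa [h2, hz] at h1
      · rw [h2] at h1
        exact ih j hj (by omega) y h3 h1
  have hz' := hwrap i₀ hi₀ a he₀ ha
  -- and from there at all the edges
  have hdown : ∀ i ≤ m, (∀ y, lastNbr e x i = some y → P y) →
      ∀ j < i, ∀ b, IsEdgeAt e j b x → P b := by
    intro i
    induction i using Nat.strong_induction_on with
    | _ i ih =>
      intro hi hy j hj b hb
      rcases lastNbr_cases e x i with ⟨_, h2⟩ | ⟨j', hj', y, h2, h3, h4⟩
      · exact absurd hb (h2 j hj b)
      · have hPy := hy y h2
        rcases lt_trichotomy j j' with hlt | rfl | hlt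
        · refine ih j' hj' (by omega) (fun y' hy' => ?_) j hlt b hb
          have h5 := hstep j' (by omega) y h3 hPy
          rwa [nextVertex, hy'] at h5
        · have h5 := lastNbr_succ_of_isEdgeAt hb
          rw [lastNbr_succ_of_isEdgeAt h3] at h5
          exact Option.some.inj h5 ▸ hPy
        · exact absurd hb (h4 j hj hlt b)
  intro b hb
  obtain ⟨i, hi, he⟩ := h.exists_edge hb
  exact hdown m le_rfl (fun y hy => by
    rw [hz] at hy
    exact Option.some.inj hy ▸ hz') i hi b he

/-- In a tree, the walk visits every vertex within twice the number of edges. -/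
theorem Lists.exists_visit [Finite V] (h : Lists G e m) (hG : G.IsTree) (hm : Nat.card G.Dart = 2 * m)
    (d : G.Dart) (x : V) : ∃ t < 2 * m, (h.next^[t] d).fst = x := by
  have hx : ∃ d' : G.Dart, d'.fst = x := by
    obtain ⟨p⟩ := hG.connected.preconnected x d.fst
    cases p with
    | nil => exact ⟨d, rfl⟩
    | cons hadj _ => exact ⟨⟨(_, _), hadj⟩, rfl⟩
  obtain ⟨d', rfl⟩ := hx
  have hfin : Finite G.Dart := Finite.of_injective _ (SimpleGraph.Dart.toProd_injective (G := G))
  obtain ⟨t, ht, h1⟩ := exists_iterate_lt_card h.next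
    (exists_iterate_eq_of_isTree hG (fun _ => rfl) h.next_transitive d d')
  exact ⟨t, hm ▸ ht, by rw [h1]⟩

theorem Lists.reachable_next (h : Lists G e m) (d : G.Dart) (t : ℕ) :
    G.Reachable d.fst (h.next^[t] d).fst := by
  induction t with
  | zero => exact SimpleGraph.Reachable.refl _
  | succ t ih =>
    rw [Function.iterate_succ_apply']
    exact ih.trans (h.next^[t] d).adj.reachable

end Walk

/-! ### The output of the program -/

theorem semList_append {d : ℕ} (Ls Ls' : List (Layer d)) (X : ℕ → Fin d → ℤ) :
    semList (Ls ++ Ls') X = semList Ls' (semList Ls X) := by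
  simp [semList]

theorem isOutput_program_one {n : ℤ} (hn : n = 1) (X : ℕ → Fin 64 → ℤ) (k : ℕ) :
    IsOutput (semList (program n) X k) 0 1 0 := by
  rw [program, semList_append, if_pos hn]
  exact isOutput_layerYes _ k

/-- The number at position `k`. -/
def numAt {n : ℕ} (S : List (Token n)) (k : ℕ) : ℤ := embInt 63 S k rNUM

/-- The indicator of an edge token at position `k`. -/
def edgeAt {n : ℕ} (S : List (Token n)) (k : ℕ) : ℤ := embInt 63 S k rEDGE

section Output

variable {n : ℕ} (S : List (Token n)) {k : ℕ}

theorem isOutput_program (hn : 2 ≤ n) :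
    ∃ Y, BodySpec n (numAt S) (edgeAt S) Y ∧ Y k rNUM = numAt S k ∧
    IsOutput (semList (program n) (embInt 63 S) k)
      (Y k rQ0 * Y k rNUM + Y k rQ1 * Y k rWO + Y k rQ2 * Y k rVK) (Y k rQ3)
      (1 - Y k rOK + Y k rQ2 * (1 - Y k rVIS)) := by
  obtain ⟨h0, hpos, hE, hN, hSQ⟩ := embInt_spec S
  have h := body_spec n h0 hpos hE hN hSQ
  have hc : ((body n).flatMap Layer.writes).contains rNUM = false := rfl
  refine ⟨_, h, semList_of_notMem (body n) _ k (by simpa using hc), ?_⟩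
  rw [program, semList_append, if_neg (by omega)]
  refine isOutput_layerOut k ⟨?_, ?_, ?_⟩
  · rw [h.q0, h.ok]; split_ifs <;> simp
  · rw [h.q1, h.ok]; (split_ifs <;> simp); omega
  · rw [h.q2, h.ok]; (split_ifs <;> simp); omega

theorem isOutput_of_lastEdge_ne (hn : 2 ≤ n) (h : lastEdge (edgeAt S) k ≠ 3 * n - 3) :
    IsOutput (semList (program n) (embInt 63 S) k) 0 0 1 := by
  obtain ⟨Y, hY, _, hout⟩ := isOutput_program S (k := k) hn
  have hok : Y k rOK = 0 := by rw [hY.ok, if_neg (by omega)]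
  rw [hY.q0, hY.q1, hY.q2, hY.q3, hok] at hout
  simpa using hout

theorem isOutput_copy (hn : 2 ≤ n) (h : lastEdge (edgeAt S) k = 3 * n - 3) (hk : k + 3 ≤ 3 * n) :
    IsOutput (semList (program n) (embInt 63 S) k) (numAt S k) 0 0 := by
  obtain ⟨Y, hY, hnum, hout⟩ := isOutput_program S (k := k) hn
  have hok : Y k rOK = 1 := by rw [hY.ok, if_pos (by omega)]
  rw [hY.q0, hY.q1, hY.q2, hY.q3, hok, hnum, if_neg (by omega), if_neg (by omega),
    if_neg (by omega)] at hout
  simpa using hout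

theorem isOutput_walk (hn : 2 ≤ n) (h : lastEdge (edgeAt S) k = 3 * n - 3) (hk : 3 * n < k + 3)
    (hk' : k + 4 < 5 * n) :
    IsOutput (semList (program n) (embInt 63 S) k) (nextNum (numAt S) (edgeAt S) k) 0 0 := by
  obtain ⟨Y, hY, hnum, hout⟩ := isOutput_program S (k := k) hn
  have hok : Y k rOK = 1 := by rw [hY.ok, if_pos (by omega)]
  rw [hY.q0, hY.q1, hY.q2, hY.q3, hok, hY.wo, if_pos (by omega), if_neg (by omega),
    if_neg (by omega)] at hout
  simpa using hout

theorem isOutput_visited (hn : 2 ≤ n) (h : lastEdge (edgeAt S) k = 3 * n - 3)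
    (hk : 5 * n ≤ k + 4) (hk' : k + 4 < 6 * n)
    (hv : ∃ j ≤ k, decNum n (numAt S) j = k + 1 + (4 - 5 * n)) :
    IsOutput (semList (program n) (embInt 63 S) k) (k + 1 + (4 - 5 * n)) 0 0 := by
  obtain ⟨Y, hY, hnum, hout⟩ := isOutput_program S (k := k) hn
  have hok : Y k rOK = 1 := by rw [hY.ok, if_pos (by omega)]
  rw [hY.q0, hY.q1, hY.q2, hY.q3, hok, hY.vis, hY.vk, if_pos hv, if_pos hv, if_pos (by omega),
    if_pos (by omega), if_neg (by omega)] at hout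
  simpa using hout

theorem isOutput_not_visited (hn : 2 ≤ n) (h : lastEdge (edgeAt S) k = 3 * n - 3)
    (hk : 5 * n ≤ k + 4) (hk' : k + 4 < 6 * n)
    (hv : ¬ ∃ j ≤ k, decNum n (numAt S) j = k + 1 + (4 - 5 * n)) :
    IsOutput (semList (program n) (embInt 63 S) k) 0 0 1 := by
  obtain ⟨Y, hY, hnum, hout⟩ := isOutput_program S (k := k) hn
  have hok : Y k rOK = 1 := by rw [hY.ok, if_pos (by omega)]
  rw [hY.q0, hY.q1, hY.q2, hY.q3, hok, hY.vis, hY.vk, if_neg hv, if_neg hv, if_pos (by omega),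
    if_pos (by omega), if_neg (by omega)] at hout
  simpa using hout

theorem isOutput_end (hn : 2 ≤ n) (h : lastEdge (edgeAt S) k = 3 * n - 3) (hk : 6 * n ≤ k + 4) :
    IsOutput (semList (program n) (embInt 63 S) k) 0 1 0 := by
  obtain ⟨Y, hY, hnum, hout⟩ := isOutput_program S (k := k) hn
  have hok : Y k rOK = 1 := by rw [hY.ok, if_pos (by omega)]
  rw [hY.q0, hY.q1, hY.q2, hY.q3, hok, if_pos (by omega), if_pos (by omega),
    if_pos (by omega)] at hout
  simpa using hout

end Output

/-! ### Reading the edge list -/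

/-- The numbers `N` and the indicator `E` of the edge tokens belong to a sequence that begins with
the list `e 0, …, e (m - 1)` of edges and goes on without edge tokens. -/
structure Reads {n : ℕ} (e : ℕ → Fin n × Fin n) (m : ℕ) (N E : ℕ → ℤ) : Prop where
  fst : ∀ i < m, N (3 * i + 1) = ((e i).1 : ℤ) + 1
  snd : ∀ i < m, N (3 * i + 3) = ((e i).2 : ℤ) + 1
  edge : ∀ i < m, E (3 * i + 2) = 1
  other : ∀ k, (∀ i < m, k ≠ 3 * i + 2) → E k = 0

/-- The number token of a vertex, and zero if there is none. -/
def optNum {n : ℕ} : Option (Fin n) → ℤ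
  | none => 0
  | some y => (y : ℤ) + 1

section Reads

variable {n : ℕ} {e : ℕ → Fin n × Fin n} {m : ℕ} {N E : ℕ → ℤ}

theorem Reads.rec_eq (h : Reads e m N E) {i : ℕ} (hi : i < m) :
    recSum N E (3 * i + 3) = ((e i).1 : ℤ) + 1 + ((e i).2 + 1) ∧
      recProd N E (3 * i + 3) = (((e i).1 : ℤ) + 1) * ((e i).2 + 1) := by
  unfold recSum recProd
  rw [show 3 * i + 3 - 1 = 3 * i + 2 by omega, show 3 * i + 3 - 2 = 3 * i + 1 by omega,
    h.edge i hi, h.fst i hi, h.snd i hi]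
  constructor <;> ring

theorem Reads.rec_eq_zero (h : Reads e m N E) {k : ℕ} (hk : ∀ i < m, k ≠ 3 * i + 3) :
    recSum N E k = 0 ∧ recProd N E k = 0 := by
  unfold recSum recProd
  rw [h.other (k - 1) fun i hi => by have := hk i hi; omega]
  simp

theorem Reads.incid_eq_zero_iff (h : Reads e m N E) (x : Fin n) (j : ℕ) :
    incid N E ((x : ℤ) + 1) j = 0 ↔ ∃ i < m, j = 3 * i + 4 ∧ ∃ y, IsEdgeAt e i y x := by
  by_cases hj : ∃ i < m, j = 3 * i + 4
  · obtain ⟨i, hi, rfl⟩ := hj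
    have h1 : incid N E ((x : ℤ) + 1) (3 * i + 4) =
        ((x : ℤ) - (e i).1) * ((x : ℤ) - (e i).2) := by
      unfold incid
      rw [show 3 * i + 4 - 1 = 3 * i + 3 by omega, (h.rec_eq hi).1, (h.rec_eq hi).2]
      ring
    rw [h1, mul_eq_zero]
    constructor
    · rintro (h2 | h2)
      · exact ⟨i, hi, rfl, (e i).2, Or.inr (by
          rw [show x = (e i).1 from Fin.ext (by omega)])⟩
      · exact ⟨i, hi, rfl, (e i).1, Or.inl (by
          rw [show x = (e i).2 from Fin.ext (by omega)])⟩
    · rintro ⟨i', _, h2, y, h3⟩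
      obtain rfl : i = i' := by omega
      rcases h3 with h3 | h3 <;> simp [h3]
  · have h1 := h.rec_eq_zero (k := j - 1) fun i hi hk => hj ⟨i, hi, by omega⟩
    constructor
    · intro h2
      rw [incid, h1.1, h1.2] at h2
      have : (0 : ℤ) < ((x : ℤ) + 1) ^ 2 := by positivity
      linarith
    · rintro ⟨i, hi, h2, _⟩
      exact absurd ⟨i, hi, h2⟩ hj

/-- The search in the records finds the last edge that contains `x`. -/
theorem Reads.look_eq (h : Reads e m N E) (x : Fin n) {i k : ℕ} (hi : i ≤ m)
    (hk : ∀ j < m, 3 * j + 4 ≤ k ↔ j < i) : look N E ((x : ℤ) + 1) k = optNum (lastNbr e x i) := by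
  have hle := rmax_le (fun j => -incid N E ((x : ℤ) + 1) j ^ 2) k
  rcases lastNbr_cases e x i with ⟨h1, h2⟩ | ⟨j, hj, y, h1, h2, h3⟩
  · rw [h1, look, if_neg]
    · rfl
    · intro h0
      obtain ⟨j, hj, h4, y, h5⟩ := (h.incid_eq_zero_iff x _).1 h0
      exact h2 j ((hk j hj).1 (by omega)) y h5
  · have h4 : incid N E ((x : ℤ) + 1) (3 * j + 4) = 0 :=
      (h.incid_eq_zero_iff x _).2 ⟨j, by omega, rfl, y, h2⟩
    have h5 : rmax (fun j => -incid N E ((x : ℤ) + 1) j ^ 2) k = 3 * j + 4 := by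
      refine rmax_eq ((hk j (by omega)).2 hj) (fun i' _ => ?_) fun i' hi' hlt => ?_
      · rw [h4]; nlinarith [sq_nonneg (incid N E ((x : ℤ) + 1) i')]
      · have h6 : incid N E ((x : ℤ) + 1) i' ≠ 0 := fun h0 => by
          obtain ⟨j', hj', rfl, y', h7⟩ := (h.incid_eq_zero_iff x _).1 h0
          exact h3 j' ((hk j' hj').1 hi') (by omega) y' h7
        have h7 : 0 < incid N E ((x : ℤ) + 1) i' ^ 2 := by positivity
        rw [h4]
        linarith
    rw [look, h5, if_pos h4, h1, show 3 * j + 4 - 1 = 3 * j + 3 by omega,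
      (h.rec_eq (by omega)).1]
    rcases h2 with h2 | h2 <;> rw [h2] <;> simp [optNum]

/-- The search for the edge between the last two numbers. -/
theorem Reads.pairPos_eq (h : Reads e m N E)
    (huniq : ∀ {i j a x}, i < m → j < m → IsEdgeAt e i a x → IsEdgeAt e j a x → i = j) {i k : ℕ}
    {a x : Fin n} (hi : i < m) (hk : 3 * i + 3 ≤ k) (hax : IsEdgeAt e i a x)
    (ha : N (k - 1) = (a : ℤ) + 1) (hx : N k = (x : ℤ) + 1) : pairPos N E k = 3 * i + 3 := by
  have hzero : (recSum N E (3 * i + 3) - (N (k - 1) + N k)) ^ 2 +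
      (recProd N E (3 * i + 3) - N (k - 1) * N k) ^ 2 = 0 := by
    rw [(h.rec_eq hi).1, (h.rec_eq hi).2, ha, hx]
    rcases hax with h1 | h1 <;> rw [h1] <;> ring
  have hne : ∀ j, j ≠ 3 * i + 3 → 0 < (recSum N E j - (N (k - 1) + N k)) ^ 2 +
      (recProd N E j - N (k - 1) * N k) ^ 2 := by
    intro j hj
    by_contra hcon
    have h1 : recSum N E j - (N (k - 1) + N k) = 0 := by
      rw [← sq_eq_zero_iff]
      nlinarith [sq_nonneg (recSum N E j - (N (k - 1) + N k)),
        sq_nonneg (recProd N E j - N (k - 1) * N k)]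
    have h2 : recProd N E j - N (k - 1) * N k = 0 := by
      rw [← sq_eq_zero_iff]
      nlinarith [sq_nonneg (recSum N E j - (N (k - 1) + N k)),
        sq_nonneg (recProd N E j - N (k - 1) * N k)]
    rw [ha, hx] at h1 h2
    by_cases hj' : ∃ i' < m, j = 3 * i' + 3
    · obtain ⟨i', hi', rfl⟩ := hj'
      rw [(h.rec_eq hi').1] at h1
      rw [(h.rec_eq hi').2] at h2
      -- equal sums and products: the edges coincide
      have h3 : ((x : ℤ) - (e i').1) * ((x : ℤ) - (e i').2) = 0 := by
        linear_combination h2 - ((x : ℤ) + 1) * h1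
      refine hj ?_
      rw [huniq hi' hi (a := a) (x := x) ?_ hax]
      rcases mul_eq_zero.1 h3 with h4 | h4
      · exact Or.inr (Prod.ext (Fin.ext (by simp; omega)) (Fin.ext (by simp; omega)))
      · exact Or.inl (Prod.ext (Fin.ext (by simp; omega)) (Fin.ext (by simp; omega)))
    · have := (h.rec_eq_zero (k := j) fun i' hi' e' => hj' ⟨i', hi', e'⟩).1
      omega
  refine rmax_eq hk (fun j hj => ?_) fun j _ hj => ?_
  · rw [hzero]; linarith [hne j (by omega)]
  · rw [hzero]; linarith [hne j (by omega)]

theorem Reads.nextNum_of_eq (h : Reads e m N E) {k : ℕ} {x : Fin n} (hk : 3 * m + 1 ≤ k)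
    (ha : N (k - 1) = N k) (hx : N k = (x : ℤ) + 1) :
    nextNum N E k = optNum (lastNbr e x m) := by
  have h1 : turn N E k = 0 := by
    rw [turn, if_neg (by omega), if_neg (by omega), add_zero]
  rw [nextNum, h1, if_pos rfl, zero_add, hx, h.look_eq x le_rfl fun j hj => by omega]

theorem Reads.nextNum_of_isEdgeAt (h : Reads e m N E)
    (huniq : ∀ {i j a x}, i < m → j < m → IsEdgeAt e i a x → IsEdgeAt e j a x → i = j)
    (hlt : ∀ i < m, (e i).1 < (e i).2) {i k : ℕ}
    {a x : Fin n} (hi : i < m) (hk : 3 * m + 1 ≤ k) (hax : IsEdgeAt e i a x)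
    (ha : N (k - 1) = (a : ℤ) + 1) (hx : N k = (x : ℤ) + 1) {y : Fin n}
    (hy : lastNbr e x m = some y) : nextNum N E k = ((nextVertex e m i x : Fin n) : ℤ) + 1 := by
  have hp := h.pairPos_eq huniq hi (by omega) hax ha hx
  have hvis : ∀ j < m, 3 * j + 4 ≤ 3 * i + 3 ↔ j < i := fun j _ => by omega
  have h1 : turn N E k = optNum (lastNbr e x i) := by
    rw [turn, hp, ha, hx, show 3 * i + 3 - 1 = 3 * i + 2 by omega,
      show 3 * i + 3 - 2 = 3 * i + 1 by omega, h.edge i hi, h.fst i hi, h.snd i hi, one_mul]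
    have h2 := hlt i hi
    rcases hax with h3 | h3 <;> rw [h3] at h2 ⊢ <;> have h4 : _ < _ := Fin.lt_def.1 h2
    · rw [if_pos (by simp at h4 ⊢; omega), if_neg (by simp at h4 ⊢; omega), add_zero,
        h.look_eq x hi.le hvis]
    · rw [if_neg (by simp at h4 ⊢; omega), if_pos (by simp at h4 ⊢; omega), zero_add,
        h.look_eq x hi.le hvis]
  rw [nextNum, h1, hx, h.look_eq x le_rfl fun j hj => by omega, hy, nextVertex, hy]
  rcases lastNbr e x i with _ | z
  · simp [optNum]
  · have : ((z : ℕ) : ℤ) + 1 ≠ 0 := by omega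
    simp [optNum, this]

/-- All edges are counted. -/
theorem Reads.lastEdge_eq (h : Reads e m N E) {k : ℕ} (hk : 3 * m ≤ k) :
    lastEdge E k = 3 * m := by
  unfold lastEdge
  have hE : ∀ j, E j * ((j : ℤ) + 1) = 0 ∨ ∃ i < m, j = 3 * i + 2 ∧ E j * ((j : ℤ) + 1) = 3 * i + 3 := by
    intro j
    by_cases hj : ∃ i < m, j = 3 * i + 2
    · obtain ⟨i, hi, rfl⟩ := hj
      refine Or.inr ⟨i, hi, rfl, ?_⟩
      rw [h.edge i hi]; push_cast; ring
    · left
      rw [h.other j fun i hi e' => hj ⟨i, hi, e'⟩, zero_mul]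
  set r := rmax (fun j => E j * ((j : ℤ) + 1)) k
  have hmax := (rmax_spec (fun j => E j * ((j : ℤ) + 1)) k).1
  change ∀ i ≤ k, E i * ((i : ℤ) + 1) ≤ E r * ((r : ℤ) + 1) at hmax
  rcases Nat.eq_zero_or_pos m with rfl | hm
  · rcases hE r with h1 | ⟨i, hi, _⟩
    · simpa using h1
    · omega
  · have h1 := hmax (3 * (m - 1) + 2) (by omega)
    rw [h.edge _ (by omega)] at h1
    push_cast [Nat.cast_sub hm] at h1
    rcases hE r with h2 | ⟨i, hi, _, h2⟩
    · rw [h2] at h1; omega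
    · rw [h2] at h1 ⊢; omega

end Reads

/-! ### Recurrent neural networks -/

theorem card_fixedNum_le (p : ℕ) : Finite (FixedNum p) ∧ Nat.card (FixedNum p) ≤ 2 ^ p := by
  have hsub : FixedNum p ⊆ (fun k : ℤ => (k : ℝ) / 2 ^ ((p - 1) / 2)) ''
      (Finset.Ioo (-2 ^ (p - 1)) (2 ^ (p - 1)) : Finset ℤ) := by
    rintro x ⟨k, hk, rfl⟩
    exact ⟨k, by simpa [abs_lt] using hk, rfl⟩
  have hfin := (Finset.finite_toSet (Finset.Ioo (-2 ^ (p - 1) : ℤ) (2 ^ (p - 1)))).image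
    (fun k : ℤ => (k : ℝ) / 2 ^ ((p - 1) / 2))
  refine ⟨hfin.subset hsub, ?_⟩
  rw [Nat.card_coe_set_eq]
  refine (Set.ncard_le_ncard hsub hfin).trans ((Set.ncard_image_le (Finset.finite_toSet _)).trans ?_)
  rw [Set.ncard_coe_finset, Int.card_Ioo]
  have h1 : (2 : ℤ) ^ (p - 1) - -2 ^ (p - 1) - 1 = 2 * 2 ^ (p - 1) - 1 := by ring
  rw [h1]
  rcases p with _ | p
  · simp
  · rw [Nat.add_sub_cancel, ← pow_succ']
    simp

theorem card_state_le (p Λ : ℕ) :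
    Finite (Fin Λ → FixedNum p) ∧ Nat.card (Fin Λ → FixedNum p) ≤ 2 ^ (Λ * p) := by
  have := (card_fixedNum_le p).1
  refine ⟨inferInstance, ?_⟩
  rw [Nat.card_fun, Nat.card_eq_fintype_card (α := Fin Λ), Fintype.card_fin, mul_comm, pow_mul]
  exact Nat.pow_le_pow_left (card_fixedNum_le p).2 _

section RNN

variable {V : Type} {p Λ d : ℕ} (R : RNN p Λ d) (E : Embedding V d)

theorem RNN.state_append {S S' : List V} (h : R.state E S = R.state E S')
    (hl : S.length = S'.length) (t : List V) : R.state E (S ++ t) = R.state E (S' ++ t) := by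
  unfold RNN.state at h ⊢
  rw [List.zipIdx_append, List.zipIdx_append, List.foldl_append, List.foldl_append, h, hl]

variable [Fintype V]

/-- Sequences of equal length that lead to the same state are continued in the same way. -/
theorem RNN.exists_cot {S S' : List V} (h : R.state E S = R.state E S')
    (hl : S.length = S'.length) (τ : (V → ℝ) → V) (t : List V) (i : ℕ) :
    ∃ t', cot (R.lm E) τ (S ++ t) i = S ++ t' ∧ cot (R.lm E) τ (S' ++ t) i = S' ++ t' := by
  induction i with
  | zero => exact ⟨t, rfl, rfl⟩
  | succ i ih =>
    obtain ⟨t', h1, h2⟩ := ih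
    refine ⟨t' ++ [τ (R.lm E (S ++ t'))], ?_, ?_⟩
    · rw [cot, h1, List.append_assoc]
    · rw [cot, h2, List.append_assoc]
      have : R.lm E (S ++ t') = R.lm E (S' ++ t') := by
        unfold RNN.lm
        rw [R.state_append E h hl]
      rw [this]

/-- In particular, the network gives the same answer after such sequences. -/
theorem RNN.answer_eq {S S' : List V} (h : R.state E S = R.state E S')
    (hl : S.length = S'.length) {τ : (V → ℝ) → V} {A : Set V} {t : List V} {a a' : V} {i i' : ℕ}
    (ha : AnswersAfter (R.lm E) τ A (S ++ t) a i) (ha' : AnswersAfter (R.lm E) τ A (S' ++ t) a' i') :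
    a = a' := by
  have key : ∀ j, τ (R.lm E (cot (R.lm E) τ (S ++ t) j)) =
      τ (R.lm E (cot (R.lm E) τ (S' ++ t) j)) := by
    intro j
    obtain ⟨t', h1, h2⟩ := R.exists_cot E h hl τ t j
    rw [h1, h2]
    unfold RNN.lm
    rw [R.state_append E h hl]
  obtain ⟨h1, h2, h3⟩ := ha
  obtain ⟨h1', h2', h3'⟩ := ha'
  have : i = i' := by
    rcases lt_trichotomy i i' with hi | hi | hi
    · exact absurd (key i ▸ h2) (h1' i hi)
    · exact hi
    · exact absurd ((key i').symm ▸ h2') (h1 i' hi)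
  subst this
  rw [← h3, ← h3', key]

end RNN

theorem tokenize_append {n : ℕ} (E E' : List (Fin n × Fin n)) :
    tokenize (E ++ E') = tokenize E ++ (E'.flatMap fun e =>
      [Sum.inl e.1, Sum.inr .edge, Sum.inl e.2]) := by
  simp [tokenize]

theorem length_tokenize {n : ℕ} (E : List (Fin n × Fin n)) :
    (tokenize E).length = 3 * E.length + 1 := by
  induction E with
  | nil => rfl
  | cons e E ih =>
    simp only [tokenize, List.flatMap_cons, List.length_cons, List.length_append,
      List.length_nil] at ih ⊢
    omega

/-! ### Two stars -/

/-- The vertices `3, 4, …`. -/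
def leaf {k : ℕ} (i : Fin k) : Fin (k + 3) := ⟨i + 3, by omega⟩

/-- The vertices `0, 1, 2`. -/
def hub {k : ℕ} (i : Fin 3) : Fin (k + 3) := ⟨i, by omega⟩

/-- The edges between the vertices `3, 4, …` and the centres `0` and `1` of two stars; the vertex
`i + 3` belongs to the star of `1` if `b i` holds. -/
def starEdges {k : ℕ} (b : Fin k → Bool) : List (Fin (k + 3) × Fin (k + 3)) :=
  List.ofFn fun i => (hub (if b i then 1 else 0), leaf i)

/-- The path from the vertex `i + 3` to the centre `0` through the vertex `2`. -/
def testEdges {k : ℕ} (i : Fin k) : List (Fin (k + 3) × Fin (k + 3)) :=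
  [(hub 2, leaf i), (hub 0, hub 2)]

/-- The graph with given edges. -/
def listGraph {n : ℕ} (E : List (Fin n × Fin n)) : SimpleGraph (Fin n) where
  Adj u v := u ≠ v ∧ ((u, v) ∈ E ∨ (v, u) ∈ E)
  symm := ⟨fun _ _ h => ⟨h.1.symm, h.2.symm⟩⟩
  loopless := ⟨fun _ h => h.1 rfl⟩

theorem isEdgeList_listGraph {n : ℕ} {E : List (Fin n × Fin n)} (h1 : E.Nodup)
    (h2 : ∀ e ∈ E, e.1 < e.2) : IsEdgeList (listGraph E) E := by
  refine ⟨h1, fun e => ⟨fun he => ⟨h2 e he, (h2 e he).ne, Or.inl he⟩, ?_⟩⟩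
  rintro ⟨hlt, _, he | he⟩
  · exact he
  · exact absurd (h2 _ he) hlt.asymm

theorem IsEdgeList.card_edgeSet {n : ℕ} {G : SimpleGraph (Fin n)} {E : List (Fin n × Fin n)}
    (h : IsEdgeList G E) : Nat.card G.edgeSet = E.length := by
  classical
  have h1 : G.edgeSet = ((E.map fun e => s(e.1, e.2)).toFinset : Set (Sym2 (Fin n))) := by
    ext e
    induction e with
    | _ u v =>
      simp only [SimpleGraph.mem_edgeSet, List.coe_toFinset, Set.mem_ofPred_eq, List.mem_map,
        Prod.exists, h.2]
      constructor
      · intro hadj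
        rcases lt_or_gt_of_ne hadj.ne with hlt | hlt
        · exact ⟨u, v, ⟨hlt, hadj⟩, rfl⟩
        · exact ⟨v, u, ⟨hlt, hadj.symm⟩, Sym2.eq_swap⟩
      · rintro ⟨a, b, ⟨_, hadj⟩, he⟩
        rw [← SimpleGraph.mem_edgeSet, ← he]
        exact hadj
  have h2 : (E.map fun e => s(e.1, e.2)).Nodup := by
    refine (List.nodup_map_iff_inj_on h.1).2 ?_
    rintro ⟨a, b⟩ hab ⟨c, d⟩ hcd he
    have h3 := ((h.2 _).1 hab).1
    have h4 := ((h.2 _).1 hcd).1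
    rcases Sym2.eq_iff.1 he with ⟨h5, h6⟩ | ⟨h5, h6⟩
    · exact Prod.ext h5 h6
    · simp only at h3 h4 h5 h6
      rw [h5, h6] at h3
      exact absurd h3 h4.asymm
  rw [h1, Nat.card_coe_set_eq, Set.ncard_coe_finset, List.toFinset_card_of_nodup h2,
    List.length_map]

theorem isEdgeList_test {k : ℕ} (b : Fin k → Bool) (i : Fin k) :
    IsEdgeList (listGraph (starEdges b ++ testEdges i)) (starEdges b ++ testEdges i) := by
  apply isEdgeList_listGraph
  · refine List.Nodup.append ?_ ?_ ?_
    · refine List.nodup_ofFn.2 fun j j' h => ?_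
      simpa [leaf, Fin.ext_iff] using congrArg Prod.snd h
    · simp [testEdges, hub, Fin.ext_iff]
    · intro e he he'
      simp only [starEdges, List.mem_ofFn] at he
      obtain ⟨j, rfl⟩ := he
      cases hb : b j <;> simp [hb, testEdges, hub, leaf, Fin.ext_iff] at he'
  · intro e he
    rcases List.mem_append.1 he with he | he
    · simp only [starEdges, List.mem_ofFn] at he
      obtain ⟨j, rfl⟩ := he
      cases hb : b j <;> simp [hub, leaf, Fin.lt_def]
    · simp only [testEdges, List.mem_cons, List.not_mem_nil, or_false] at he
      rcases he with rfl | rfl <;> simp [hub, leaf, Fin.lt_def]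

theorem adj_star {k : ℕ} (b : Fin k → Bool) (i j : Fin k) :
    (listGraph (starEdges b ++ testEdges i)).Adj (hub (if b j then 1 else 0)) (leaf j) :=
  let h := isEdgeList_test b i
  ((h.2 _).1 (List.mem_append_left _ (List.mem_ofFn.2 ⟨j, rfl⟩))).2

theorem isTree_test {k : ℕ} {b : Fin k → Bool} {i : Fin k} (hb : b i = true) :
    (listGraph (starEdges b ++ testEdges i)).IsTree := by
  have h := isEdgeList_test b i
  have h1 : (listGraph (starEdges b ++ testEdges i)).Adj (hub 2) (leaf i) :=
    ((h.2 (hub 2, leaf i)).1 (by simp [testEdges])).2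
  have h2 : (listGraph (starEdges b ++ testEdges i)).Adj (hub 0) (hub 2) :=
    ((h.2 (hub 0, hub 2)).1 (by simp [testEdges])).2
  have h3 := adj_star b i i
  rw [hb, if_pos rfl] at h3
  have hhub : ∀ t : Fin 3, (listGraph (starEdges b ++ testEdges i)).Reachable (hub 0) (hub t) := by
    intro t
    fin_cases t
    · exact SimpleGraph.Reachable.refl _
    · exact (h2.reachable.trans h1.reachable).trans h3.reachable.symm
    · exact h2.reachable
  have hall : ∀ v, (listGraph (starEdges b ++ testEdges i)).Reachable (hub 0) v := by
    rintro ⟨v, hv⟩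
    by_cases h4 : v < 3
    · exact hhub ⟨v, h4⟩
    · obtain ⟨j, rfl⟩ := Nat.exists_eq_add_of_le' (not_lt.1 h4)
      exact (hhub _).trans (adj_star b i ⟨j, by omega⟩).reachable
  refine SimpleGraph.isTree_iff_connected_and_card.2 ⟨⟨fun u v => (hall u).symm.trans (hall v)⟩, ?_⟩
  rw [h.card_edgeSet]
  simp [starEdges, testEdges]

theorem not_isTree_test {k : ℕ} {b : Fin k → Bool} {i : Fin k} (hb : b i = false) :
    ¬ (listGraph (starEdges b ++ testEdges i)).IsTree := by
  intro hG
  -- the star of `1` is a union of components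
  let P : Fin (k + 3) → Prop := fun v => v = hub 1 ∨ ∃ j, b j = true ∧ v = leaf j
  have hP : ∀ e ∈ starEdges b ++ testEdges i, P e.1 ↔ P e.2 := by
    intro e he
    rcases List.mem_append.1 he with he | he
    · simp only [starEdges, List.mem_ofFn] at he
      obtain ⟨j, rfl⟩ := he
      cases hj : b j <;> simp [P, hub, leaf, Fin.ext_iff]
      · intro j' hj' h
        rw [Fin.ext h, hj'] at hj
        cases hj
      · exact ⟨j, hj, rfl⟩
    · simp only [testEdges, List.mem_cons, List.not_mem_nil, or_false] at he
      rcases he with rfl | rfl <;> simp [P, hub, leaf, Fin.ext_iff]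
      · intro j' hj' h
        rw [Fin.ext h, hj'] at hb
        cases hb
  have hwalk : ∀ u v, (listGraph (starEdges b ++ testEdges i)).Walk u v → P u → P v := by
    intro u v p
    induction p with
    | nil => exact id
    | cons hadj _ ih =>
      intro hu
      apply ih
      rcases hadj.2 with he | he
      · exact (hP _ he).1 hu
      · exact (hP _ he).2 hu
  obtain ⟨p⟩ := hG.connected.preconnected (hub 1) (hub 0)
  have := hwalk _ _ p (Or.inl rfl)
  simp [P, hub, leaf, Fin.ext_iff] at this

/-- A recurrent network with fewer than `2 ^ k` states confuses two pairs of stars; completing both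
by the same two edges, where they differ, gives a tree and a disconnected graph. -/
theorem RNN.not_solvesIsTree {p Λ d k : ℕ} (R : RNN p Λ d) (E : Embedding (Token (k + 3)) d)
    (h : Λ * p < k) (τ : (Token (k + 3) → ℝ) → Token (k + 3)) :
    ¬ SolvesIsTree (k + 3) (R.lm E) τ := by
  intro hsol
  obtain ⟨hfin, hcard⟩ := card_state_le p Λ
  obtain ⟨b, b', hne, hst⟩ : ∃ b b' : Fin k → Bool, b ≠ b' ∧
      R.state E (tokenize (starEdges b)) = R.state E (tokenize (starEdges b')) := by
    by_contra! hcon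
    have hinj : Function.Injective fun b : Fin k → Bool => R.state E (tokenize (starEdges b)) :=
      fun b b' h => by_contra fun hne => hcon b b' hne h
    have h1 := Nat.card_le_card_of_injective _ hinj
    rw [Nat.card_fun, Nat.card_eq_fintype_card, Nat.card_eq_fintype_card, Fintype.card_bool,
      Fintype.card_fin] at h1
    exact absurd (h1.trans hcard) (not_le.2 (Nat.pow_lt_pow_right one_lt_two h))
  obtain ⟨i, hi⟩ := Function.ne_iff.1 hne
  wlog hb : b i = true generalizing b b'
  · refine this b' b hne.symm hst.symm hi.symm ?_
    cases hb' : b' i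
    · simp [hb'] at hi; exact absurd hi hb
    · rfl
  have hb' : b' i = false := by
    cases hb' : b' i
    · rfl
    · exact absurd (hb.trans hb'.symm) hi
  obtain ⟨j, hj⟩ := hsol _ _ (isEdgeList_test b i)
  obtain ⟨j', hj'⟩ := hsol _ _ (isEdgeList_test b' i)
  rw [tokenize_append, isTreeAnswer, if_pos (isTree_test hb)] at hj
  rw [tokenize_append, isTreeAnswer, if_neg (not_isTree_test hb')] at hj'
  have := R.answer_eq E hst (by simp [length_tokenize, starEdges]) hj hj'
  simp at this

theorem eventually_not_solvesIsTree (p Λ d : ℕ → ℕ) (E : ∀ n, Embedding (Token n) (d n))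
    (R : ∀ n, RNN (p n) (Λ n) (d n))
    (h : (fun n => ((Λ n * p n : ℕ) : ℝ)) =o[atTop] (fun n => (n : ℝ))) :
    ∀ᶠ n in atTop, ∀ τ : (Token n → ℝ) → Token n, ¬ SolvesIsTree n ((R n).lm (E n)) τ := by
  filter_upwards [h.def (by norm_num : (0 : ℝ) < 1 / 2), eventually_ge_atTop 7] with n hn h7 τ
  have hlt : Λ n * p n < n - 3 := by
    rw [Real.norm_of_nonneg (by positivity), Real.norm_of_nonneg (by positivity)] at hn
    have h2 : 2 * (Λ n * p n) ≤ n := by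
      have : (2 : ℝ) * ((Λ n * p n : ℕ) : ℝ) ≤ n := by linarith
      exact_mod_cast this
    omega
  generalize R n = R at *
  generalize E n = E at *
  obtain ⟨k, rfl⟩ := Nat.exists_eq_add_of_le' (show 3 ≤ n by omega)
  exact R.not_solvesIsTree E (by simpa using hlt) τ

/-! ### Token sequences -/

theorem getElem?_tokenize {n : ℕ} (E : List (Fin n × Fin n)) (i : ℕ) :
    (tokenize E)[3 * i + 1]? = E[i]?.map (fun e => Sum.inl e.1) ∧
      (tokenize E)[3 * i + 2]? = E[i]?.map (fun _ => Sum.inr .edge) ∧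
      (tokenize E)[3 * i + 3]? = E[i]?.map (fun e => Sum.inl e.2) := by
  unfold tokenize
  simp only [List.getElem?_cons_succ]
  induction E generalizing i with
  | nil => simp
  | cons e E ih =>
    rcases i with _ | i
    · simp
    · simp only [Nat.mul_add, Nat.mul_one, List.flatMap_cons, List.cons_append, List.nil_append,
        List.getElem?_cons_succ]
      exact ih i

theorem numAt_of_eq {n : ℕ} {S : List (Token n)} {k : ℕ} {i : Fin n} (h : S[k]? = some (Sum.inl i)) :
    numAt S k = (i : ℤ) + 1 := by
  rw [numAt, embInt, h, if_neg (by decide)]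
  simp [tokVec]

theorem edgeAt_of_eq {n : ℕ} {S : List (Token n)} {k : ℕ} (h : S[k]? = some (Sum.inr .edge)) :
    edgeAt S k = 1 := by
  rw [edgeAt, embInt, h, if_neg (by decide)]
  simp [tokVec, Special.index]

theorem edgeAt_of_ne {n : ℕ} {S : List (Token n)} {k : ℕ} (h : S[k]? ≠ some (Sum.inr .edge)) :
    edgeAt S k = 0 := by
  rw [edgeAt, embInt, if_neg (by decide)]
  rcases hS : S[k]? with _ | i | s
  · simp
  · simp [tokVec]
  · cases s <;> simp [tokVec, Special.index]
    exact h hS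

section Decode

variable {n : ℕ} {E : List (Fin n × Fin n)} {e : ℕ → Fin n × Fin n}

theorem reads_append (he : ∀ i < E.length, E[i]? = some (e i)) (l : List (Fin n)) :
    Reads e E.length (numAt (tokenize E ++ l.map Sum.inl)) (edgeAt (tokenize E ++ l.map Sum.inl)) := by
  have hlt : ∀ k < 3 * E.length + 1, (tokenize E ++ l.map Sum.inl)[k]? = (tokenize E)[k]? :=
    fun k hk => List.getElem?_append_left (by rwa [length_tokenize])
  refine ⟨fun i hi => numAt_of_eq ?_, fun i hi => numAt_of_eq ?_, fun i hi => edgeAt_of_eq ?_,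
    fun k hk => edgeAt_of_ne ?_⟩
  · rw [hlt _ (by omega), (getElem?_tokenize E i).1, he i hi]; rfl
  · rw [hlt _ (by omega), (getElem?_tokenize E i).2.2, he i hi]; rfl
  · rw [hlt _ (by omega), (getElem?_tokenize E i).2.1, he i hi]; rfl
  · rcases lt_or_ge k (3 * E.length + 1) with h | h
    · rw [hlt k h]
      rcases k with _ | k
      · simp [tokenize]
      · obtain h1 | h1 | h1 : k = 3 * (k / 3) ∨ k = 3 * (k / 3) + 1 ∨ k = 3 * (k / 3) + 2 := by omega
        · rw [h1, (getElem?_tokenize E _).1]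
          simp
        · exact absurd (by omega) (hk (k / 3) (by omega))
        · rw [h1, (getElem?_tokenize E _).2.2]
          simp
    · rw [List.getElem?_append_right (by rwa [length_tokenize])]
      simp

theorem numAt_append (l : List (Fin n)) {t : ℕ} {x : Fin n} (h : l[t]? = some x) :
    numAt (tokenize E ++ l.map Sum.inl) (3 * E.length + 1 + t) = (x : ℤ) + 1 := by
  refine numAt_of_eq ?_
  rw [List.getElem?_append_right (by rw [length_tokenize]; omega), length_tokenize,
    Nat.add_sub_cancel_left, List.getElem?_map, h]
  rfl

theorem IsEdgeList.lists {G : SimpleGraph (Fin n)} (h : IsEdgeList G E)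
    (he : ∀ i < E.length, E[i]? = some (e i)) : Lists G e E.length where
  adj i hi := ((h.2 _).1 (List.mem_of_getElem? (he i hi))).2
  exists_edge := by
    intro a x hax
    have key : ∀ {a x}, a < x → G.Adj a x → ∃ i < E.length, e i = (a, x) := by
      intro a x hlt hax
      obtain ⟨i, hi⟩ := List.getElem?_of_mem ((h.2 (a, x)).2 ⟨hlt, hax⟩)
      have hi' : i < E.length := (List.getElem?_eq_some_iff.1 hi).1
      exact ⟨i, hi', Option.some.inj ((he i hi').symm.trans hi)⟩
    rcases lt_or_gt_of_ne hax.ne with hlt | hlt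
    · obtain ⟨i, hi, h1⟩ := key hlt hax
      exact ⟨i, hi, Or.inl h1⟩
    · obtain ⟨i, hi, h1⟩ := key hlt hax.symm
      exact ⟨i, hi, Or.inr h1⟩
  unique := by
    intro i j a x hi hj h1 h2
    have hlt : ∀ i < E.length, (e i).1 < (e i).2 :=
      fun i hi => ((h.2 _).1 (List.mem_of_getElem? (he i hi))).1
    have h3 : e i = e j := by
      have h4 := hlt i hi
      have h5 := hlt j hj
      rcases h1 with h1 | h1 <;> rcases h2 with h2 | h2 <;> rw [h1] at h4 ⊢ <;> rw [h2] at h5 ⊢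
      · exact absurd h4 h5.asymm
      · exact absurd h4 h5.asymm
    exact (List.getElem?_inj hi h.1).1 (by rw [he i hi, he j hj, h3])

end Decode

/-- The first decoded tokens are `c 0, c 1, …` if each of them follows from the earlier ones. -/
theorem answersAfter_of_forall {V : Type} {M : LM V} {τ : (V → ℝ) → V} {A : Set V} {S : List V}
    {a : V} {J : ℕ} (c : ℕ → V) (h : ∀ j < J, τ (M (S ++ (List.range j).map c)) = c j)
    (hc : ∀ j < J, c j ∉ A) (ha : a ∈ A) (hJ : τ (M (S ++ (List.range J).map c)) = a) :
    AnswersAfter M τ A S a J := by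
  have key : ∀ j ≤ J, cot M τ S j = S ++ (List.range j).map c := by
    intro j hj
    induction j with
    | zero => simp [cot]
    | succ j ih =>
      rw [cot, ih (by omega), h j (by omega), List.range_succ, List.map_append,
        List.append_assoc]
      rfl
  refine ⟨fun j hj => ?_, ?_, ?_⟩
  · rw [key j hj.le, h j hj]; exact hc j hj
  · rw [key J le_rfl, hJ]; exact ha
  · rw [key J le_rfl, hJ]

/-! ### Decoding the walk -/

/-- A next-token rule that follows the program on all sequences of length at most `7 n²`. -/
structure Follows (n : ℕ) (f : List (Token n) → Token n) : Prop where
  num : ∀ S, 0 < S.length → S.length ≤ 7 * n ^ 2 → ∀ i : Fin n,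
    IsOutput (semList (program n) (embInt 63 S) (S.length - 1)) ((i : ℤ) + 1) 0 0 → f S = Sum.inl i
  yes : ∀ S, 0 < S.length → S.length ≤ 7 * n ^ 2 →
    IsOutput (semList (program n) (embInt 63 S) (S.length - 1)) 0 1 0 → f S = Sum.inr .yes
  no : ∀ S, 0 < S.length → S.length ≤ 7 * n ^ 2 →
    IsOutput (semList (program n) (embInt 63 S) (S.length - 1)) 0 0 1 → f S = Sum.inr .no

theorem IsEdgeList.isTree_iff {n : ℕ} {G : SimpleGraph (Fin n)} {E : List (Fin n × Fin n)}
    (h : IsEdgeList G E) : G.IsTree ↔ G.Connected ∧ E.length + 1 = n := by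
  rw [SimpleGraph.isTree_iff_connected_and_card, h.card_edgeSet, Nat.card_eq_fintype_card,
    Fintype.card_fin]

theorem IsEdgeList.length_le {n : ℕ} {G : SimpleGraph (Fin n)} {E : List (Fin n × Fin n)}
    (h : IsEdgeList G E) : E.length ≤ n ^ 2 := by
  have := h.1.length_le_card
  simpa [sq] using this

theorem IsEdgeList.card_dart {n : ℕ} {G : SimpleGraph (Fin n)} {E : List (Fin n × Fin n)}
    (h : IsEdgeList G E) : Nat.card G.Dart = 2 * E.length := by
  classical
  rw [Nat.card_eq_fintype_card, G.dart_card_eq_twice_card_edges, ← h.card_edgeSet,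
    Nat.card_eq_fintype_card, SimpleGraph.edgeFinset_card]

/-- The decoded numbers for a graph with `n - 1` edges: the walk, and then the list of all
vertices. -/
def decoded {n m : ℕ} (hn : 0 < n) (walk : ℕ → Fin n) (j : ℕ) : Fin n :=
  if j ≤ 2 * m then walk j else ⟨(j - 2 * m - 1) % n, Nat.mod_lt _ hn⟩

section Follows

variable {n : ℕ} {M : LM (Token n)} {τ : (Token n → ℝ) → Token n} {G : SimpleGraph (Fin n)}
  {E : List (Fin n × Fin n)} {e : ℕ → Fin n × Fin n}

/-- One step of the decoding for a graph with `n - 1` edges, after the first `j` decoded tokens: the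
walk is followed for `2 m + 1` steps, and then the vertices are listed as long as they occur on it. -/
theorem Follows.step (hf : Follows n fun S => τ (M S)) (hn : 2 ≤ n) (hm : E.length + 1 = n)
    (hE : IsEdgeList G E) (he : ∀ i < E.length, E[i]? = some (e i)) (h : Lists G e E.length)
    (d : G.Dart) (hd : d.fst = (e (E.length - 1)).2)
    (hd' : lastNbr e d.fst E.length = some d.snd) {j : ℕ} (hj : j < 3 * E.length + 2) :
    let walk := fun t => (h.next^[t] d).fst
    let c := decoded (m := E.length) (by omega : 0 < n) walk
    let r := τ (M (tokenize E ++ (List.range j).map fun t => Sum.inl (c t)))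
    (j ≤ 2 * E.length → r = Sum.inl (c j)) ∧
    (2 * E.length < j → (∃ t ≤ 2 * E.length, walk t = c j) → r = Sum.inl (c j)) ∧
    (2 * E.length < j → (¬ ∃ t ≤ 2 * E.length, walk t = c j) → r = Sum.inr .no) := by
  intro walk c r
  set m := E.length with hmdef
  have hmap : ((List.range j).map fun t => (Sum.inl (c t) : Token n)) =
      ((List.range j).map c).map Sum.inl := by simp
  set S := tokenize E ++ ((List.range j).map c).map Sum.inl with hS
  have hr : r = τ (M S) := by simp only [r, hS, hmap]
  have hR : Reads e m (numAt S) (edgeAt S) := reads_append he _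
  have hlen : S.length - 1 = 3 * m + j := by
    rw [hS, List.length_append, length_tokenize, List.length_map, List.length_map, List.length_range]
    omega
  have h0 : 0 < S.length := by simp [hS, length_tokenize]
  have h7 : S.length ≤ 7 * n ^ 2 := by
    have : n ≤ n ^ 2 := Nat.le_self_pow two_ne_zero n
    omega
  have hlast : lastEdge (edgeAt S) (3 * m + j) = 3 * n - 3 := by
    rw [hR.lastEdge_eq (by omega)]; omega
  have hnum : ∀ t < j, numAt S (3 * m + 1 + t) = (c t : ℤ) + 1 := fun t ht =>
    numAt_append _ (by simp [ht])
  have hnum0 : numAt S (3 * m) = (walk 0 : ℤ) + 1 := by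
    have := hR.snd (m - 1) (by omega)
    rw [show 3 * (m - 1) + 3 = 3 * m by omega, ← hd] at this
    exact this
  have hcw : ∀ t ≤ 2 * m, c t = walk t := fun t ht => if_pos ht
  have hcv : ∀ t, 2 * m < t → t < 3 * m + 2 → (c t : ℕ) = t - 2 * m - 1 := by
    intro t ht ht'
    have : c t = ⟨(t - 2 * m - 1) % n, Nat.mod_lt _ (by omega)⟩ := if_neg (by omega)
    rw [this]
    exact Nat.mod_eq_of_lt (by omega)
  have hvis : 2 * m < j → ((∃ k ≤ 3 * m + j, decNum n (numAt S) k =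
      ((3 * m + j : ℕ) : ℤ) + 1 + (4 - 5 * n)) ↔ ∃ t ≤ 2 * m, walk t = c j) := by
    intro hj'
    have hcj := hcv j hj' hj
    rw [show ((3 * m + j : ℕ) : ℤ) + 1 + (4 - 5 * n) = (c j : ℤ) + 1 by push_cast; omega]
    unfold decNum
    constructor
    · rintro ⟨k, hk, hkv⟩
      split_ifs at hkv with hk0
      · obtain rfl | hk1 := Nat.eq_or_lt_of_le (show 3 * m ≤ k by omega)
        · exact ⟨0, by omega, Fin.ext (by omega)⟩
        · obtain ⟨t, rfl⟩ := Nat.exists_eq_add_of_le (show 3 * m + 1 ≤ k by omega)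
          rw [hnum t (by omega)] at hkv
          by_cases ht : t ≤ 2 * m
          · exact ⟨t, ht, by rw [← hcw t ht]; exact Fin.ext (by omega)⟩
          · have := hcv t (by omega) (by omega)
            omega
      · omega
    · rintro ⟨t, ht, htv⟩
      refine ⟨3 * m + 1 + t, by omega, ?_⟩
      rw [if_pos (by push_cast; omega), hnum t (by omega), hcw t ht, htv]
  rw [hr]
  refine ⟨fun hj' => ?_, fun hj' hv => ?_, fun hj' hv => ?_⟩
  · refine hf.num S h0 h7 (c j) ?_
    rw [hlen, hcw j hj']
    obtain rfl | rfl | ⟨i, rfl⟩ : j = 0 ∨ j = 1 ∨ ∃ i, j = i + 2 := by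
      rcases j with _ | _ | i
      · exact Or.inl rfl
      · exact Or.inr (Or.inl rfl)
      · exact Or.inr (Or.inr ⟨i, rfl⟩)
    · rw [add_zero, ← hnum0]
      exact isOutput_copy S hn hlast (by omega)
    · have h1 := hnum 0 (by omega)
      rw [hcw 0 (by omega)] at h1
      have h2 := hR.nextNum_of_eq (k := 3 * m + 1) le_rfl (hnum0.trans h1.symm) h1
      have h3 : lastNbr e (walk 0) m = some (walk 1) := hd'
      rw [h3, optNum] at h2
      rw [← h2]
      exact isOutput_walk S hn hlast (by omega) (by omega)
    · have h1 := hnum (i + 1) (by omega)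
      have h2 : numAt S (3 * m + (i + 2) - 1) = (walk i : ℤ) + 1 := by
        have := hnum i (by omega)
        rw [hcw i (by omega)] at this
        rw [← this]
        congr 1
        omega
      rw [hcw (i + 1) (by omega), show 3 * m + 1 + (i + 1) = 3 * m + (i + 2) by omega] at h1
      have hw : walk (i + 1) = (h.next^[i] d).snd := by
        simp only [walk, Function.iterate_succ_apply']
        rfl
      have hw' : walk (i + 2) = nextVertex e m (h.index (h.next^[i] d)) (h.next^[i] d).snd := by
        simp only [walk, Function.iterate_succ_apply']
        rfl
      obtain ⟨y, hy⟩ := h.exists_lastNbr (h.next^[i] d).adj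
      obtain ⟨h3, h4⟩ := h.index_spec (h.next^[i] d)
      rw [hw] at h1
      have h5 := hR.nextNum_of_isEdgeAt h.unique
        (fun i hi => ((hE.2 _).1 (List.mem_of_getElem? (he i hi))).1) h3 (by omega) h4 h2 h1 hy
      rw [hw', ← h5]
      exact isOutput_walk S hn hlast (by omega) (by omega)
  · refine hf.num S h0 h7 (c j) ?_
    have := isOutput_visited S hn hlast (by omega) (by omega) ((hvis hj').2 hv)
    rw [show ((3 * m + j : ℕ) : ℤ) + 1 + (4 - 5 * n) = (c j : ℤ) + 1 by
      rw [hcv j hj' hj]; push_cast; omega] at this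
    rw [hlen]
    exact this
  · refine hf.no S h0 h7 ?_
    rw [hlen]
    exact isOutput_not_visited S hn hlast (by omega) (by omega) fun h' => hv ((hvis hj').1 h')

theorem Follows.exists_answersAfter_of_length (hf : Follows n fun S => τ (M S)) (hn : 2 ≤ n)
    (hm : E.length + 1 = n) (hE : IsEdgeList G E) (he : ∀ i < E.length, E[i]? = some (e i)) :
    ∃ i ≤ 3 * n, AnswersAfter M τ (answers n) (tokenize E) (isTreeAnswer G) i := by
  have h := hE.lists he
  have hlast := h.adj (E.length - 1) (by omega)
  obtain ⟨y, hy⟩ := h.exists_lastNbr hlast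
  set d : G.Dart := ⟨(_, y), h.adj_lastNbr le_rfl hy⟩
  have hstep := fun {j} => hf.step hn hm hE he h d rfl hy (j := j)
  set walk := fun t => (h.next^[t] d).fst with hwalk
  set c := decoded (m := E.length) (by omega : 0 < n) walk with hcdef
  simp only at hstep
  have hc : ∀ i : Fin n, c (2 * E.length + 1 + i) = i := by
    intro i
    have : c (2 * E.length + 1 + i) = ⟨(2 * E.length + 1 + i - 2 * E.length - 1) % n,
      Nat.mod_lt _ (by omega)⟩ := if_neg (by omega)
    rw [this]
    refine Fin.ext ?_
    simp only
    rw [show 2 * E.length + 1 + (i : ℕ) - 2 * E.length - 1 = i by omega, Nat.mod_eq_of_lt i.2]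
  have hvisit : ∀ {j}, 2 * E.length < j → j < 3 * E.length + 2 →
      ∃ i : Fin n, j = 2 * E.length + 1 + i := fun {j} h1 h2 =>
    ⟨⟨j - 2 * E.length - 1, by omega⟩, by simp only; omega⟩
  have hmem : ∀ j, (Sum.inl (c j) : Token n) ∉ answers n := by simp [answers]
  by_cases hG : G.IsTree
  · refine ⟨3 * E.length + 2, by omega, answersAfter_of_forall (fun t => Sum.inl (c t))
      (fun j hj => ?_) (fun j _ => hmem j) (by simp [isTreeAnswer, hG, answers]) ?_⟩
    · rcases le_or_gt j (2 * E.length) with h1 | h1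
      · exact (hstep hj).1 h1
      · obtain ⟨t, ht, h2⟩ := h.exists_visit hG hE.card_dart d (c j)
        exact (hstep hj).2.1 h1 ⟨t, ht.le, h2⟩
    · rw [isTreeAnswer, if_pos hG]
      have hmap : ((List.range (3 * E.length + 2)).map fun t => (Sum.inl (c t) : Token n)) =
        ((List.range (3 * E.length + 2)).map c).map Sum.inl := by simp
      rw [hmap]
      have hlen : (tokenize E ++ ((List.range (3 * E.length + 2)).map c).map Sum.inl).length =
          6 * E.length + 3 := by
        rw [List.length_append, length_tokenize, List.length_map, List.length_map,
          List.length_range]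
        omega
      refine hf.yes _ (by omega) ?_ ?_
      · have : n ≤ n ^ 2 := Nat.le_self_pow two_ne_zero n
        omega
      · refine isOutput_end _ hn ?_ (by omega)
        rw [(reads_append he _).lastEdge_eq (by omega)]
        omega
  · -- some vertex is not reached by the walk
    have hex : ∃ i, ∃ hi : i < n, ¬ ∃ t ≤ 2 * E.length, walk t = ⟨i, hi⟩ := by
      by_contra! hcon
      refine hG (hE.isTree_iff.2 ⟨{ preconnected := fun u v => ?_, nonempty := ⟨d.fst⟩ }, hm⟩)
      have hall : ∀ v, G.Reachable d.fst v := fun v => by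
        obtain ⟨t, _, ht⟩ := hcon v v.2
        rw [show v = walk t from ht.symm]
        exact h.reachable_next d t
      exact (hall u).symm.trans (hall v)
    classical
    obtain ⟨hi, hno⟩ := Nat.find_spec hex
    set i := Nat.find hex with hidef
    have hmin : ∀ i' < i, ∀ hi' : i' < n, ∃ t ≤ 2 * E.length, walk t = ⟨i', hi'⟩ := by
      intro i' h1 hi'
      by_contra hcon
      exact Nat.find_min hex h1 ⟨hi', hcon⟩
    refine ⟨2 * E.length + 1 + i, by omega, answersAfter_of_forall (fun t => Sum.inl (c t))
      (fun j hj => ?_) (fun j _ => hmem j) (by simp [isTreeAnswer, hG, answers]) ?_⟩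
    · rcases le_or_gt j (2 * E.length) with h1 | h1
      · exact (hstep (by omega)).1 h1
      · obtain ⟨i', rfl⟩ := hvisit h1 (by omega)
        refine (hstep (by omega)).2.1 h1 ?_
        rw [show decoded (m := E.length) (by omega : 0 < n) walk (2 * E.length + 1 + i') = i' from
          hc i']
        exact hmin i' (by omega) i'.2
    · rw [isTreeAnswer, if_neg hG]
      refine (hstep (by omega)).2.2 (by omega) ?_
      rw [show decoded (m := E.length) (by omega : 0 < n) walk (2 * E.length + 1 + i) = ⟨i, hi⟩ from
        hc ⟨i, hi⟩]
      exact hno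

theorem Follows.solvesIsTreeWithin (hf : Follows n fun S => τ (M S)) (hn : 1 ≤ n) :
    SolvesIsTreeWithin n M τ (3 * n) := by
  intro G E hE
  have hlen : ((tokenize E).length) = 3 * E.length + 1 := length_tokenize E
  have h7 : (tokenize E).length ≤ 7 * n ^ 2 := by
    have := hE.length_le
    have : 1 ≤ n ^ 2 := Nat.one_le_pow _ _ hn
    omega
  have hzero : ∀ a ∈ answers n, τ (M (tokenize E)) = a →
      AnswersAfter M τ (answers n) (tokenize E) a 0 := fun a ha h =>
    answersAfter_of_forall (fun _ => a) (fun j hj => absurd hj (Nat.not_lt_zero j))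
      (fun j hj => absurd hj (Nat.not_lt_zero j)) ha (by simpa using h)
  obtain rfl | hn2 := hn.eq_or_lt
  · have hG : G.IsTree := SimpleGraph.IsTree.of_subsingleton
    refine ⟨0, by omega, hzero _ (by simp [isTreeAnswer, hG, answers]) ?_⟩
    rw [isTreeAnswer, if_pos hG]
    exact hf.yes _ (by omega) h7 (isOutput_program_one (by simp) _ _)
  · have he : ∀ i < E.length, E[i]? = some (E.getD i (⟨0, hn⟩, ⟨0, hn⟩)) := fun i hi => by
      simp [hi]
    by_cases hm : E.length + 1 = n
    · exact hf.exists_answersAfter_of_length hn2 hm hE he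
    · have hG : ¬ G.IsTree := fun h => hm (hE.isTree_iff.1 h).2
      refine ⟨0, by omega, hzero _ (by simp [isTreeAnswer, hG, answers]) ?_⟩
      rw [isTreeAnswer, if_neg hG]
      refine hf.no _ (by omega) h7 (isOutput_of_lastEdge_ne _ hn2 ?_)
      have hR := reads_append he []
      rw [List.map_nil, List.append_nil] at hR
      rw [hR.lastEdge_eq (by omega)]
      omega

end Follows

/-! ### The Transformer -/

/-- The program for graphs with `n` vertices runs on a Transformer with `O(log n)` bits. -/
theorem exists_transformer : ∃ C : ℕ, ∀ n : ℕ, 1 ≤ n →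
    ∃ p : ℕ, Odd p ∧ p ≤ C * (Nat.log 2 n + 1) ∧ ∃ T : Transformer p 64 11 1 16,
      ∀ τ : (Token n → ℝ) → Token n, IsArgmax τ →
        Follows n fun S => τ (T.lm (stdEmbedding n 64) S) := by
  -- eleven layers and the readout; the exponent is kept opaque, since its powers are too large to
  -- be evaluated
  obtain ⟨e, he⟩ : ∃ e, e = 24 ^ 12 := ⟨_, rfl⟩
  -- the constant in `argmax_toTransformer_lm` is the product of the dimension `64`, its root `8`, the
  -- `4` of `2 * q + 2 ≤ 4 * q`, the `49` of the squared length and the `100` of the weights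
  obtain ⟨K, hK, hprec⟩ := exists_precision (64 * 8 * 4 * 49 * 100) e
  refine ⟨2 * K + 1, fun n hn => ?_⟩
  specialize hprec n
  have hq1 : 1 ≤ K * (Nat.log 2 n + 1) := Nat.mul_pos hK (Nat.succ_pos _)
  set q := K * (Nat.log 2 n + 1) with hq
  refine ⟨2 * q + 1, ⟨q, rfl⟩, ?_, ?_⟩
  · rw [hq, add_mul, mul_assoc]
    omega
  have hlen : (program n).length = 11 := by simp [program, body]
  suffices h : ∃ T : Transformer (2 * q + 1) 64 (program n).length 1 16,
      ∀ τ : (Token n → ℝ) → Token n, IsArgmax τ →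
        Follows n fun S => τ (T.lm (stdEmbedding n 64) S) by
    rwa [hlen] at h
  refine ⟨toTransformer (D := 63) (program n) q 16 8 (49 * n ^ 4), fun τ hτ => ?_⟩
  have hn' : (1 : ℤ) ≤ n := by exact_mod_cast hn
  have hq' : (1 : ℤ) ≤ q := by exact_mod_cast hq1
  have hZ : ((63 : ℕ) + 1 : ℤ) * ((8 : ℕ) * ((2 * q + 2) * ((49 * n ^ 4 : ℕ) : ℤ)) * (100 * n)) ≤
      64 * 8 * 4 * 49 * 100 * q * n ^ 5 := by
    have h5 : (0 : ℤ) ≤ (n : ℤ) ^ 5 := by positivity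
    push_cast
    nlinarith
  have hprec' : (64 * 8 * 4 * 49 * 100 * q * n ^ 5 : ℤ) ^ 24 ^ ((program n).length + 1) < 2 ^ q := by
    rw [hlen, ← he]
    exact_mod_cast hprec
  have key : ∀ (S : List (Token n)), 0 < S.length → S.length ≤ 7 * n ^ 2 → ∀ v : Token n,
      (∀ v' ≠ v, logit (semList (program n) (embInt 63 S) (S.length - 1)) v' <
        logit (semList (program n) (embInt 63 S) (S.length - 1)) v) →
      τ ((toTransformer (D := 63) (program n) q 16 8 (49 * n ^ 4)).lm (stdEmbedding n 64) S) = v := by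
    intro S hS h7 v hv
    refine argmax_toTransformer_lm (D := 63) (W := 100 * n) rfl (by norm_num) (by omega) hn
      (by norm_num) hZ (program_fits hn') hprec' hS ?_ ?_ hτ hv
    · calc S.length * S.length ≤ 7 * n ^ 2 * (7 * n ^ 2) := Nat.mul_le_mul h7 h7
        _ = 49 * n ^ 4 := by ring
    · have h7' : (S.length : ℤ) ≤ 7 * (n : ℤ) ^ 2 := by exact_mod_cast h7
      have h2 : (n : ℤ) ^ 2 ≤ (n : ℤ) ^ 5 := pow_le_pow_right₀ hn' (by norm_num)
      have h5 : (n : ℤ) ^ 5 ≤ q * (n : ℤ) ^ 5 := le_mul_of_one_le_left (by positivity) hq'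
      nlinarith
  exact ⟨fun S hS h7 i h => key S hS h7 _ h.lt_num,
    fun S hS h7 h => key S hS h7 _ (h.lt_special (Or.inl ⟨rfl, rfl, rfl⟩)),
    fun S hS h7 h => key S hS h7 _ (h.lt_special (Or.inr ⟨rfl, rfl, rfl⟩))⟩

end SeqModel

end

theorem mainTheorem1 :
    (∃ d L H w C : ℕ, 8 < d ∧ ∀ n : ℕ, 1 ≤ n →
      ∃ p : ℕ, Odd p ∧ p ≤ C * (Nat.log 2 n + 1) ∧
        ∃ T : SeqModel.Transformer p d L H w,
          ∀ τ : (SeqModel.Token n → ℝ) → SeqModel.Token n, SeqModel.IsArgmax τ →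
            SeqModel.SolvesIsTreeWithin n (T.lm (SeqModel.stdEmbedding n d)) τ (C * n)) ∧
    (∀ (p Λ d : ℕ → ℕ) (E : ∀ n, SeqModel.Embedding (SeqModel.Token n) (d n))
      (R : ∀ n, SeqModel.RNN (p n) (Λ n) (d n)),
      (fun n => ((Λ n * p n : ℕ) : ℝ)) =o[atTop] (fun n => (n : ℝ)) →
        ∀ᶠ n in atTop, ∀ τ : (SeqModel.Token n → ℝ) → SeqModel.Token n, SeqModel.IsArgmax τ →
          ¬ SeqModel.SolvesIsTree n ((R n).lm (E n)) τ) := by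
  refine ⟨?_, fun p Λ d E R h => ?_⟩
  · obtain ⟨C, hC⟩ := SeqModel.exists_transformer
    refine ⟨64, 11, 1, 16, max C 3, by norm_num, fun n hn => ?_⟩
    obtain ⟨p, hp, hpC, T, hT⟩ := hC n hn
    refine ⟨p, hp, hpC.trans (Nat.mul_le_mul_right _ (le_max_left _ _)), T, fun τ hτ G E hE => ?_⟩
    obtain ⟨i, hi, h⟩ := (hT τ hτ).solvesIsTreeWithin hn G E hE
    exact ⟨i, hi.trans (Nat.mul_le_mul_right _ (le_max_right _ _)), h⟩
  · filter_upwards [SeqModel.eventually_not_solvesIsTree p Λ d E R h] with n hn τ _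
    exact hn τ
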